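/- Let $\lambda>3$ be an integer, let $\mathbb D=\{Z\in Mat_{2\times2}(\mathbb C): E-Z^*Z>0\}$ with the probability measure $d\mu_\lambda(Z)=\pi^{-4}(\lambda-1)(\lambda-2)^2(\lambda-3)\,[\det(E-Z^*Z)]^{\lambda-4}\,|dZ|$, where $|dZ|$ is Lebesgue measure, and let $L^2\mathcal O(\mathbb D,d\mu_\lambda)$ be the Hilbert space of square integrable holomorphic functions on $\mathbb D$. Let $\mathcal H$ be a complex Hilbert space identified with it by an anti-linear unitary $I:\mathcal H\to L^2\mathcal O(\mathbb D,d\mu_\lambda)$, and let the coherent state $|Z\rangle\in\mathcal H$, $Z\in\mathbb D$, be the vector with $\langle\psi|Z\rangle=(I\psi)(Z)$ for all $\psi\in\mathcal H$. For a bounded holomorphic function $f\in H^\infty(\mathbb D)$ let $a(f)$ be the unique bounded operator on $\mathcal H$ with $a(f)|Z\rangle=f(Z)|Z\rangle$ for all $Z\in\mathbb D$. Put $\mathcal P^{++}=a(H^\infty(\mathbb D))$; let $\mathcal P^{++}_{pol}$ be the norm-closed unital algebra generated by the four operators $a_{kl}=a(z_{kl})$, $k,l=1,2$; let $\mathcal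 M^{++}$ and $\mathcal M^{++}_{pol}$ be the $C^*$-algebras generated by $\mathcal P^{++}$ and $\mathcal P^{++}_{pol}$ respectively; and for a set $\mathcal P$ of operators write $\overline{\mathcal P}=\{x^*:x\in\mathcal P\}$. Let $L^0(\mathcal H)$ be the set of compact operators, and for a $C^*$-algebra $\mathcal M$ of operators let $Comm\,\mathcal M$ be its commutator ideal, i.e. the closed two-sided ideal of $\mathcal M$ generated by all commutators $xy-yx$, $x,y\in\mathcal M$. Then: (i) $\mathcal M^{++}_{pol}$ acts irreducibly on $\mathcal H$, and $\mathcal P^{++}_{pol}\cap\overline{\mathcal P^{++}_{pol}}=\mathbb C\,\mathbb I$. (ii) $\mathcal M^{++}_{pol}$ is dense in $B(\mathcal H)$ in the weak and in the strong operator topology. (iii) $\mathcal M^{++}_{pol}$ contains $L^0(\mathcal H)$, and so does every closed two-sided ideal of $\mathcal M^{++}_{pol}$ that acts irreducibly on $\mathcal H$. (iv) $\mathcal M^{++}_{pol}$ is conformally invariant: there is a unitary representation $U_\lambda$ of $SU(2,2)=\{g\in SL(4,\mathbb C): g^*\eta g=\eta\}$, $\eta=\mathrm{diag}(1,1,-1,-1)$,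 on $\mathcal H$ (the discrete series representation), determined by $(I\,U_\lambda(g)\psi)(Z)=[\det(CZ+D)]^{-\lambda}\,(I\psi)\big((AZ+B)(CZ+D)^{-1}\big)$ for $Z\in\mathbb D$, $\psi\in\mathcal H$, $g^{-1}=\begin{pmatrix}A&B\\C&D\end{pmatrix}$, and $U_\lambda(g)\,\mathcal M^{++}_{pol}\,U_\lambda(g)^*\subset\mathcal M^{++}_{pol}$ for all $g\in SU(2,2)$. (v) $\mathcal P^{++}_{pol}\cap L^0(\mathcal H)=\{0\}$. (vi) $L^0(\mathcal H)\subsetneq Comm\,\mathcal M^{++}_{pol}$. (vii) Statements (i), (ii), (iii), (v) and (vi) also hold with $\mathcal M^{++}$ and $\mathcal P^{++}$ in place of $\mathcal M^{++}_{pol}$ and $\mathcal P^{++}_{pol}$. -/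

import Mathlib

open MeasureTheory Filter Topology Metric
open scoped ComplexOrder ENNReal InnerProductSpace

noncomputable section
namespace ConformalToeplitz

/-- `2 × 2` complex matrices `Z = (z_{kl})`, as a normed space with its Lebesgue measure. -/
abbrev Mat2 : Type := Fin 2 → Fin 2 → ℂ

/-- The symmetric domain `𝔻 = {Z : E - Z* Z > 0}`. -/
def domainD : Set Mat2 :=
  {Z | (1 - (Matrix.of Z).conjTranspose * Matrix.of Z).PosDef}

/-- `det (E - Z* Z)`; it is real, since the matrix is Hermitian. -/
def weight (Z : Mat2) : ℝ :=
  (1 - (Matrix.of Z).conjTranspose * Matrix.of Z).det.re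

/-- The normalizing constant `c_λ = π⁻⁴ (λ - 1) (λ - 2)² (λ - 3)`. -/
def cConst (lam : ℕ) : ℝ :=
  (Real.pi ^ 4)⁻¹ * ((lam : ℝ) - 1) * ((lam : ℝ) - 2) ^ 2 * ((lam : ℝ) - 3)

/-- The measure `dμ_λ(Z) = c_λ det(E - Z* Z)^(λ-4) |dZ|` on `𝔻`, for an integer `λ > 3`. -/
def bergmanMeasure (lam : ℕ) : Measure Mat2 :=
  (volume.restrict domainD).withDensity
    fun Z => ENNReal.ofReal (cConst lam * weight Z ^ (lam - 4))

lemma isOpen_domainD : IsOpen domainD := by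
  have hcont : Continuous fun p : Mat2 × (Fin 2 → ℂ) =>
      (star p.2 ⬝ᵥ ((1 - (Matrix.of p.1).conjTranspose * Matrix.of p.1).mulVec p.2)).re := by
    refine Complex.continuous_re.comp ?_
    simp only [dotProduct, Matrix.mulVec, Matrix.mul_apply, Matrix.sub_apply, Fin.sum_univ_two,
      Matrix.conjTranspose_apply, Matrix.of_apply, Pi.star_apply, Matrix.one_apply]
    fun_prop
  have hH : ∀ Z : Mat2, (1 - (Matrix.of Z).conjTranspose * Matrix.of Z).IsHermitian := fun Z =>
    Matrix.isHermitian_one.sub (Matrix.isHermitian_conjTranspose_mul_self _)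
  have hset : domainD = {Z | ∀ v ∈ sphere (0 : Fin 2 → ℂ) 1,
      0 < (star v ⬝ᵥ ((1 - (Matrix.of Z).conjTranspose * Matrix.of Z).mulVec v)).re} := by
    ext Z
    simp only [domainD, Set.mem_ofPred_eq]
    rw [Matrix.posDef_iff_dotProduct_mulVec]
    constructor
    · intro h v hv
      have hv0 : v ≠ 0 := by
        rintro rfl
        simp at hv
      exact (Complex.pos_iff.1 (h.2 hv0)).1
    · intro h
      refine ⟨hH Z, fun v hv => ?_⟩
      have hn : 0 < ‖v‖ := norm_pos_iff.2 hv
      have := h (((‖v‖⁻¹ : ℝ) : ℂ) • v) (by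
        rw [mem_sphere_zero_iff_norm, norm_smul, Complex.norm_real, norm_inv, norm_norm,
          inv_mul_cancel₀ hn.ne'])
      rw [Matrix.mulVec_smul, star_smul, smul_dotProduct, dotProduct_smul, smul_smul,
        Complex.star_def, Complex.conj_ofReal, ← Complex.ofReal_mul, smul_eq_mul,
        Complex.re_ofReal_mul] at this
      have h2 : 0 < ‖v‖⁻¹ * ‖v‖⁻¹ := by positivity
      refine Complex.pos_iff.2 ⟨(pos_iff_pos_of_mul_pos this).1 h2, ?_⟩
      exact ((hH Z).im_star_dotProduct_mulVec_self v).symm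
  rw [hset, isOpen_iff_mem_nhds]
  intro Z hZ
  have hev : ∀ v ∈ sphere (0 : Fin 2 → ℂ) 1, ∀ᶠ p in 𝓝 (Z, v), 0 < (star p.2 ⬝ᵥ
      ((1 - (Matrix.of p.1).conjTranspose * Matrix.of p.1).mulVec p.2)).re := fun v hv =>
    (isOpen_lt continuous_const hcont).mem_nhds (hZ v hv)
  exact (isCompact_sphere (0 : Fin 2 → ℂ) 1).eventually_forall_of_forall_eventually hev

lemma continuous_weight : Continuous weight := by
  unfold weight
  refine Complex.continuous_re.comp ?_
  simp only [Matrix.det_fin_two, Matrix.mul_apply, Matrix.sub_apply, Fin.sum_univ_two,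
      Matrix.conjTranspose_apply, Matrix.of_apply, Matrix.one_apply]
  fun_prop

lemma weight_pos {Z : Mat2} (hZ : Z ∈ domainD) : 0 < weight Z :=
  (Complex.pos_iff.1 (Matrix.PosDef.det_pos hZ)).1

lemma cConst_pos (lam : ℕ) [h : Fact (3 < lam)] : 0 < cConst lam := by
  have : (3 : ℝ) < lam := by exact_mod_cast h.out
  unfold cConst
  have h1 : (0 : ℝ) < (lam : ℝ) - 1 := by linarith
  have h2 : (0 : ℝ) < (lam : ℝ) - 2 := by linarith
  have h3 : (0 : ℝ) < (lam : ℝ) - 3 := by linarith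
  positivity

lemma measurePreserving_rotate (u : Circle) :
    MeasurePreserving (fun W : Mat2 => (u : ℂ) • W) := by
  have h1 : MeasurePreserving (fun z : ℂ => (u : ℂ) * z) :=
    (rotation u).measurePreserving
  exact volume_preserving_pi (fun _ : Fin 2 => volume_preserving_pi (fun _ : Fin 2 => h1))

/-- Sub-mean value property of `|f|²` over polydiscs. -/
lemma enorm_sq_mul_volume_le {U : Set Mat2} (hU : IsOpen U) {f : Mat2 → ℂ}
    (hf : DifferentiableOn ℂ f U) {Z : Mat2} {r : ℝ} (hr : closedBall Z r ⊆ U) :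
    ‖f Z‖ₑ ^ 2 * volume (ball (0 : Mat2) r) ≤ ∫⁻ W in ball Z r, ‖f W‖ₑ ^ 2 := by
  classical
  set h : Mat2 → ℂ := U.piecewise f 0 with hh
  have hmeas : Measurable h := by
    refine ContinuousOn.measurable_piecewise hf.continuousOn continuousOn_const hU.measurableSet
  have heq : ∀ W ∈ U, h W = f W := fun W hW => Set.piecewise_eq_of_mem _ _ _ hW
  have key : ∀ W ∈ ball (0 : Mat2) r, ENNReal.ofReal (2 * Real.pi) * ‖f Z‖ₑ ^ 2 ≤
      ∫⁻ t in Set.Ioc 0 (2 * Real.pi), ‖h (Z + (Circle.exp t : ℂ) • W)‖ₑ ^ 2 := by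
    intro W hW
    have hW' : ‖W‖ < r := by simpa using hW
    have hin : ∀ z : ℂ, ‖z‖ ≤ 1 → Z + z • W ∈ U := fun z hz => hr (by
      rw [mem_closedBall, dist_eq_norm, add_sub_cancel_left, norm_smul]
      nlinarith [norm_nonneg W, norm_nonneg z])
    have hd : DiffContOnCl ℂ (fun z : ℂ => f (Z + z • W) ^ 2) (ball 0 |1|) := by
      apply DifferentiableOn.diffContOnCl
      intro z hz
      rw [abs_one, closure_ball _ one_ne_zero] at hz
      have hz' : ‖z‖ ≤ 1 := by simpa using hz
      refine DifferentiableAt.differentiableWithinAt ?_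
      have h1 : DifferentiableAt ℂ f (Z + z • W) :=
        (hf _ (hin z hz')).differentiableAt (hU.mem_nhds (hin z hz'))
      exact (h1.comp z (by fun_prop)).pow 2
    have hav := hd.circleAverage
    rw [Real.circleAverage_def] at hav
    simp only [zero_smul, add_zero] at hav
    have hpi : (0 : ℝ) < 2 * Real.pi := by positivity
    have h2 : (∫ t in (0)..(2 * Real.pi), f (Z + circleMap 0 1 t • W) ^ 2)
        = (2 * Real.pi : ℝ) • f Z ^ 2 := by
      rw [← hav, smul_smul, mul_inv_cancel₀ hpi.ne', one_smul]
    rw [intervalIntegral.integral_of_le hpi.le] at h2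
    have h3 := enorm_integral_le_lintegral_enorm (μ := volume.restrict (Set.Ioc 0 (2 * Real.pi)))
      (fun t => f (Z + circleMap 0 1 t • W) ^ 2)
    rw [h2, enorm_smul, enorm_pow] at h3
    rw [Real.enorm_of_nonneg hpi.le] at h3
    refine h3.trans (le_of_eq ?_)
    refine lintegral_congr fun t => ?_
    have hc : circleMap 0 1 t = (Circle.exp t : ℂ) := by simp [circleMap]
    rw [hc, heq _ (hin _ (by simp)), enorm_pow]
  have hjoint : Measurable fun p : Mat2 × ℝ => ‖h (Z + (Circle.exp p.2 : ℂ) • p.1)‖ₑ ^ 2 := by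
    refine ((hmeas.comp ?_).enorm).pow_const 2
    have : Continuous fun p : Mat2 × ℝ => Z + (Circle.exp p.2 : ℂ) • p.1 := by fun_prop
    exact this.measurable
  have hrot : ∀ t : ℝ, ∫⁻ W in ball (0 : Mat2) r, ‖h (Z + (Circle.exp t : ℂ) • W)‖ₑ ^ 2
      = ∫⁻ W in ball Z r, ‖f W‖ₑ ^ 2 := by
    intro t
    have hm : Measurable fun W : Mat2 => ‖h (Z + W)‖ₑ ^ 2 :=
      ((hmeas.comp (measurable_const_add Z)).enorm).pow_const 2
    have e1 := (measurePreserving_rotate (Circle.exp t)).setLIntegral_comp_preimage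
      (s := ball (0 : Mat2) r) measurableSet_ball hm
    have p1 : (fun W : Mat2 => (Circle.exp t : ℂ) • W) ⁻¹' ball 0 r = ball 0 r := by
      ext W; simp [norm_smul]
    rw [p1] at e1
    rw [e1]
    have e2 := (measurePreserving_add_left (volume : Measure Mat2) Z).setLIntegral_comp_preimage
      (s := ball Z r) measurableSet_ball ((hmeas.enorm).pow_const 2)
    have p2 : (fun W : Mat2 => Z + W) ⁻¹' ball Z r = ball 0 r := by
      ext W; simp [dist_eq_norm]
    rw [p2] at e2
    rw [e2]
    refine setLIntegral_congr_fun measurableSet_ball fun W hW => ?_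
    simp only [heq W (hr (ball_subset_closedBall hW))]
  have hpi : (0 : ℝ) < 2 * Real.pi := by positivity
  have step : ENNReal.ofReal (2 * Real.pi) * (‖f Z‖ₑ ^ 2 * volume (ball (0 : Mat2) r)) ≤
      ENNReal.ofReal (2 * Real.pi) * ∫⁻ W in ball Z r, ‖f W‖ₑ ^ 2 := by
    calc ENNReal.ofReal (2 * Real.pi) * (‖f Z‖ₑ ^ 2 * volume (ball (0 : Mat2) r))
        = ∫⁻ W in ball (0 : Mat2) r, ENNReal.ofReal (2 * Real.pi) * ‖f Z‖ₑ ^ 2 := by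
          rw [setLIntegral_const, mul_assoc]
      _ ≤ ∫⁻ W in ball (0 : Mat2) r, ∫⁻ t in Set.Ioc 0 (2 * Real.pi),
            ‖h (Z + (Circle.exp t : ℂ) • W)‖ₑ ^ 2 :=
          setLIntegral_mono' measurableSet_ball key
      _ = ∫⁻ t in Set.Ioc 0 (2 * Real.pi), ∫⁻ W in ball (0 : Mat2) r,
            ‖h (Z + (Circle.exp t : ℂ) • W)‖ₑ ^ 2 :=
          lintegral_lintegral_swap hjoint.aemeasurable
      _ = ENNReal.ofReal (2 * Real.pi) * ∫⁻ W in ball Z r, ‖f W‖ₑ ^ 2 := by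
          simp only [hrot]
          rw [setLIntegral_const, Real.volume_Ioc, sub_zero, mul_comm]
  exact (ENNReal.mul_le_mul_iff_right (by simpa using hpi) ENNReal.ofReal_ne_top).1 step

/-- Uniform local bound of a holomorphic function by its norm in `L²(𝔻, dμ_λ)`. -/
lemma exists_local_bound (lam : ℕ) [Fact (3 < lam)] {Z₀ : Mat2} (hZ₀ : Z₀ ∈ domainD) :
    ∃ r > 0, ∃ C : ℝ, 0 ≤ C ∧ ball Z₀ r ⊆ domainD ∧ ∀ f : Mat2 → ℂ,
      DifferentiableOn ℂ f domainD → ∀ Z ∈ ball Z₀ r,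
        ‖f Z‖ₑ ≤ ENNReal.ofReal C * eLpNorm f 2 (bergmanMeasure lam) := by
  obtain ⟨R, hR, hRU⟩ := nhds_basis_closedBall.mem_iff.1 (isOpen_domainD.mem_nhds hZ₀)
  set w : Mat2 → ℝ := fun Z => cConst lam * weight Z ^ (lam - 4) with hw
  have hwc : Continuous w := continuous_const.mul (continuous_weight.pow _)
  have hwpos : ∀ Z ∈ domainD, 0 < w Z := fun Z hZ =>
    mul_pos (cConst_pos lam) (pow_pos (weight_pos hZ) _)
  obtain ⟨Z₁, hZ₁, hmin⟩ := (isCompact_closedBall Z₀ R).exists_isMinOn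
    ⟨Z₀, mem_closedBall_self hR.le⟩ hwc.continuousOn
  set m : ℝ := w Z₁
  have hm : 0 < m := hwpos _ (hRU hZ₁)
  set r : ℝ := R / 2 with hr
  have hrpos : 0 < r := by positivity
  set V : ℝ := (volume (ball (0 : Mat2) r)).toReal
  have hVfin : volume (ball (0 : Mat2) r) ≠ ∞ := measure_ball_lt_top.ne
  have hV : 0 < V := ENNReal.toReal_pos (measure_ball_pos _ _ hrpos).ne' hVfin
  refine ⟨r, hrpos, Real.sqrt ((m * V)⁻¹), Real.sqrt_nonneg _, fun Z hZ => hRU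
    (ball_subset_closedBall (ball_subset_ball (by linarith) hZ)), fun f hf Z hZ => ?_⟩
  have hsub : closedBall Z r ⊆ closedBall Z₀ R := by
    intro W hW
    rw [mem_closedBall] at *
    rw [mem_ball] at hZ
    linarith [dist_triangle W Z Z₀]
  have h1 := enorm_sq_mul_volume_le isOpen_domainD hf (hsub.trans hRU)
  have h2 : ENNReal.ofReal m * ∫⁻ W in ball Z r, ‖f W‖ₑ ^ 2 ≤
      ∫⁻ W, ‖f W‖ₑ ^ 2 ∂(bergmanMeasure lam) := by
    unfold bergmanMeasure
    rw [lintegral_withDensity_eq_lintegral_mul_non_measurable _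
      (hwc.measurable.ennreal_ofReal) (Eventually.of_forall fun _ => ENNReal.ofReal_lt_top)]
    rw [← lintegral_const_mul' _ _ ENNReal.ofReal_ne_top]
    calc ∫⁻ W in ball Z r, ENNReal.ofReal m * ‖f W‖ₑ ^ 2
        ≤ ∫⁻ W in ball Z r, ENNReal.ofReal (w W) * ‖f W‖ₑ ^ 2 := by
          refine setLIntegral_mono' measurableSet_ball fun W hW => ?_
          gcongr
          exact hmin (hsub (ball_subset_closedBall hW))
      _ ≤ ∫⁻ W in domainD, ENNReal.ofReal (w W) * ‖f W‖ₑ ^ 2 :=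
          lintegral_mono_set ((ball_subset_closedBall.trans hsub).trans hRU)
      _ = _ := rfl
  have h3 : eLpNorm f 2 (bergmanMeasure lam) ^ 2 = ∫⁻ W, ‖f W‖ₑ ^ 2 ∂(bergmanMeasure lam) := by
    rw [eLpNorm_eq_lintegral_rpow_enorm_toReal (by norm_num) (by norm_num)]
    simp only [ENNReal.toReal_ofNat, ENNReal.rpow_ofNat]
    rw [← ENNReal.rpow_natCast, ← ENNReal.rpow_mul]
    norm_num
  have h4 : ENNReal.ofReal (m * V) * ‖f Z‖ₑ ^ 2 ≤ eLpNorm f 2 (bergmanMeasure lam) ^ 2 := by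
    rw [h3]
    refine le_trans ?_ h2
    rw [ENNReal.ofReal_mul hm.le, mul_assoc]
    gcongr
    rw [ENNReal.ofReal_toReal hVfin, mul_comm]
    exact h1
  have hmV : 0 < m * V := mul_pos hm hV
  have h5 : ‖f Z‖ₑ ^ 2 ≤ (ENNReal.ofReal (Real.sqrt ((m * V)⁻¹)) *
      eLpNorm f 2 (bergmanMeasure lam)) ^ 2 := by
    rw [mul_pow, ← ENNReal.ofReal_pow (Real.sqrt_nonneg _), Real.sq_sqrt (by positivity),
      ENNReal.ofReal_inv_of_pos hmV]
    have h6 : ENNReal.ofReal (m * V) ≠ 0 := by simpa using hmV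
    calc ‖f Z‖ₑ ^ 2 = (ENNReal.ofReal (m * V))⁻¹ * (ENNReal.ofReal (m * V) * ‖f Z‖ₑ ^ 2) := by
          rw [← mul_assoc, ENNReal.inv_mul_cancel h6 ENNReal.ofReal_ne_top, one_mul]
      _ ≤ _ := by gcongr
  exact (ENNReal.pow_le_pow_left_iff two_ne_zero).1 h5

/-- Two holomorphic functions on `𝔻` that agree almost everywhere agree on `𝔻`. -/
lemma eqOn_of_ae_eq (lam : ℕ) [Fact (3 < lam)] {f g : Mat2 → ℂ}
    (hf : DifferentiableOn ℂ f domainD) (hg : DifferentiableOn ℂ g domainD)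
    (h : f =ᵐ[bergmanMeasure lam] g) : Set.EqOn f g domainD := by
  intro Z hZ
  obtain ⟨r, hr, C, hC, hsub, hb⟩ := exists_local_bound lam hZ
  have h1 := hb (f - g) (hf.sub hg) Z (mem_ball_self hr)
  have h2 : eLpNorm (f - g) 2 (bergmanMeasure lam) = 0 := by
    rw [eLpNorm_congr_ae (g := 0), eLpNorm_zero]
    filter_upwards [h] with W hW using by simp [hW]
  rw [h2, mul_zero] at h1
  have h3 : f Z - g Z = 0 := by simpa using h1
  exact sub_eq_zero.1 h3

/-- A pointwise limit on `𝔻` of a sequence of holomorphic functions that is locally uniformly Cauchy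
is holomorphic. -/
lemma differentiableOn_of_locally_cauchy {F : ℕ → Mat2 → ℂ} {f : Mat2 → ℂ} {Z₀ : Mat2} {r : ℝ}
    (hr : 0 < r) (hF : ∀ n, DifferentiableOn ℂ (F n) (ball Z₀ r))
    (hc : UniformCauchySeqOn F atTop (ball Z₀ r))
    (hlim : ∀ Z ∈ ball Z₀ r, Tendsto (fun n => F n Z) atTop (𝓝 (f Z))) :
    DifferentiableAt ℂ f Z₀ := by
  have hs2 : ball Z₀ (r / 2) ⊆ ball Z₀ r := ball_subset_ball (by linarith)
  have hdiff : ∀ n, ∀ Z ∈ ball Z₀ r, DifferentiableAt ℂ (F n) Z := fun n Z hZ =>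
    (hF n Z hZ).differentiableAt (isOpen_ball.mem_nhds hZ)
  have hbound : ∀ G : Mat2 → ℂ, DifferentiableOn ℂ G (ball Z₀ r) → ∀ C : ℝ, 0 ≤ C →
      (∀ Z ∈ ball Z₀ r, ‖G Z‖ ≤ C) → ∀ Z ∈ ball Z₀ (r / 2), ‖fderiv ℂ G Z‖ ≤ C / (r / 4) := by
    intro G hG C hC hGC Z hZ
    refine ContinuousLinearMap.opNorm_le_of_unit_norm (𝕜 := ℂ) (by positivity) fun v hv => ?_
    have hin : ∀ t : ℂ, ‖t‖ ≤ r / 4 → Z + t • v ∈ ball Z₀ r := fun t ht => by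
      rw [mem_ball, dist_eq_norm] at hZ ⊢
      have h1 : ‖Z + t • v - Z₀‖ ≤ ‖Z - Z₀‖ + ‖t • v‖ := by
        rw [add_sub_right_comm]
        exact norm_add_le _ _
      rw [norm_smul, hv, mul_one] at h1
      linarith
    have hGd : ∀ t : ℂ, ‖t‖ ≤ r / 4 → HasDerivAt (fun t : ℂ => G (Z + t • v))
        (fderiv ℂ G (Z + t • v) v) t := fun t ht => by
      have h1 := ((hG _ (hin t ht)).differentiableAt
        (isOpen_ball.mem_nhds (hin t ht))).hasFDerivAt
      have h2 : HasDerivAt (fun t : ℂ => Z + t • v) v t := by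
        simpa using ((hasDerivAt_id t).smul_const v).const_add Z
      exact h1.comp_hasDerivAt t h2
    have h3 : DiffContOnCl ℂ (fun t : ℂ => G (Z + t • v)) (ball 0 (r / 4)) := by
      apply DifferentiableOn.diffContOnCl
      intro t ht
      rw [closure_ball _ (by positivity), mem_closedBall_zero_iff] at ht
      exact (hGd t ht).differentiableAt.differentiableWithinAt
    have h4 := Complex.norm_deriv_le_of_forall_mem_sphere_norm_le (by positivity : 0 < r / 4) h3
      (fun t ht => hGC _ (hin t (mem_sphere_zero_iff_norm.1 ht).le))
    rw [(hGd 0 (by rw [norm_zero]; positivity)).deriv] at h4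
    simpa using h4
  have hcd : UniformCauchySeqOn (fun n => fderiv ℂ (F n)) atTop (ball Z₀ (r / 2)) := by
    rw [Metric.uniformCauchySeqOn_iff] at hc ⊢
    intro ε hε
    obtain ⟨N, hN⟩ := hc (ε * (r / 4) / 2) (by positivity)
    refine ⟨N, fun p hp q hq Z hZ => ?_⟩
    have h1 := hbound (F p - F q) ((hF p).sub (hF q)) (ε * (r / 4) / 2) (by positivity)
      (fun W hW => by
        have := hN p hp q hq W hW
        rw [dist_eq_norm] at this
        exact this.le) Z hZ
    rw [fderiv_sub (hdiff p Z (hs2 hZ)) (hdiff q Z (hs2 hZ))] at h1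
    rw [dist_eq_norm]
    refine h1.trans_lt ?_
    rw [div_lt_iff₀ (by positivity)]
    have : 0 < ε * (r / 4) := by positivity
    linarith
  have hlimd : ∀ Z ∈ ball Z₀ (r / 2), ∃ L, Tendsto (fun n => fderiv ℂ (F n) Z) atTop (𝓝 L) :=
    fun Z hZ => cauchySeq_tendsto_of_complete (hcd.cauchySeq hZ)
  choose! L hL using hlimd
  have hun : TendstoUniformlyOn (fun n => fderiv ℂ (F n)) L atTop (ball Z₀ (r / 2)) :=
    hcd.tendstoUniformlyOn_of_tendsto hL
  exact (hasFDerivAt_of_tendstoUniformlyOn isOpen_ball hun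
    (fun n Z hZ => (hdiff n Z (hs2 hZ)).hasFDerivAt) (fun Z hZ => hlim Z (hs2 hZ))
    (mem_ball_self (by positivity))).differentiableAt

/-- The Hilbert space `L²𝒪(𝔻, dμ_λ)` of (classes of) square integrable holomorphic functions. -/
def bergmanSpace (lam : ℕ) : Submodule ℂ (Lp ℂ 2 (bergmanMeasure lam)) where
  carrier := {ψ | ∃ f : Mat2 → ℂ, DifferentiableOn ℂ f domainD ∧ ψ =ᵐ[bergmanMeasure lam] f}
  add_mem' := by
    rintro ψ φ ⟨f, hf, hψ⟩ ⟨g, hg, hφ⟩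
    exact ⟨f + g, hf.add hg, (Lp.coeFn_add ψ φ).trans (hψ.add hφ)⟩
  zero_mem' := ⟨0, differentiableOn_const 0, Lp.coeFn_zero _ _ _⟩
  smul_mem' := by
    rintro c ψ ⟨f, hf, hψ⟩
    exact ⟨c • f, hf.const_smul c, (Lp.coeFn_smul c ψ).trans (hψ.const_smul c)⟩

/-- The holomorphic function on `𝔻` representing an element of `L²𝒪(𝔻, dμ_λ)`. -/
def holFun {lam : ℕ} (ψ : bergmanSpace lam) : Mat2 → ℂ := ψ.2.choose

lemma differentiableOn_holFun {lam : ℕ} (ψ : bergmanSpace lam) :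
    DifferentiableOn ℂ (holFun ψ) domainD := ψ.2.choose_spec.1

lemma ae_eq_holFun {lam : ℕ} (ψ : bergmanSpace lam) :
    (ψ : Lp ℂ 2 (bergmanMeasure lam)) =ᵐ[bergmanMeasure lam] holFun ψ := ψ.2.choose_spec.2

lemma holFun_add {lam : ℕ} [Fact (3 < lam)] (ψ φ : bergmanSpace lam) {Z : Mat2}
    (hZ : Z ∈ domainD) : holFun (ψ + φ) Z = holFun ψ Z + holFun φ Z :=
  eqOn_of_ae_eq lam (differentiableOn_holFun _)
    ((differentiableOn_holFun ψ).add (differentiableOn_holFun φ))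
    ((ae_eq_holFun (ψ + φ)).symm.trans ((Lp.coeFn_add _ _).trans
      ((ae_eq_holFun ψ).add (ae_eq_holFun φ)))) hZ

lemma holFun_smul {lam : ℕ} [Fact (3 < lam)] (c : ℂ) (ψ : bergmanSpace lam) {Z : Mat2}
    (hZ : Z ∈ domainD) : holFun (c • ψ) Z = c * holFun ψ Z :=
  eqOn_of_ae_eq lam (differentiableOn_holFun _)
    ((differentiableOn_holFun ψ).const_smul c)
    ((ae_eq_holFun (c • ψ)).symm.trans ((Lp.coeFn_smul _ _).trans
      ((ae_eq_holFun ψ).const_smul c))) hZ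

lemma exists_norm_holFun_le (lam : ℕ) [Fact (3 < lam)] {Z₀ : Mat2} (hZ₀ : Z₀ ∈ domainD) :
    ∃ r > 0, ∃ C : ℝ, 0 ≤ C ∧ ball Z₀ r ⊆ domainD ∧ ∀ ψ : bergmanSpace lam,
      ∀ Z ∈ ball Z₀ r, ‖holFun ψ Z‖ ≤ C * ‖ψ‖ := by
  obtain ⟨r, hr, C, hC, hsub, hb⟩ := exists_local_bound lam hZ₀
  refine ⟨r, hr, C, hC, hsub, fun ψ Z hZ => ?_⟩
  have h1 := hb _ (differentiableOn_holFun ψ) Z hZ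
  rw [← eLpNorm_congr_ae (ae_eq_holFun ψ), ← Lp.enorm_def] at h1
  have h2 : ENNReal.ofReal ‖holFun ψ Z‖ ≤ ENNReal.ofReal (C * ‖ψ‖) := by
    rw [ENNReal.ofReal_mul hC, ofReal_norm, Submodule.coe_norm, ofReal_norm]
    exact h1
  exact (ENNReal.ofReal_le_ofReal_iff (by positivity)).1 h2

lemma isClosed_bergmanSpace (lam : ℕ) [Fact (3 < lam)] :
    IsClosed (bergmanSpace lam : Set (Lp ℂ 2 (bergmanMeasure lam))) := by
  refine IsSeqClosed.isClosed fun ψ ψ₀ hψ hlim => ?_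
  set Ψ : ℕ → bergmanSpace lam := fun n => ⟨ψ n, hψ n⟩
  have hsubv : ∀ p q : ℕ, ∀ Z ∈ domainD, holFun (Ψ p - Ψ q) Z = holFun (Ψ p) Z - holFun (Ψ q) Z := by
    intro p q Z hZ
    have := holFun_add (Ψ p - Ψ q) (Ψ q) hZ
    rw [sub_add_cancel] at this
    rw [this, add_sub_cancel_right]
  have hcau := Metric.cauchySeq_iff.1 hlim.cauchySeq
  have hloc : ∀ Z₀ ∈ domainD, ∃ r > 0, ball Z₀ r ⊆ domainD ∧
      UniformCauchySeqOn (fun n => holFun (Ψ n)) atTop (ball Z₀ r) := by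
    intro Z₀ hZ₀
    obtain ⟨r, hr, C, hC, hsub, hb⟩ := exists_norm_holFun_le lam hZ₀
    refine ⟨r, hr, hsub, Metric.uniformCauchySeqOn_iff.2 fun ε hε => ?_⟩
    obtain ⟨N, hN⟩ := hcau (ε / (C + 1)) (by positivity)
    refine ⟨N, fun p hp q hq Z hZ => ?_⟩
    have h1 := hb (Ψ p - Ψ q) Z hZ
    rw [hsubv p q Z (hsub hZ)] at h1
    have h2 := hN p hp q hq
    rw [dist_eq_norm] at h2 ⊢
    have h3 : ‖Ψ p - Ψ q‖ = ‖ψ p - ψ q‖ := rfl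
    rw [h3] at h1
    rw [lt_div_iff₀ (by positivity)] at h2
    nlinarith [norm_nonneg (ψ p - ψ q)]
  have hpt : ∀ Z ∈ domainD, ∃ a, Tendsto (fun n => holFun (Ψ n) Z) atTop (𝓝 a) := by
    intro Z hZ
    obtain ⟨r, hr, hsub, hc⟩ := hloc Z hZ
    exact cauchySeq_tendsto_of_complete (hc.cauchySeq (mem_ball_self hr))
  choose! f hf using hpt
  refine ⟨f, fun Z hZ => ?_, ?_⟩
  · obtain ⟨r, hr, hsub, hc⟩ := hloc Z hZ
    exact (differentiableOn_of_locally_cauchy hr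
      (fun n => (differentiableOn_holFun _).mono hsub) hc
      (fun W hW => hf W (hsub hW))).differentiableWithinAt
  · obtain ⟨ns, hns, hae⟩ := (tendstoInMeasure_of_tendsto_Lp hlim).exists_seq_tendsto_ae
    have h1 : ∀ᵐ Z ∂(bergmanMeasure lam), ∀ n, ψ n Z = holFun (Ψ n) Z :=
      ae_all_iff.2 fun n => ae_eq_holFun (Ψ n)
    have h2 : ∀ᵐ Z ∂(bergmanMeasure lam), Z ∈ domainD :=
      (withDensity_absolutelyContinuous _ _).ae_le (ae_restrict_mem isOpen_domainD.measurableSet)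
    filter_upwards [hae, h1, h2] with Z h3 h4 h5
    refine tendsto_nhds_unique h3 ?_
    simp only [h4]
    exact (hf Z h5).comp hns.tendsto_atTop

instance instCompleteSpaceBergmanSpace (lam : ℕ) [Fact (3 < lam)] :
    CompleteSpace (bergmanSpace lam) :=
  (isClosed_bergmanSpace lam).completeSpace_coe

/-- Evaluation `ψ ↦ ψ(Z)` at a point `Z ∈ 𝔻`, a bounded linear functional on `L²𝒪(𝔻, dμ_λ)`. -/
def evalAt (lam : ℕ) [Fact (3 < lam)] (Z : domainD) : bergmanSpace lam →L[ℂ] ℂ :=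
  LinearMap.mkContinuousOfExistsBound
    { toFun := fun ψ => holFun ψ Z
      map_add' := fun ψ φ => holFun_add ψ φ Z.2
      map_smul' := fun c ψ => holFun_smul c ψ Z.2 }
    (by
      obtain ⟨r, hr, C, hC, hsub, hb⟩ := exists_norm_holFun_le lam Z.2
      exact ⟨C, fun ψ => hb ψ Z (mem_ball_self hr)⟩)

/-- The reproducing kernel `k_Z ∈ L²𝒪(𝔻, dμ_λ)`, i.e. `⟨k_Z, ψ⟩ = ψ(Z)` for every `ψ`. -/
def reproducingKernel (lam : ℕ) [Fact (3 < lam)] (Z : domainD) : bergmanSpace lam :=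
  (InnerProductSpace.toDual ℂ (bergmanSpace lam)).symm (evalAt lam Z)

lemma inner_reproducingKernel (lam : ℕ) [Fact (3 < lam)] (Z : domainD) (ψ : bergmanSpace lam) :
    ⟪reproducingKernel lam Z, ψ⟫_ℂ = holFun ψ Z := by
  rw [reproducingKernel, InnerProductSpace.toDual_symm_apply]
  rfl

/-- An anti-linear isometry satisfies `⟨I x, I y⟩ = ⟨y, x⟩`. -/
lemma inner_map_map_conj {lam : ℕ} {H : Type*} [NormedAddCommGroup H]
    [InnerProductSpace ℂ H] (I : H ≃ₗᵢ⋆[ℂ] bergmanSpace lam) (x y : H) :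
    ⟪I x, I y⟫_ℂ = ⟪y, x⟫_ℂ := by
  have hI : (RCLike.I : ℂ) = Complex.I := rfl
  have hs : I (Complex.I • y) = -(Complex.I • I y) := by
    rw [map_smulₛₗ, Complex.conj_I, neg_smul]
  rw [inner_eq_sum_norm_sq_div_four (I x) (I y), inner_eq_sum_norm_sq_div_four y x]
  have e1 : ‖I x + I y‖ = ‖y + x‖ := by rw [← map_add, I.norm_map, add_comm]
  have e2 : ‖I x - I y‖ = ‖y - x‖ := by rw [← map_sub, I.norm_map, norm_sub_rev]
  have e3 : ‖I x - (RCLike.I : ℂ) • I y‖ = ‖y - (RCLike.I : ℂ) • x‖ := by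
    have h1 : I x - Complex.I • I y = I (x + Complex.I • y) := by
      rw [map_add, hs, sub_eq_add_neg]
    have h2 : x + Complex.I • y = Complex.I • (y - Complex.I • x) := by
      rw [smul_sub, smul_smul, Complex.I_mul_I, neg_one_smul, sub_neg_eq_add, add_comm]
    rw [hI, h1, I.norm_map, h2, norm_smul, Complex.norm_I, one_mul]
  have e4 : ‖I x + (RCLike.I : ℂ) • I y‖ = ‖y + (RCLike.I : ℂ) • x‖ := by
    have h1 : I x + Complex.I • I y = I (x - Complex.I • y) := by
      rw [map_sub, hs, sub_neg_eq_add]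
    have h2 : x - Complex.I • y = -(Complex.I • (y + Complex.I • x)) := by
      rw [smul_add, smul_smul, Complex.I_mul_I, neg_one_smul, neg_add, neg_neg, sub_eq_add_neg,
        add_comm]
    rw [hI, h1, I.norm_map, h2, norm_neg, norm_smul, Complex.norm_I, one_mul]
  rw [e1, e2, e3, e4]

section QuantumPhaseSpace

variable {lam : ℕ} [Fact (3 < lam)] {H : Type*} [NormedAddCommGroup H] [InnerProductSpace ℂ H]

/-- The coherent state `|Z⟩ ∈ ℋ`, where the anti-linear unitary `I : ℋ → L²𝒪(𝔻, dμ_λ)` identifies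
`ψ ∈ ℋ` with the function `Z ↦ ⟨ψ | Z⟩` (see `inner_coherentState`). -/
def coherentState (I : H ≃ₗᵢ⋆[ℂ] bergmanSpace lam) (Z : domainD) : H :=
  I.symm (reproducingKernel lam Z)

lemma inner_coherentState (I : H ≃ₗᵢ⋆[ℂ] bergmanSpace lam) (ψ : H) (Z : domainD) :
    ⟪ψ, coherentState I Z⟫_ℂ = holFun (I ψ) Z := by
  rw [← inner_map_map_conj I, coherentState, I.apply_symm_apply, inner_reproducingKernel]

/-- The algebra `H^∞(𝔻)` of bounded holomorphic functions on `𝔻`. -/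
def boundedHolomorphic : Set (Mat2 → ℂ) :=
  {f | DifferentiableOn ℂ f domainD ∧ ∃ C : ℝ, ∀ Z ∈ domainD, ‖f Z‖ ≤ C}

/-- The four coordinate functions `f_{kl}(Z) = z_{kl}`. -/
def coordinateFunctions : Set (Mat2 → ℂ) :=
  {f | ∃ k l : Fin 2, f = fun Z => Z k l}

/-- The bounded operators `a(f)`, `f ∈ S`, determined by `a(f) |Z⟩ = f(Z) |Z⟩` for all `Z ∈ 𝔻`. -/
def annihilationOperators (I : H ≃ₗᵢ⋆[ℂ] bergmanSpace lam) (S : Set (Mat2 → ℂ)) :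
    Set (H →L[ℂ] H) :=
  {T | ∃ f ∈ S, ∀ Z : domainD, T (coherentState I Z) = f Z • coherentState I Z}

/-- The quantum Kähler polarization `𝒫⁺⁺ = a(H^∞(𝔻))`. -/
def polarization (I : H ≃ₗᵢ⋆[ℂ] bergmanSpace lam) : Set (H →L[ℂ] H) :=
  annihilationOperators I boundedHolomorphic

/-- `𝒫⁺⁺_pol`, the unital Banach algebra generated by the coordinate annihilation operators
`a_{kl} = a(f_{kl})`. -/
def polarizationPol (I : H ≃ₗᵢ⋆[ℂ] bergmanSpace lam) : Subalgebra ℂ (H →L[ℂ] H) :=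
  (Algebra.adjoin ℂ (annihilationOperators I coordinateFunctions)).topologicalClosure

/-- A set of operators acts irreducibly: `ℋ ≠ 0`, and `0` and `ℋ` are the only closed subspaces
invariant under all of them. -/
def ActsIrreducibly (A : Set (H →L[ℂ] H)) : Prop :=
  Nontrivial H ∧ ∀ K : Submodule ℂ H, IsClosed (K : Set H) →
    (∀ T ∈ A, ∀ x ∈ K, T x ∈ K) → K = ⊥ ∨ K = ⊤

/-- The set `L⁰(ℋ)` of compact operators. -/
def compactOperators (H : Type*) [NormedAddCommGroup H] [InnerProductSpace ℂ H] :
    Set (H →L[ℂ] H) :=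
  {T | IsCompactOperator T}

/-- The scalar operators `ℂ 𝕀`. -/
def scalarOperators (H : Type*) [NormedAddCommGroup H] [InnerProductSpace ℂ H] :
    Set (H →L[ℂ] H) :=
  Set.range fun c : ℂ => c • (1 : H →L[ℂ] H)

variable [CompleteSpace H]

/-- Every bounded holomorphic `f` gives rise to exactly one operator `a(f)`. -/
lemma existsUnique_annihilation (I : H ≃ₗᵢ⋆[ℂ] bergmanSpace lam) {f : Mat2 → ℂ}
    (hf : f ∈ boundedHolomorphic) :
    ∃! T : H →L[ℂ] H, ∀ Z : domainD, T (coherentState I Z) = f Z • coherentState I Z := by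
  obtain ⟨hfd, C, hC⟩ := hf
  have hae : ∀ᵐ Z ∂(bergmanMeasure lam), Z ∈ domainD :=
    (withDensity_absolutelyContinuous _ _).ae_le (ae_restrict_mem isOpen_domainD.measurableSet)
  have hfm : AEStronglyMeasurable f (bergmanMeasure lam) :=
    (hfd.continuousOn.aestronglyMeasurable isOpen_domainD.measurableSet).mono_ac
      (withDensity_absolutelyContinuous _ _)
  have hle : ∀ ψ : bergmanSpace lam, ∀ᵐ Z ∂(bergmanMeasure lam),
      ‖f Z * (ψ : Lp ℂ 2 (bergmanMeasure lam)) Z‖ ≤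
        C * ‖(ψ : Lp ℂ 2 (bergmanMeasure lam)) Z‖ := fun ψ => by
    filter_upwards [hae] with Z hZ
    rw [norm_mul]
    exact mul_le_mul_of_nonneg_right (hC Z hZ) (norm_nonneg _)
  have hmem : ∀ ψ : bergmanSpace lam,
      MemLp (fun Z => f Z * (ψ : Lp ℂ 2 (bergmanMeasure lam)) Z) 2 (bergmanMeasure lam) :=
    fun ψ => (Lp.memLp (ψ : Lp ℂ 2 (bergmanMeasure lam))).of_le_mul
      (hfm.mul (Lp.aestronglyMeasurable _)) (hle ψ)
  have hmul : ∀ ψ : bergmanSpace lam, (hmem ψ).toLp ∈ bergmanSpace lam := fun ψ =>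
    ⟨fun Z => f Z * holFun ψ Z, hfd.mul (differentiableOn_holFun ψ), by
      filter_upwards [(hmem ψ).coeFn_toLp, ae_eq_holFun ψ] with Z h1 h2
      rw [h1, h2]⟩
  have hhol : ∀ ψ : bergmanSpace lam, ∀ Z ∈ domainD,
      holFun (⟨(hmem ψ).toLp, hmul ψ⟩ : bergmanSpace lam) Z = f Z * holFun ψ Z := fun ψ Z hZ =>
    eqOn_of_ae_eq lam (differentiableOn_holFun _) (hfd.mul (differentiableOn_holFun ψ)) (by
      refine (ae_eq_holFun _).symm.trans ?_
      filter_upwards [(hmem ψ).coeFn_toLp, ae_eq_holFun ψ] with Z h1 h2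
      rw [h1, h2]
      rfl) hZ
  have hext : ∀ x y : H, (∀ Z : domainD, holFun (I x) Z = holFun (I y) Z) → x = y := by
    intro x y h
    refine I.injective (Subtype.ext (Lp.ext ?_))
    filter_upwards [ae_eq_holFun (I x), ae_eq_holFun (I y), hae] with Z h1 h2 h3
    rw [h1, h2, h ⟨Z, h3⟩]
  let S : H →ₗ[ℂ] H :=
    { toFun := fun x => I.symm ⟨(hmem (I x)).toLp, hmul (I x)⟩
      map_add' := fun x y => hext _ _ fun Z => by
        simp only [map_add, I.apply_symm_apply, holFun_add _ _ Z.2, hhol _ _ Z.2, mul_add]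
      map_smul' := fun c x => hext _ _ fun Z => by
        simp only [map_smulₛₗ, I.apply_symm_apply, holFun_smul _ _ Z.2, hhol _ _ Z.2,
          RingHom.id_apply]
        ring }
  have hS : ∀ x, ‖S x‖ ≤ C * ‖x‖ := fun x => by
    change ‖I.symm ⟨(hmem (I x)).toLp, hmul (I x)⟩‖ ≤ _
    rw [I.symm.norm_map, ← I.norm_map x, Submodule.coe_norm, Submodule.coe_norm]
    refine Lp.norm_le_mul_norm_of_ae_le_mul ?_
    filter_upwards [hle (I x), (hmem (I x)).coeFn_toLp] with Z h1 h2
    rw [h2]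
    exact h1
  let B : H →L[ℂ] H := S.mkContinuous C hS
  have hB : ∀ x, ∀ Z : domainD, holFun (I (B x)) Z = f Z * holFun (I x) Z := fun x Z => by
    change holFun (I (I.symm ⟨(hmem (I x)).toLp, hmul (I x)⟩)) Z = _
    rw [I.apply_symm_apply, hhol _ _ Z.2]
  refine ⟨ContinuousLinearMap.adjoint B, fun Z => ?_, fun T hT => ?_⟩
  · refine ext_inner_left ℂ fun x => ?_
    rw [ContinuousLinearMap.adjoint_inner_right, inner_smul_right, inner_coherentState,
      inner_coherentState, hB]
  · have h1 : ContinuousLinearMap.adjoint T = B := by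
      ext x
      refine hext _ _ fun Z => ?_
      rw [hB, ← inner_coherentState, ContinuousLinearMap.adjoint_inner_left, hT Z,
        inner_smul_right, inner_coherentState]
    rw [← h1, ContinuousLinearMap.adjoint_adjoint]

/-- The set of adjoints of the operators in `A`. -/
def adjointSet (A : Set (H →L[ℂ] H)) : Set (H →L[ℂ] H) :=
  ContinuousLinearMap.adjoint '' A

/-- The quantum Kähler phase space `ℳ⁺⁺`, the C*-algebra generated by `𝒫⁺⁺`. -/
def phaseSpace (I : H ≃ₗᵢ⋆[ℂ] bergmanSpace lam) : StarSubalgebra ℂ (H →L[ℂ] H) :=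
  (StarAlgebra.adjoin ℂ (polarization I)).topologicalClosure

/-- `ℳ⁺⁺_pol`, the C*-algebra generated by `𝒫⁺⁺_pol`. -/
def phaseSpacePol (I : H ≃ₗᵢ⋆[ℂ] bergmanSpace lam) : StarSubalgebra ℂ (H →L[ℂ] H) :=
  (StarAlgebra.adjoin ℂ (polarizationPol I : Set (H →L[ℂ] H))).topologicalClosure

/-- The elements of an ideal of the operator algebra `M`, as operators on `ℋ`. -/
def idealOperators {M : StarSubalgebra ℂ (H →L[ℂ] H)} (J : TwoSidedIdeal M) : Set (H →L[ℂ] H) :=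
  Subtype.val '' (J : Set M)

/-- The commutator ideal `Comm M`: the closed two-sided ideal of `M` generated by all commutators
of elements of `M`. -/
def commutatorIdeal (M : StarSubalgebra ℂ (H →L[ℂ] H)) : Set (H →L[ℂ] H) :=
  Subtype.val '' closure
    ((TwoSidedIdeal.span {x : M | ∃ a b : M, x = a * b - b * a} : TwoSidedIdeal M) : Set M)

/-- Density in `B(ℋ)` for the weak operator topology. -/
def WeaklyDense (A : Set (H →L[ℂ] H)) : Prop :=
  Dense (ContinuousLinearMapWOT.ofCLM '' A : Set (H →WOT[ℂ] H))

/-- Density in `B(ℋ)` for the strong operator topology. -/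
def StronglyDense (A : Set (H →L[ℂ] H)) : Prop :=
  Dense (ContinuousLinearMap.toPointwiseConvergenceCLM ℂ (RingHom.id ℂ) H H '' A :
    Set (H →Lₚₜ[ℂ] H))

end QuantumPhaseSpace

/-- The twistor form `η = diag(E, -E)` on `ℂ⁴`. -/
def twistorForm : Matrix (Fin 2 ⊕ Fin 2) (Fin 2 ⊕ Fin 2) ℂ := Matrix.fromBlocks 1 0 0 (-1)

/-- The conformal group `SU(2,2)`: the `g ∈ SL(4, ℂ)` with `g* η g = η`. -/
def SU22 : Subgroup (Matrix.SpecialLinearGroup (Fin 2 ⊕ Fin 2) ℂ) where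
  carrier := {g | g.1.conjTranspose * twistorForm * g.1 = twistorForm}
  mul_mem' := by
    intro a b ha hb
    simp only [Set.mem_ofPred_eq] at *
    change (a.1 * b.1).conjTranspose * twistorForm * (a.1 * b.1) = twistorForm
    rw [Matrix.conjTranspose_mul]
    calc _ = b.1.conjTranspose * (a.1.conjTranspose * twistorForm * a.1) * b.1 := by
          simp only [Matrix.mul_assoc]
      _ = _ := by rw [ha, hb]
  one_mem' := by simp
  inv_mem' := by
    intro a ha
    simp only [Set.mem_ofPred_eq] at *
    have h1 : a.1 * (a⁻¹).1 = 1 := congrArg Subtype.val (mul_inv_cancel a)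
    have h2 : (a⁻¹).1.conjTranspose * a.1.conjTranspose = 1 := by
      rw [← Matrix.conjTranspose_mul, h1, Matrix.conjTranspose_one]
    calc (a⁻¹).1.conjTranspose * twistorForm * (a⁻¹).1
        = (a⁻¹).1.conjTranspose * (a.1.conjTranspose * twistorForm * a.1) * (a⁻¹).1 := by rw [ha]
      _ = ((a⁻¹).1.conjTranspose * a.1.conjTranspose) * twistorForm * (a.1 * (a⁻¹).1) := by
          simp only [Matrix.mul_assoc]
      _ = twistorForm := by rw [h1, h2, Matrix.one_mul, Matrix.mul_one]

/-- `det (C Z + D)`, where `h = (A B; C D)`. -/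
def autFactor (h : Matrix (Fin 2 ⊕ Fin 2) (Fin 2 ⊕ Fin 2) ℂ) (Z : Mat2) : ℂ :=
  (h.toBlocks₂₁ * Matrix.of Z + h.toBlocks₂₂).det

/-- `(A Z + B) (C Z + D)⁻¹`, where `h = (A B; C D)`. -/
def moebius (h : Matrix (Fin 2 ⊕ Fin 2) (Fin 2 ⊕ Fin 2) ℂ) (Z : Mat2) : Mat2 :=
  Matrix.of.symm ((h.toBlocks₁₁ * Matrix.of Z + h.toBlocks₁₂) *
    (h.toBlocks₂₁ * Matrix.of Z + h.toBlocks₂₂)⁻¹)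

/-- `U` is the discrete series representation `U_λ` of `SU(2,2)` on `ℋ ≅ L²𝒪(𝔻, dμ_λ)`:
`(I U(g) ψ)(Z) = det(C Z + D)^(-λ) (I ψ)((A Z + B) (C Z + D)⁻¹)`, where `g⁻¹ = (A B; C D)`. -/
def IsDiscreteSeries {lam : ℕ} [Fact (3 < lam)] {H : Type*} [NormedAddCommGroup H]
    [InnerProductSpace ℂ H] [CompleteSpace H] (I : H ≃ₗᵢ⋆[ℂ] bergmanSpace lam)
    (U : SU22 →* unitary (H →L[ℂ] H)) : Prop :=
  ∀ (g : SU22) (ψ : H), ∀ Z ∈ domainD,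
    holFun (I ((U g : H →L[ℂ] H) ψ)) Z =
      ((autFactor (g⁻¹ : SU22).1.1 Z) ^ lam)⁻¹ * holFun (I ψ) (moebius (g⁻¹ : SU22).1.1 Z)

end ConformalToeplitz
end

open ConformalToeplitz

/-! The proof rests on the coherent states and on the fact that `λ` is an integer. They form a total
family, since a vector orthogonal to all of them corresponds to the zero function, and `U_λ(g)`
carries `|Z⟩` to a scalar multiple of `|gZ⟩`. As `SU(2,2)` is transitive on `𝔻`, the kernel is found
by moving one point to the origin, where rotation invariance and the mean value property make it
constant: `⟨W|Z⟩ = N det(E - W*Z)^(-λ)` (`inner_mul_detKernel`). In particular it never vanishes.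

The function `det(E - W*Z)` is a finite sum of terms `± conj(p(W)) p(Z)`, with `p` equal to `1`, a
coordinate or the determinant. Hence `X ↦ X - ∑ a_{kl}* X a_{kl} + (det a)* X (det a)` multiplies
the kernel of an operator by `det(E - W*Z)`. Applied `λ` times to the identity it cancels the kernel
to a constant and yields a multiple of `|0⟩⟨0|`, so this projection lies in `ℳ⁺⁺_pol`
(`vacuum_rankOne_mem`).

Conjugation by `U_λ(g)` turns `a(f)` into `a(f ∘ g⁻¹)`. The entries of a Möbius map are polynomials
divided by `det(CZ + D)`, whose reciprocal is bounded on `𝔻`; thus `a(det(CZ + D))` is invertible,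
and spectral permanence puts its inverse in `ℳ⁺⁺_pol`. This is conformal invariance
(`conj_discreteSeries_mem`). It moves `|0⟩⟨0|` to every `|Z⟩⟨Z|`, and products of these give every
`|W⟩⟨Z|` (`rankOne_coherentState_mem`). Irreducibility, density, the inclusion of the compact
operators and the claims on ideals are then general facts about rank one operators on a total
family. They use only `ℳ⁺⁺_pol ⊆ M` with `M` a closed star subalgebra, so they hold for `ℳ⁺⁺` too.

Two statements need the boundary. Normalized coherent states at `diag(t, 0)` tend weakly to zero as
`|t| → 1`, so the expectation of a compact operator in them tends to zero. For a compact `a(f)` this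
expectation is `f(diag(t, 0))`, and the maximum principle with transitivity gives `f = 0`. For
`[a₂₂, a₂₂*]` it stays above a positive constant, so this commutator is not compact. -/

noncomputable section
namespace ConformalToeplitz

/-! ### Rank one operators on a total family, and compact operators -/

section OperatorTheory

open InnerProductSpace

variable {H : Type*} [NormedAddCommGroup H] [InnerProductSpace ℂ H]

/-- A family of vectors is total if only `0` is orthogonal to all of them. -/
def IsTotalFamily {ι : Type*} (v : ι → H) : Prop := ∀ x : H, (∀ i, ⟪x, v i⟫_ℂ = 0) → x = 0

variable [CompleteSpace H] {ι : Type*} {v : ι → H}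

lemma IsTotalFamily.mem_of_isClosed (hv : IsTotalFamily v) {K : Submodule ℂ H}
    (hK : IsClosed (K : Set H)) (h : ∀ i, v i ∈ K) (x : H) : x ∈ K := by
  have hK' : K.topologicalClosure = K := IsClosed.submodule_topologicalClosure_eq hK
  have h1 : Kᗮ = ⊥ := by
    refine (Submodule.eq_bot_iff _).2 fun y hy => hv y fun i => ?_
    exact Submodule.inner_left_of_mem_orthogonal (h i) hy
  have h2 : K.topologicalClosure = ⊤ := Submodule.topologicalClosure_eq_top_iff.2 h1
  rw [hK'] at h2
  simp [h2]

lemma IsTotalFamily.ext (hv : IsTotalFamily v) {F : Type*} [NormedAddCommGroup F] [NormedSpace ℂ F]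
    {S T : H →L[ℂ] F} (h : ∀ i, S (v i) = T (v i)) : S = T := by
  ext x
  have h1 := hv.mem_of_isClosed (K := (S - T).ker) (S - T).isClosed_ker
    (fun i => by simp [h i]) x
  simpa [sub_eq_zero] using h1

/-- The rank one operator depends continuously and (conjugate-)linearly on each vector, so totality
is applied first in the left slot and then in the right one. -/
lemma rankOne_mem_of_isTotalFamily (hv : IsTotalFamily v) {S : Submodule ℂ (H →L[ℂ] H)}
    (hS : IsClosed (S : Set (H →L[ℂ] H))) (h : ∀ i j, rankOne ℂ (v i) (v j) ∈ S) (x y : H) :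
    rankOne ℂ x y ∈ S := by
  have h1 : ∀ j x, rankOne ℂ x (v j) ∈ S := fun j x => by
    let K : Submodule ℂ H := 
      { carrier := {x | rankOne ℂ x (v j) ∈ S}
        add_mem' := fun {a b} ha hb => by
          simpa using S.add_mem ha hb
        zero_mem' := by simp
        smul_mem' := fun c a ha => by simpa using S.smul_mem c ha }
    refine hv.mem_of_isClosed (K := K) (hS.preimage (f := fun x => rankOne ℂ x (v j)) ?_)
      (fun i => h i j) x
    exact (by fun_prop : Continuous fun x : H => (rankOne ℂ x : H →L⋆[ℂ] H →L[ℂ] H) (v j))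
  let K : Submodule ℂ H := 
    { carrier := {y | rankOne ℂ x y ∈ S}
      add_mem' := fun {a b} ha hb => by
        simpa using S.add_mem ha hb
      zero_mem' := by simp
      smul_mem' := fun c a ha => by simpa using S.smul_mem (star c) ha }
  refine hv.mem_of_isClosed (K := K) (hS.preimage (f := fun y => rankOne ℂ x y) ?_)
      (fun i => h1 i x) y
  exact ((rankOne ℂ x : H →L⋆[ℂ] H →L[ℂ] H)).continuous

/-- For an orthonormal basis `e_i` of `F` one has `P_F T = ∑ |e_i⟩⟨T* e_i|`. These finite rank
operators serve below as approximants, both in norm and strongly. -/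
lemma starProjection_comp_mem {S : Submodule ℂ (H →L[ℂ] H)} (h : ∀ x y, rankOne ℂ x y ∈ S)
    (F : Submodule ℂ H) [FiniteDimensional ℂ F] (T : H →L[ℂ] H) : F.starProjection ∘L T ∈ S := by
  have e : F.starProjection ∘L T = ∑ i, rankOne ℂ ((stdOrthonormalBasis ℂ F i : F) : H)
      (ContinuousLinearMap.adjoint T (stdOrthonormalBasis ℂ F i : F)) := by
    rw [OrthonormalBasis.starProjection_eq_sum_rankOne (stdOrthonormalBasis ℂ F)]
    ext x
    simp [ContinuousLinearMap.adjoint_inner_left]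
  rw [e]
  exact S.sum_mem fun i _ => h _ _

lemma compactOperators_subset (hv : IsTotalFamily v) {S : Submodule ℂ (H →L[ℂ] H)}
    (hS : IsClosed (S : Set (H →L[ℂ] H))) (h : ∀ i j, rankOne ℂ (v i) (v j) ∈ S) :
    compactOperators H ⊆ (S : Set (H →L[ℂ] H)) := by
  intro T hT
  have h' := rankOne_mem_of_isTotalFamily hv hS h
  refine hS.closure_subset_iff.2 subset_rfl (Metric.mem_closure_iff.2 fun ε hε => ?_)
  have hT' : IsCompactOperator T := hT
  have htb : TotallyBounded (T '' closedBall 0 1) :=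
    (hT'.isCompact_closure_image_closedBall 1).totallyBounded.subset subset_closure
  -- The span `F` of a finite `ε/2`-net of the image of the unit ball gives `‖T - P_F T‖ ≤ ε/2`, as
  -- `P_F` realizes the distance to `F`.
  obtain ⟨t, htf, ht⟩ := Metric.totallyBounded_iff.1 htb (ε / 2) (by positivity)
  let F := Submodule.span ℂ t
  have : FiniteDimensional ℂ F := FiniteDimensional.span_of_finite ℂ htf
  refine ⟨F.starProjection ∘L T, starProjection_comp_mem h' F T, ?_⟩
  rw [dist_eq_norm]
  refine lt_of_le_of_lt (b := ε / 2) ?_ (by linarith)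
  refine ContinuousLinearMap.opNorm_le_of_unit_norm (𝕜 := ℂ) (by positivity) fun x hx => ?_
  have hx1 : T x ∈ T '' closedBall 0 1 := ⟨x, by simp [hx], rfl⟩
  obtain ⟨y, hy, hxy⟩ := Set.mem_iUnion₂.1 (ht hx1)
  have h3 : ‖T x - F.starProjection (T x)‖ ≤ ‖T x - y‖ := by
    rw [Submodule.starProjection_minimal]
    exact ciInf_le ⟨0, by rintro _ ⟨z, rfl⟩; exact norm_nonneg _⟩ (⟨y, Submodule.subset_span hy⟩ : F)
  rw [mem_ball, dist_eq_norm] at hxy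
  simpa using h3.trans hxy.le

lemma stronglyDense_of_rankOne_mem {S : Submodule ℂ (H →L[ℂ] H)} (h : ∀ x y, rankOne ℂ x y ∈ S) :
    StronglyDense (S : Set (H →L[ℂ] H)) := by
  classical
  intro T
  have hF : ∀ s : Finset H, FiniteDimensional ℂ (Submodule.span ℂ (s : Set H)) := fun s =>
    FiniteDimensional.span_finset ℂ s
  have hP : ∀ s : Finset H, (Submodule.span ℂ (s : Set H)).HasOrthogonalProjection := fun s =>
    haveI := hF s
    inferInstance
  refine mem_closure_of_tendsto (b := (atTop : Filter (Finset H)))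
    (f := fun s : Finset H => ContinuousLinearMap.toPointwiseConvergenceCLM ℂ (RingHom.id ℂ) H H
      ((Submodule.span ℂ (s : Set H)).starProjection ∘L
        (T : H →L[ℂ] H))) ?_ (Eventually.of_forall fun s =>
        ⟨_, starProjection_comp_mem h _ _, rfl⟩)
  rw [PointwiseConvergenceCLM.tendsto_iff_forall_tendsto]
  intro x
  refine tendsto_const_nhds.congr' ?_
  -- Along the net of finite sets `s`, the projection onto the span of `s` fixes `T x` as soon as `T
  -- x ∈ s`.
  filter_upwards [eventually_ge_atTop {T x}] with s hs
  have hx : T x ∈ Submodule.span ℂ (s : Set H) := Submodule.subset_span (hs (by simp))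
  exact (Submodule.starProjection_eq_self_iff.2 hx).symm

omit [CompleteSpace H] in
lemma weaklyDense_of_stronglyDense {A : Set (H →L[ℂ] H)} (h : StronglyDense A) :
    WeaklyDense A := by
  let φ : (H →Lₚₜ[ℂ] H) → (H →WOT[ℂ] H) := fun T => ContinuousLinearMapWOT.ofCLM (T : H →L[ℂ] H)
  have hφ : Continuous φ := ContinuousLinearMapWOT.continuous_of_dual_apply_continuous fun x y =>
    y.continuous.comp (continuous_eval_const x)
  have hs : Function.Surjective φ := fun T => ⟨T.toCLM, rfl⟩
  have h1 := hs.denseRange.dense_image hφ h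
  rwa [Set.image_image] at h1

/-- A nonzero `x` in an invariant subspace has some `⟪v j, x⟫ ≠ 0`, and then `|v i⟩⟨v j|` maps it to
a nonzero multiple of `v i`, for every `i`. -/
lemma actsIrreducibly_of_rankOne_mem (hv : IsTotalFamily v) [Nontrivial H] {A : Set (H →L[ℂ] H)}
    (h : ∀ i j, rankOne ℂ (v i) (v j) ∈ A) : ActsIrreducibly A := by
  refine ⟨inferInstance, fun K hK hA => ?_⟩
  by_cases hb : K = ⊥
  · exact Or.inl hb
  obtain ⟨x, hx, hx0⟩ := Submodule.exists_mem_ne_zero_of_ne_bot hb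
  obtain ⟨j, hj⟩ : ∃ j, ⟪x, v j⟫_ℂ ≠ 0 := by
    by_contra! hc
    exact hx0 (hv x hc)
  refine Or.inr (eq_top_iff.2 fun y _ => hv.mem_of_isClosed hK (fun i => ?_) y)
  have h1 := hA _ (h i j) x hx
  rw [rankOne_apply] at h1
  have h2 : ⟪v j, x⟫_ℂ ≠ 0 := by rwa [Ne, inner_eq_zero_symm]
  simpa [smul_smul, inv_mul_cancel₀ h2] using K.smul_mem (⟪v j, x⟫_ℂ)⁻¹ h1

/-- The operators in a two-sided ideal form a linear subspace. -/
def idealSubmodule {M : StarSubalgebra ℂ (H →L[ℂ] H)} (J : TwoSidedIdeal M) :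
    Submodule ℂ (H →L[ℂ] H) where
  carrier := Subtype.val '' (J : Set M)
  add_mem' := by
    rintro _ _ ⟨a, ha, rfl⟩ ⟨b, hb, rfl⟩
    exact ⟨a + b, J.add_mem ha hb, rfl⟩
  zero_mem' := ⟨0, J.zero_mem, rfl⟩
  smul_mem' := by
    rintro c _ ⟨a, ha, rfl⟩
    refine ⟨c • a, ?_, rfl⟩
    -- A ring ideal is closed under scalars because `M` is unital and contains `c • 1`.
    have := J.mul_mem_left (c • (1 : M)) a ha
    rwa [smul_mul_assoc, one_mul] at this

/-- A nonzero `a` has a nonzero matrix element `⟪v p, a (v q)⟫`, and `|v i⟩⟨v p| a |v q⟩⟨v j|` is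
that number times `|v i⟩⟨v j|`. -/
lemma rankOne_mem_ideal (hv : IsTotalFamily v) {M : StarSubalgebra ℂ (H →L[ℂ] H)}
    (h : ∀ i j, rankOne ℂ (v i) (v j) ∈ M) (J : TwoSidedIdeal M) {a : M} (ha : a ∈ J) (ha0 : a ≠ 0)
    (i j : ι) : rankOne ℂ (v i) (v j) ∈ idealSubmodule J := by
  obtain ⟨q, hq⟩ : ∃ q, (a : H →L[ℂ] H) (v q) ≠ 0 := by
    by_contra! hc
    exact ha0 (Subtype.ext (hv.ext fun i => by simp [hc i]))
  obtain ⟨p, hp⟩ : ∃ p, ⟪v p, (a : H →L[ℂ] H) (v q)⟫_ℂ ≠ 0 := by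
    by_contra! hc
    exact hq (hv _ fun i => inner_eq_zero_symm.1 (hc i))
  have h1 : (⟨_, h i p⟩ * a * ⟨_, h q j⟩ : M) ∈ J :=
    J.mul_mem_right _ _ (J.mul_mem_left _ _ ha)
  have h2 : ((⟨_, h i p⟩ * a * ⟨_, h q j⟩ : M) : H →L[ℂ] H) ∈ idealSubmodule J := ⟨_, h1, rfl⟩
  have h3 : ((⟨_, h i p⟩ * a * ⟨_, h q j⟩ : M) : H →L[ℂ] H) =
      ⟪v p, (a : H →L[ℂ] H) (v q)⟫_ℂ • rankOne ℂ (v i) (v j) := by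
    ext x
    simp [smul_smul, mul_comm]
  rw [h3] at h2
  simpa [smul_smul, inv_mul_cancel₀ hp] using Submodule.smul_mem _ (⟪v p, (a : H →L[ℂ] H) (v q)⟫_ℂ)⁻¹ h2

/-- Since `M` is closed in `B(ℋ)`, the closure of `J` inside `M` is its closure in `B(ℋ)`, to which
the approximation of compact operators applies. -/
lemma compactOperators_subset_closure_ideal (hv : IsTotalFamily v)
    {M : StarSubalgebra ℂ (H →L[ℂ] H)} (hM : IsClosed (M : Set (H →L[ℂ] H)))
    (h : ∀ i j, rankOne ℂ (v i) (v j) ∈ M) (J : TwoSidedIdeal M) {a : M} (ha : a ∈ J) (ha0 : a ≠ 0) :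
    compactOperators H ⊆ Subtype.val '' closure (J : Set M) := by
  have h1 := compactOperators_subset hv (S := (idealSubmodule J).topologicalClosure)
    (Submodule.isClosed_topologicalClosure _) fun i j =>
      Submodule.le_topologicalClosure _ (rankOne_mem_ideal hv h J ha ha0 i j)
  have h2 : Topology.IsClosedEmbedding (Subtype.val : M → H →L[ℂ] H) := hM.isClosedEmbedding_subtypeVal
  rw [← h2.closure_image_eq]
  exact h1

/-- In dimension `> 1`, a closed ideal that acts irreducibly contains the compact operators. -/
lemma compactOperators_subset_idealOperators (hv : IsTotalFamily v)
    {M : StarSubalgebra ℂ (H →L[ℂ] H)} (hM : IsClosed (M : Set (H →L[ℂ] H)))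
    (h : ∀ i j, rankOne ℂ (v i) (v j) ∈ M) {x y : H} (hxy : LinearIndependent ℂ ![x, y])
    (J : TwoSidedIdeal M) (hJ : IsClosed (J : Set M)) (hirr : ActsIrreducibly (idealOperators J)) :
    compactOperators H ⊆ idealOperators J := by
  -- The zero ideal leaves the line `ℂ x` invariant, and independence of `x` and `y` makes this line
  -- neither `0` nor everything.
  obtain ⟨a, ha, ha0⟩ : ∃ a ∈ J, a ≠ 0 := by
    by_contra! hc
    have h1 := hirr.2 (ℂ ∙ x) (Submodule.closed_of_finiteDimensional _) (by
      rintro _ ⟨a, ha, rfl⟩ z _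
      rw [hc a ha]
      simp)
    rw [LinearIndependent.pair_iff] at hxy
    rcases h1 with h1 | h1
    · rw [Submodule.span_singleton_eq_bot] at h1
      have := (hxy 1 0 (by simp [h1])).1
      simp at this
    · have h2 : y ∈ ℂ ∙ x := by simp [h1]
      obtain ⟨c, hc⟩ := Submodule.mem_span_singleton.1 h2
      have := (hxy c (-1) (by simp [hc])).2
      simp at this
  have := compactOperators_subset_closure_ideal hv hM h J ha ha0
  rwa [hJ.closure_eq] at this

/-- A compact operator maps bounded weakly null sequences to norm null sequences; here in the form
that its quadratic form tends to zero along such a sequence. -/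
lemma tendsto_inner_of_isCompactOperator (hv : IsTotalFamily v) {T : H →L[ℂ] H}
    (hT : T ∈ compactOperators H) {u : ℕ → H} (hu : ∀ n, ‖u n‖ ≤ 1)
    (hw : ∀ i, Tendsto (fun n => ⟪v i, u n⟫_ℂ) atTop (𝓝 0)) :
    Tendsto (fun n => ⟪u n, T (u n)⟫_ℂ) atTop (𝓝 0) := by
  have hweak : ∀ x, Tendsto (fun n => ⟪x, u n⟫_ℂ) atTop (𝓝 0) := by
    let K : Submodule ℂ H := 
      { carrier := {x | Tendsto (fun n => ⟪x, u n⟫_ℂ) atTop (𝓝 0)}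
        add_mem' := fun {a b} ha hb => by
          simpa [inner_add_left] using Tendsto.add ha hb
        zero_mem' := by simp
        smul_mem' := fun c a ha => by
          simpa [inner_smul_left] using Tendsto.mul_const (star c) ha }
    -- The bound `‖u n‖ ≤ 1` makes the set of `x` with `⟪x, u n⟫ → 0` closed, so weak nullness
    -- passes from the total family to all vectors.
    refine hv.mem_of_isClosed (K := K) (isClosed_of_closure_subset fun x hx => ?_) hw
    rw [Metric.mem_closure_iff] at hx
    change Tendsto _ _ _
    rw [Metric.tendsto_atTop]
    intro ε hε
    obtain ⟨y, hy, hxy⟩ := hx (ε / 2) (by positivity)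
    obtain ⟨N, hN⟩ := Metric.tendsto_atTop.1 (show Tendsto _ _ _ from hy) (ε / 2) (by positivity)
    refine ⟨N, fun n hn => ?_⟩
    have h1 := hN n hn
    rw [dist_zero_right] at h1 ⊢
    have h2 : ⟪x, u n⟫_ℂ = ⟪x - y, u n⟫_ℂ + ⟪y, u n⟫_ℂ := by rw [← inner_add_left, sub_add_cancel]
    have h3 : ‖⟪x - y, u n⟫_ℂ‖ ≤ ‖x - y‖ * ‖u n‖ := norm_inner_le_norm _ _
    rw [dist_eq_norm] at hxy
    rw [h2]
    refine (norm_add_le _ _).trans_lt ?_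
    nlinarith [hu n, norm_nonneg (x - y), norm_nonneg (u n)]
  -- On a further subsequence `T u` converges in norm to some `y`, and `⟪u, T u⟫ = ⟪u, y⟫ + ⟪u, T u
  -- - y⟫`.
  refine tendsto_of_subseq_tendsto fun ns hns => ?_
  have hT' : IsCompactOperator T := hT
  obtain ⟨y, -, φ, hφ, hlim⟩ := (hT'.isCompact_closure_image_closedBall 1).tendsto_subseq
    (x := fun n => T (u (ns n))) (fun n => subset_closure ⟨_, by simpa using hu _, rfl⟩)
  refine ⟨φ, ?_⟩
  have h1 : Tendsto (fun n => ⟪u (ns (φ n)), y⟫_ℂ) atTop (𝓝 0) := by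
    have := ((hweak y).comp (hns.comp hφ.tendsto_atTop)).star
    simpa [Function.comp_def] using this
  have h2 : Tendsto (fun n => ⟪u (ns (φ n)), T (u (ns (φ n))) - y⟫_ℂ) atTop (𝓝 0) := by
    refine squeeze_zero_norm (a := fun n => ‖T (u (ns (φ n))) - y‖) (fun n => ?_) ?_
    · refine (norm_inner_le_norm _ _).trans ?_
      nlinarith [hu (ns (φ n)), norm_nonneg (T (u (ns (φ n))) - y)]
    · have := (hlim.sub_const y).norm
      simpa using this
  have h3 := h1.add h2
  simpa [inner_sub_right] using h3

end OperatorTheory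

/-! ### The Möbius action of `U(2,2)`: cocycle, derivative and Jacobian -/

section Moebius

open Matrix

/-- `4 × 4` matrices in `2 × 2` blocks. -/
abbrev Mat22 : Type := Matrix (Fin 2 ⊕ Fin 2) (Fin 2 ⊕ Fin 2) ℂ

/-- `A Z + B`, where `h = (A B; C D)`. -/
def numer (h : Mat22) (Z : Mat2) : Matrix (Fin 2) (Fin 2) ℂ :=
  h.toBlocks₁₁ * Matrix.of Z + h.toBlocks₁₂

/-- `C Z + D`, where `h = (A B; C D)`. -/
def denom (h : Mat22) (Z : Mat2) : Matrix (Fin 2) (Fin 2) ℂ :=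
  h.toBlocks₂₁ * Matrix.of Z + h.toBlocks₂₂

lemma autFactor_eq (h : Mat22) (Z : Mat2) : autFactor h Z = (denom h Z).det := rfl

lemma of_moebius (h : Mat22) (Z : Mat2) :
    Matrix.of (moebius h Z) = numer h Z * (denom h Z)⁻¹ := rfl

lemma conjTranspose_mul_twistorForm_mul (A B C D : Matrix (Fin 2) (Fin 2) ℂ) :
    (fromBlocks A B C D)ᴴ * twistorForm * fromBlocks A B C D =
      fromBlocks (Aᴴ * A - Cᴴ * C) (Aᴴ * B - Cᴴ * D) (Bᴴ * A - Dᴴ * C) (Bᴴ * B - Dᴴ * D) := by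
  simp [twistorForm, fromBlocks_conjTranspose, fromBlocks_multiply, sub_eq_add_neg]

lemma twistorForm_blocks {h : Mat22} (hh : hᴴ * twistorForm * h = twistorForm) :
    h.toBlocks₁₁ᴴ * h.toBlocks₁₁ - h.toBlocks₂₁ᴴ * h.toBlocks₂₁ = 1 ∧
    h.toBlocks₁₁ᴴ * h.toBlocks₁₂ - h.toBlocks₂₁ᴴ * h.toBlocks₂₂ = 0 ∧
    h.toBlocks₁₂ᴴ * h.toBlocks₁₁ - h.toBlocks₂₂ᴴ * h.toBlocks₂₁ = 0 ∧
    h.toBlocks₁₂ᴴ * h.toBlocks₁₂ - h.toBlocks₂₂ᴴ * h.toBlocks₂₂ = -1 := by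
  rw [← fromBlocks_toBlocks h, conjTranspose_mul_twistorForm_mul, twistorForm,
    fromBlocks_inj] at hh
  simpa using hh

/-- The matrix `h` sends the column `(Z; E)` to `(AZ + B; CZ + D)`, and it preserves the pairing of
the columns of `W` and `Z` under `η`. All geometric identities below come from this one. -/
lemma numer_denom_form {h : Mat22} (hh : hᴴ * twistorForm * h = twistorForm) (Z W : Mat2) :
    (denom h W)ᴴ * denom h Z - (numer h W)ᴴ * numer h Z = 1 - (Matrix.of W)ᴴ * Matrix.of Z := by
  obtain ⟨h1, h2, h3, h4⟩ := twistorForm_blocks hh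
  simp only [numer, denom, conjTranspose_add, conjTranspose_mul]
  generalize h.toBlocks₁₁ = A at *
  generalize h.toBlocks₁₂ = B at *
  generalize h.toBlocks₂₁ = C at *
  generalize h.toBlocks₂₂ = D at *
  generalize Matrix.of Z = Z at *
  generalize Matrix.of W = W at *
  calc _ = -(Bᴴ * B - Dᴴ * D) - Wᴴ * (Aᴴ * A - Cᴴ * C) * Z - Wᴴ * (Aᴴ * B - Cᴴ * D)
        - (Bᴴ * A - Dᴴ * C) * Z := by noncomm_ring
    _ = _ := by rw [h1, h2, h3, h4]; simp

/-- The same invariance, with the column `(0; E)`, whose image is `(B; D)`, paired against `(Z; E)`.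
-/
lemma denom_numer_one {h : Mat22} (hh : hᴴ * twistorForm * h = twistorForm) (Z : Mat2) :
    h.toBlocks₂₂ᴴ * denom h Z - h.toBlocks₁₂ᴴ * numer h Z = 1 := by
  obtain ⟨h1, h2, h3, h4⟩ := twistorForm_blocks hh
  simp only [numer, denom]
  generalize h.toBlocks₁₁ = A at *
  generalize h.toBlocks₁₂ = B at *
  generalize h.toBlocks₂₁ = C at *
  generalize h.toBlocks₂₂ = D at *
  generalize Matrix.of Z = Z at *
  calc _ = -(Bᴴ * B - Dᴴ * D) - (Bᴴ * A - Dᴴ * C) * Z := by noncomm_ring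
    _ = _ := by rw [h3, h4]; simp

/-- `(CZ + D)*(CZ + D)` is the sum of the positive definite `E - Z*Z` and the positive semidefinite
`(AZ + B)*(AZ + B)`. -/
lemma isUnit_det_denom {h : Mat22} (hh : hᴴ * twistorForm * h = twistorForm) {Z : Mat2}
    (hZ : Z ∈ domainD) : IsUnit (denom h Z).det := by
  have h1 : ((denom h Z)ᴴ * denom h Z).PosDef := by
    have := numer_denom_form hh Z Z
    rw [sub_eq_iff_eq_add] at this
    rw [this]
    exact PosDef.add_posSemidef hZ (posSemidef_conjTranspose_mul_self _)
  have h2 := h1.det_pos.ne'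
  rw [det_mul] at h2
  exact isUnit_iff_ne_zero.2 (right_ne_zero_of_mul h2)

lemma autFactor_ne_zero {h : Mat22} (hh : hᴴ * twistorForm * h = twistorForm) {Z : Mat2}
    (hZ : Z ∈ domainD) : autFactor h Z ≠ 0 := (isUnit_det_denom hh hZ).ne_zero

lemma moebius_mul_denom {h : Mat22} (hh : hᴴ * twistorForm * h = twistorForm) {Z : Mat2}
    (hZ : Z ∈ domainD) : Matrix.of (moebius h Z) * denom h Z = numer h Z := by
  rw [of_moebius, nonsing_inv_mul_cancel_right _ _ (isUnit_det_denom hh hZ)]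

/-- The inverse is affine in the image point, which stays in the bounded set `𝔻`; this is what later
makes `det(CZ + D)⁻¹` bounded. -/
lemma inv_denom {h : Mat22} (hh : hᴴ * twistorForm * h = twistorForm) {Z : Mat2}
    (hZ : Z ∈ domainD) :
    (denom h Z)⁻¹ = h.toBlocks₂₂ᴴ - h.toBlocks₁₂ᴴ * Matrix.of (moebius h Z) := by
  refine inv_eq_left_inv ?_
  rw [Matrix.sub_mul, Matrix.mul_assoc, moebius_mul_denom hh hZ, denom_numer_one hh]

lemma denom_conj_form {h : Mat22} (hh : hᴴ * twistorForm * h = twistorForm) {Z W : Mat2}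
    (hZ : Z ∈ domainD) (hW : W ∈ domainD) :
    (denom h W)ᴴ * (1 - (Matrix.of (moebius h W))ᴴ * Matrix.of (moebius h Z)) * denom h Z =
      1 - (Matrix.of W)ᴴ * Matrix.of Z := by
  rw [← numer_denom_form hh Z W, ← moebius_mul_denom hh hZ, ← moebius_mul_denom hh hW,
    conjTranspose_mul]
  noncomm_ring

lemma moebius_mem {h : Mat22} (hh : hᴴ * twistorForm * h = twistorForm) {Z : Mat2}
    (hZ : Z ∈ domainD) : moebius h Z ∈ domainD := by
  have hu := isUnit_det_denom hh hZ
  have hu' : IsUnit (denom h Z) := (isUnit_iff_isUnit_det _).2 hu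
  have h1 := denom_conj_form hh hZ hZ
  have h2 := (IsUnit.posDef_star_left_conjugate_iff
    (x := 1 - (Matrix.of (moebius h Z))ᴴ * Matrix.of (moebius h Z)) hu')
  rw [star_eq_conjTranspose, h1] at h2
  exact h2.1 hZ

/-- The kernel `det (E - W* Z)`. -/
def detKernel (W Z : Mat2) : ℂ := (1 - (Matrix.of W)ᴴ * Matrix.of Z).det

lemma detKernel_moebius {h : Mat22} (hh : hᴴ * twistorForm * h = twistorForm) {Z W : Mat2}
    (hZ : Z ∈ domainD) (hW : W ∈ domainD) :
    star (autFactor h W) * autFactor h Z * detKernel (moebius h W) (moebius h Z) =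
      detKernel W Z := by
  rw [detKernel, detKernel, ← denom_conj_form hh hZ hW, det_mul, det_mul, det_conjTranspose,
    autFactor_eq, autFactor_eq]
  ring

lemma weight_eq (Z : Mat2) : weight Z = (detKernel Z Z).re := rfl

lemma detKernel_self {Z : Mat2} (hZ : Z ∈ domainD) : detKernel Z Z = weight Z := by
  have := (Complex.pos_iff.1 (Matrix.PosDef.det_pos hZ)).2
  exact Complex.ext rfl this.symm

lemma weight_moebius {h : Mat22} (hh : hᴴ * twistorForm * h = twistorForm) {Z : Mat2}
    (hZ : Z ∈ domainD) : ‖autFactor h Z‖ ^ 2 * weight (moebius h Z) = weight Z := by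
  have h1 := detKernel_moebius hh hZ hZ
  rw [detKernel_self hZ, detKernel_self (moebius_mem hh hZ)] at h1
  have h2 : star (autFactor h Z) * autFactor h Z = ((‖autFactor h Z‖ ^ 2 : ℝ) : ℂ) := by
    rw [Complex.star_def, Complex.conj_mul']
    simp
  rw [h2] at h1
  exact_mod_cast h1

lemma numer_mul {h₁ h₂ : Mat22} (hh : h₂ᴴ * twistorForm * h₂ = twistorForm) {Z : Mat2}
    (hZ : Z ∈ domainD) :
    numer (h₁ * h₂) Z = numer h₁ (moebius h₂ Z) * denom h₂ Z := by
  have e := fromBlocks_multiply h₁.toBlocks₁₁ h₁.toBlocks₁₂ h₁.toBlocks₂₁ h₁.toBlocks₂₂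
    h₂.toBlocks₁₁ h₂.toBlocks₁₂ h₂.toBlocks₂₁ h₂.toBlocks₂₂
  rw [fromBlocks_toBlocks, fromBlocks_toBlocks] at e
  rw [numer, numer, Matrix.add_mul, Matrix.mul_assoc, moebius_mul_denom hh hZ, e,
    toBlocks_fromBlocks₁₁, toBlocks_fromBlocks₁₂, numer, denom]
  noncomm_ring

lemma denom_mul {h₁ h₂ : Mat22} (hh : h₂ᴴ * twistorForm * h₂ = twistorForm) {Z : Mat2}
    (hZ : Z ∈ domainD) :
    denom (h₁ * h₂) Z = denom h₁ (moebius h₂ Z) * denom h₂ Z := by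
  have e := fromBlocks_multiply h₁.toBlocks₁₁ h₁.toBlocks₁₂ h₁.toBlocks₂₁ h₁.toBlocks₂₂
    h₂.toBlocks₁₁ h₂.toBlocks₁₂ h₂.toBlocks₂₁ h₂.toBlocks₂₂
  rw [fromBlocks_toBlocks, fromBlocks_toBlocks] at e
  rw [denom, denom, Matrix.add_mul, Matrix.mul_assoc, moebius_mul_denom hh hZ, e,
    toBlocks_fromBlocks₂₁, toBlocks_fromBlocks₂₂, numer, denom]
  noncomm_ring

lemma autFactor_mul {h₁ h₂ : Mat22} (hh : h₂ᴴ * twistorForm * h₂ = twistorForm) {Z : Mat2}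
    (hZ : Z ∈ domainD) :
    autFactor (h₁ * h₂) Z = autFactor h₁ (moebius h₂ Z) * autFactor h₂ Z := by
  rw [autFactor_eq, denom_mul hh hZ, det_mul]
  rfl

lemma moebius_mul {h₁ h₂ : Mat22} (hh : h₂ᴴ * twistorForm * h₂ = twistorForm) {Z : Mat2}
    (hZ : Z ∈ domainD) : moebius (h₁ * h₂) Z = moebius h₁ (moebius h₂ Z) := by
  refine Matrix.of.injective ?_
  rw [of_moebius, of_moebius, numer_mul hh hZ, denom_mul hh hZ, Matrix.mul_inv_rev, Matrix.mul_assoc,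
    mul_nonsing_inv_cancel_left _ _ (isUnit_det_denom hh hZ)]

lemma moebius_one (Z : Mat2) : moebius 1 Z = Z := by
  refine Matrix.of.injective ?_
  rw [of_moebius, numer, denom, ← fromBlocks_one]
  simp only [toBlocks_fromBlocks₁₁, toBlocks_fromBlocks₁₂, toBlocks_fromBlocks₂₁,
    toBlocks_fromBlocks₂₂]
  simp

lemma autFactor_one (Z : Mat2) : autFactor 1 Z = 1 := by
  rw [autFactor, ← fromBlocks_one]
  simp only [toBlocks_fromBlocks₂₁, toBlocks_fromBlocks₂₂]
  simp

/-- The first factor is the determinant of the Schur complement of the lower right block in `h (E Z;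
0 E)`, a matrix of determinant one. -/
lemma det_sub_moebius {h : Mat22} (hh : hᴴ * twistorForm * h = twistorForm) (hdet : h.det = 1)
    {Z : Mat2} (hZ : Z ∈ domainD) :
    (h.toBlocks₁₁ - Matrix.of (moebius h Z) * h.toBlocks₂₁).det * autFactor h Z = 1 := by
  have e : h * fromBlocks 1 (Matrix.of Z) 0 1 =
      fromBlocks h.toBlocks₁₁ (numer h Z) h.toBlocks₂₁ (denom h Z) := by
    conv_lhs => rw [← fromBlocks_toBlocks h]
    rw [fromBlocks_multiply]
    simp [numer, denom]
  have hu : IsUnit (denom h Z) := (isUnit_iff_isUnit_det _).2 (isUnit_det_denom hh hZ)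
  let := hu.invertible
  have e2 := congrArg det e
  rw [det_mul, hdet, det_fromBlocks_zero₂₁, det_fromBlocks₂₂, det_one, invOf_eq_nonsing_inv] at e2
  rw [of_moebius, autFactor_eq, mul_comm]
  simpa using e2.symm

/-- The linear map `X ↦ L X R` on `2 × 2` matrices. -/
def sandwich (L R : Matrix (Fin 2) (Fin 2) ℂ) : Mat2 →ₗ[ℂ] Mat2 where
  toFun X := Matrix.of.symm (L * Matrix.of X * R)
  map_add' X Y := by
    rw [← Matrix.of_add_of, Matrix.mul_add, Matrix.add_mul]; rfl
  map_smul' c X := by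
    rw [← Matrix.smul_of, Matrix.mul_smul, Matrix.smul_mul]; rfl

/-- On vectors indexed by pairs the map `X ↦ L X R` is the Kronecker product of `L` and `Rᵀ`. -/
lemma det_sandwich (L R : Matrix (Fin 2) (Fin 2) ℂ) :
    LinearMap.det (sandwich L R) = L.det ^ 2 * R.det ^ 2 := by
  have e : (sandwich L R) = (LinearEquiv.curry ℂ ℂ (Fin 2) (Fin 2)).toLinearMap ∘ₗ
      (Matrix.toLin' (kroneckerMap (· * ·) L Rᵀ)) ∘ₗ
      (LinearEquiv.curry ℂ ℂ (Fin 2) (Fin 2)).symm.toLinearMap := by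
    refine LinearMap.ext fun X => funext fun i => funext fun j => ?_
    change (L * Matrix.of X * R) i j = ((kroneckerMap (· * ·) L Rᵀ) *ᵥ (fun p => X p.1 p.2)) (i, j)
    simp only [Matrix.mul_apply, Fin.sum_univ_two, Fintype.sum_prod_type, mulVec, dotProduct,
      kroneckerMap_apply, transpose_apply, of_apply]
    ring
  rw [e, LinearMap.det_conj, LinearMap.det_toLin', det_kronecker, det_transpose]
  simp

lemma differentiable_numer (h : Mat22) (i j : Fin 2) :
    Differentiable ℂ fun Z => numer h Z i j := by
  simp only [numer, Matrix.add_apply, Matrix.mul_apply, Fin.sum_univ_two, of_apply]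
  fun_prop

lemma differentiable_denom (h : Mat22) (i j : Fin 2) :
    Differentiable ℂ fun Z => denom h Z i j := by
  simp only [denom, Matrix.add_apply, Matrix.mul_apply, Fin.sum_univ_two, of_apply]
  fun_prop

lemma differentiable_autFactor (h : Mat22) : Differentiable ℂ (autFactor h) := by
  have e : autFactor h = fun Z => denom h Z 0 0 * denom h Z 1 1 - denom h Z 0 1 * denom h Z 1 0 :=
    funext fun Z => by rw [autFactor_eq, det_fin_two]
  rw [e]
  exact ((differentiable_denom h _ _).mul (differentiable_denom h _ _)).sub
    ((differentiable_denom h _ _).mul (differentiable_denom h _ _))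

lemma moebius_apply (h : Mat22) (Z : Mat2) (i j : Fin 2) :
    moebius h Z i j = (numer h Z i 0 * (denom h Z).adjugate 0 j +
      numer h Z i 1 * (denom h Z).adjugate 1 j) * (autFactor h Z)⁻¹ := by
  change (numer h Z * (denom h Z)⁻¹) i j = _
  rw [inv_def, Ring.inverse_eq_inv', Matrix.mul_apply, Fin.sum_univ_two, Matrix.smul_apply,
    Matrix.smul_apply, smul_eq_mul, smul_eq_mul, autFactor_eq]
  ring

lemma differentiableAt_moebius {h : Mat22} (hh : hᴴ * twistorForm * h = twistorForm) {Z : Mat2}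
    (hZ : Z ∈ domainD) : DifferentiableAt ℂ (moebius h) Z := by
  refine differentiableAt_pi.2 fun i => differentiableAt_pi.2 fun j => ?_
  simp only [moebius_apply]
  refine DifferentiableAt.mul ?_ ((differentiable_autFactor h Z).inv (autFactor_ne_zero hh hZ))
  have hadj : ∀ k, DifferentiableAt ℂ (fun Z => (denom h Z).adjugate k j) Z := fun k => by
    simp only [adjugate_fin_two]
    fin_cases k <;> fin_cases j <;>
      simp only [Fin.zero_eta, Fin.mk_one, of_apply, cons_val_zero, cons_val_one, cons_val', cons_val_fin_one]
    · exact differentiable_denom h _ _ Z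
    · exact (differentiable_denom h _ _ Z).neg
    · exact (differentiable_denom h _ _ Z).neg
    · exact differentiable_denom h _ _ Z
  exact ((differentiable_numer h _ _ Z).mul (hadj 0)).add
    ((differentiable_numer h _ _ Z).mul (hadj 1))

lemma differentiableOn_moebius {h : Mat22} (hh : hᴴ * twistorForm * h = twistorForm) :
    DifferentiableOn ℂ (moebius h) domainD := fun _ hZ =>
  (differentiableAt_moebius hh hZ).differentiableWithinAt

/-- Differentiating `h(Z) (CZ + D) = AZ + B` along `Z + tX` gives `Y (CZ + D) + h(Z) C X = A X` for
the derivative `Y`, so no derivative of an inverse matrix is needed. -/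
lemma fderiv_moebius {h : Mat22} (hh : hᴴ * twistorForm * h = twistorForm) {Z : Mat2}
    (hZ : Z ∈ domainD) : (fderiv ℂ (moebius h) Z : Mat2 →ₗ[ℂ] Mat2) =
      sandwich (h.toBlocks₁₁ - Matrix.of (moebius h Z) * h.toBlocks₂₁) (denom h Z)⁻¹ := by
  have hF := (differentiableAt_moebius hh hZ).hasFDerivAt
  refine LinearMap.ext fun X => ?_
  have hline : HasDerivAt (fun t : ℂ => Z + t • X) X 0 := by
    simpa using ((hasDerivAt_id (0 : ℂ)).smul_const X).const_add Z
  have hFt : HasDerivAt (fun t : ℂ => moebius h (Z + t • X)) (fderiv ℂ (moebius h) Z X) 0 := by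
    have hF' : HasFDerivAt (moebius h) (fderiv ℂ (moebius h) Z) (Z + (0 : ℂ) • X) := by
      rwa [zero_smul, add_zero]
    exact hF'.comp_hasDerivAt (0 : ℂ) hline
  set Y : Matrix (Fin 2) (Fin 2) ℂ := Matrix.of (fderiv ℂ (moebius h) Z X) with hY
  have hent : ∀ i j, HasDerivAt (fun t : ℂ => moebius h (Z + t • X) i j) (Y i j) 0 := fun i j =>
    hasDerivAt_pi.1 (hasDerivAt_pi.1 hFt i) j
  have hlin : ∀ i j, HasDerivAt (fun t : ℂ => Z i j + t * X i j) (X i j) 0 := fun i j => by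
    simpa using ((hasDerivAt_id (0 : ℂ)).mul_const (X i j)).const_add (Z i j)
  have hden : ∀ i j, HasDerivAt (fun t : ℂ => denom h (Z + t • X) i j)
      ((h.toBlocks₂₁ * Matrix.of X) i j) 0 := fun i j => by
    simp only [denom, Matrix.add_apply, Matrix.mul_apply, Fin.sum_univ_two, of_apply, Pi.add_apply,
      Pi.smul_apply, smul_eq_mul]
    exact (((hlin 0 j).const_mul _).add ((hlin 1 j).const_mul _)).add_const _
  have hnum : ∀ i j, HasDerivAt (fun t : ℂ => numer h (Z + t • X) i j)
      ((h.toBlocks₁₁ * Matrix.of X) i j) 0 := fun i j => by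
    simp only [numer, Matrix.add_apply, Matrix.mul_apply, Fin.sum_univ_two, of_apply, Pi.add_apply,
      Pi.smul_apply, smul_eq_mul]
    exact (((hlin 0 j).const_mul _).add ((hlin 1 j).const_mul _)).add_const _
  have hev : ∀ᶠ t : ℂ in 𝓝 0, Z + t • X ∈ domainD :=
    hline.continuousAt.eventually_mem (isOpen_domainD.mem_nhds (by simpa using hZ))
  have key : Y * denom h Z + Matrix.of (moebius h Z) * (h.toBlocks₂₁ * Matrix.of X) =
      h.toBlocks₁₁ * Matrix.of X := by
    ext i j
    have h1 := ((hent i 0).mul (hden 0 j)).add ((hent i 1).mul (hden 1 j))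
    have h2 := (hnum i j).congr_of_eventuallyEq (f₁ := fun t : ℂ =>
      moebius h (Z + t • X) i 0 * denom h (Z + t • X) 0 j +
        moebius h (Z + t • X) i 1 * denom h (Z + t • X) 1 j) (hev.mono fun t ht => by
      simp only [← moebius_mul_denom hh ht, Matrix.mul_apply, Fin.sum_univ_two, of_apply])
    have h3 := h1.unique h2
    simp only [zero_smul, add_zero] at h3
    rw [← h3, Matrix.add_apply, Matrix.mul_apply, Matrix.mul_apply, Fin.sum_univ_two,
      Fin.sum_univ_two, of_apply, of_apply]
    ring
  refine Matrix.of.injective ?_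
  change Y = (h.toBlocks₁₁ - Matrix.of (moebius h Z) * h.toBlocks₂₁) * Matrix.of X * (denom h Z)⁻¹
  rw [Matrix.sub_mul, ← key, Matrix.mul_assoc, add_sub_cancel_right,
    mul_nonsing_inv_cancel_right _ _ (isUnit_det_denom hh hZ)]

/-- With `j = det(CZ + D)`, the two factors of the sandwich have determinant `j⁻¹`, so the complex
Jacobian is `j⁻⁴`; the real one is its squared modulus. -/
lemma abs_det_fderiv_moebius {h : Mat22} (hh : hᴴ * twistorForm * h = twistorForm)
    (hdet : h.det = 1) {Z : Mat2} (hZ : Z ∈ domainD) :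
    |((fderiv ℂ (moebius h) Z).restrictScalars ℝ).det| = (‖autFactor h Z‖ ^ 8)⁻¹ := by
  have e : ((fderiv ℂ (moebius h) Z).restrictScalars ℝ).det =
      LinearMap.det ((fderiv ℂ (moebius h) Z : Mat2 →ₗ[ℂ] Mat2).restrictScalars ℝ) := rfl
  have h1 := det_sub_moebius hh hdet hZ
  have h2 := eq_inv_of_mul_eq_one_left h1
  rw [e, LinearMap.det_restrictScalars, fderiv_moebius hh hZ, det_sandwich, h2, det_nonsing_inv,
    Ring.inverse_eq_inv', ← autFactor_eq, Algebra.norm_complex_apply, Complex.normSq_eq_norm_sq]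
  rw [abs_of_nonneg (by positivity), norm_mul, norm_pow, norm_inv]
  ring

end Moebius

/-! ### Geometry of `𝔻` and transitivity of `SU(2,2)` -/

section Domain

open Matrix

lemma zero_mem_domainD : (0 : Mat2) ∈ domainD := by
  change (1 - (0 : Matrix (Fin 2) (Fin 2) ℂ)ᴴ * 0).PosDef
  simpa using PosDef.one

lemma norm_apply_lt_one {Z : Mat2} (hZ : Z ∈ domainD) (k l : Fin 2) : ‖Z k l‖ < 1 := by
  have h1 := (Complex.pos_iff.1 (Matrix.PosDef.diag_pos (i := l) hZ)).1
  simp only [Matrix.sub_apply, Matrix.mul_apply, Fin.sum_univ_two, Matrix.conjTranspose_apply,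
    Matrix.of_apply, Matrix.one_apply_eq, Complex.star_def, Complex.conj_mul', Complex.sub_re,
    Complex.add_re, Complex.one_re, ← Complex.ofReal_pow, Complex.ofReal_re] at h1
  have h2 : ‖Z k l‖ ^ 2 < 1 := by
    fin_cases k <;> simp only [Fin.zero_eta, Fin.mk_one] <;>
      nlinarith [sq_nonneg ‖Z 0 l‖, sq_nonneg ‖Z 1 l‖]
  exact (sq_lt_one_iff₀ (norm_nonneg _)).1 h2

lemma norm_apply_le_one {Z : Mat2} (hZ : Z ∈ domainD) (k l : Fin 2) : ‖Z k l‖ ≤ 1 :=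
  (norm_apply_lt_one hZ k l).le

lemma domainD_subset_closedBall : domainD ⊆ closedBall (0 : Mat2) 1 := fun Z hZ => by
  rw [mem_closedBall_zero_iff, pi_norm_le_iff_of_nonneg zero_le_one]
  exact fun k => (pi_norm_le_iff_of_nonneg zero_le_one).2 fun l => norm_apply_le_one hZ k l

/-- `E - |t|² Z*Z` is the convex combination `(1 - |t|²) E + |t|² (E - Z*Z)`. The closed range of
`t` allows the mean value property on the full unit circle. -/
lemma smul_mem_domainD {Z : Mat2} (hZ : Z ∈ domainD) {t : ℂ} (ht : ‖t‖ ≤ 1) :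
    t • Z ∈ domainD := by
  have e : 1 - (Matrix.of (t • Z))ᴴ * Matrix.of (t • Z) =
      ((1 - ‖t‖ ^ 2 : ℝ) : ℂ) • (1 : Matrix (Fin 2) (Fin 2) ℂ) +
        ((‖t‖ ^ 2 : ℝ) : ℂ) • (1 - (Matrix.of Z)ᴴ * Matrix.of Z) := by
    have e1 : Matrix.of (t • Z) = t • Matrix.of Z := rfl
    rw [e1, conjTranspose_smul, smul_mul_smul_comm, Complex.star_def, Complex.conj_mul', smul_sub]
    push_cast
    module
  have h1 : 0 ≤ 1 - ‖t‖ ^ 2 := by nlinarith [norm_nonneg t]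
  rcases eq_or_ne t 0 with rfl | h0
  · simpa using zero_mem_domainD
  change PosDef _
  rw [e]
  refine PosDef.posSemidef_add (PosSemidef.smul PosSemidef.one ?_) (PosDef.smul hZ ?_)
  · exact_mod_cast h1
  · have : 0 < ‖t‖ := norm_pos_iff.2 h0
    exact_mod_cast (by positivity : 0 < ‖t‖ ^ 2)

/-- The diagonal matrix `diag (t, s)` as a point of `ℂ^{2 × 2}`. -/
def diagPoint (t s : ℂ) : Mat2 := ![![t, 0], ![0, s]]

lemma one_sub_diagPoint (t s t' s' : ℂ) :
    1 - (Matrix.of (diagPoint t s))ᴴ * Matrix.of (diagPoint t' s') =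
      diagonal ![1 - star t * t', 1 - star s * s'] := by
  ext i j
  fin_cases i <;> fin_cases j <;>
    simp [diagPoint, Matrix.mul_apply, Fin.sum_univ_two]

lemma diagPoint_mem {t s : ℂ} (ht : ‖t‖ < 1) (hs : ‖s‖ < 1) : diagPoint t s ∈ domainD := by
  change PosDef _
  rw [one_sub_diagPoint]
  refine PosDef.diagonal fun i => ?_
  have key : ∀ z : ℂ, ‖z‖ < 1 → 0 < 1 - star z * z := fun z hz => by
    rw [Complex.star_def, Complex.conj_mul']
    have : 0 < 1 - ‖z‖ ^ 2 := by nlinarith [norm_nonneg z]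
    exact_mod_cast this
  fin_cases i
  · exact key t ht
  · exact key s hs

lemma detKernel_diagPoint (t s t' s' : ℂ) :
    detKernel (diagPoint t s) (diagPoint t' s') = (1 - star t * t') * (1 - star s * s') := by
  rw [detKernel, one_sub_diagPoint, det_diagonal]
  simp [Fin.prod_univ_two]

/-- Every term has the form `± conj(p(W)) p(Z)` with `p` polynomial, which is the shape that
sandwiching an operator between `a(p)*` and `a(p)` produces. -/
lemma detKernel_eq (W Z : Mat2) : detKernel W Z = 1 - (star (W 0 0) * Z 0 0 + star (W 0 1) * Z 0 1 +
    star (W 1 0) * Z 1 0 + star (W 1 1) * Z 1 1) +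
      star (W 0 0 * W 1 1 - W 0 1 * W 1 0) * (Z 0 0 * Z 1 1 - Z 0 1 * Z 1 0) := by
  rw [detKernel, det_fin_two]
  simp only [Matrix.sub_apply, Matrix.mul_apply, Fin.sum_univ_two, conjTranspose_apply, of_apply,
    Matrix.one_apply, star_sub, star_mul']
  simp
  ring

lemma detKernel_zero_left (Z : Mat2) : detKernel 0 Z = 1 := by simp [detKernel_eq]

lemma twistorForm_mul {a b : Mat22} (ha : aᴴ * twistorForm * a = twistorForm)
    (hb : bᴴ * twistorForm * b = twistorForm) :
    (a * b)ᴴ * twistorForm * (a * b) = twistorForm := by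
  rw [conjTranspose_mul]
  calc _ = bᴴ * (aᴴ * twistorForm * a) * b := by noncomm_ring
    _ = _ := by rw [ha, hb]

lemma twistorForm_scalar {u : ℂ} (hu : ‖u‖ = 1) :
    (fromBlocks (u • (1 : Matrix (Fin 2) (Fin 2) ℂ)) 0 0 1)ᴴ * twistorForm *
      fromBlocks (u • (1 : Matrix (Fin 2) (Fin 2) ℂ)) 0 0 1 = twistorForm := by
  rw [conjTranspose_mul_twistorForm_mul, twistorForm]
  have : star u * u = 1 := by rw [Complex.star_def, Complex.conj_mul', hu]; simp
  rw [Complex.star_def] at this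
  simp [smul_smul, mul_comm u, this]

open scoped MatrixOrder in
lemma exists_eq_conjTranspose_mul_self {P : Matrix (Fin 2) (Fin 2) ℂ} (hP : P.PosDef) :
    ∃ A, P = Aᴴ * A :=
  CStarAlgebra.nonneg_iff_eq_star_mul_self.1 hP.posSemidef.nonneg

/-- `SU(2,2)` acts transitively on `𝔻`. -/
lemma exists_moebius_eq_zero {W : Mat2} (hW : W ∈ domainD) :
    ∃ g : SU22, moebius g.1.1 W = 0 := by
  set w : Matrix (Fin 2) (Fin 2) ℂ := Matrix.of W with hw
  have hP : (1 - wᴴ * w).PosDef := hW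
  set R := (1 - wᴴ * w)⁻¹ with hR
  have hRu : IsUnit (1 - wᴴ * w).det := (isUnit_iff_isUnit_det _).1 hP.isUnit
  have hR1 : R * (wᴴ * w) = R - 1 := by
    have := nonsing_inv_mul _ hRu
    rw [← hR, Matrix.mul_sub, Matrix.mul_one] at this
    rw [← this]; abel
  have hR2 : (wᴴ * w) * R = R - 1 := by
    have := mul_nonsing_inv _ hRu
    rw [← hR, Matrix.sub_mul, Matrix.one_mul] at this
    rw [← this]; abel
  have hQ : (1 + w * R * wᴴ).PosDef :=
    PosDef.add_posSemidef PosDef.one (hP.inv.posSemidef.mul_mul_conjTranspose_same w)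
  obtain ⟨D, hD⟩ := exists_eq_conjTranspose_mul_self hP.inv
  obtain ⟨A, hA⟩ := exists_eq_conjTranspose_mul_self hQ
  rw [← hR] at hD
  -- The numerator `A Z - A w` vanishes at `w` by design. The form is preserved because `D*D = (E -
  -- w*w)⁻¹` and `A*A = E + w (E - w*w)⁻¹ w*`, which is `(E - w w*)⁻¹`.
  set g₀ : Mat22 := fromBlocks A (-(A * w)) (-(D * wᴴ)) D with hg₀
  have hform : g₀ᴴ * twistorForm * g₀ = twistorForm := by
    rw [hg₀, conjTranspose_mul_twistorForm_mul, twistorForm, fromBlocks_inj]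
    simp only [conjTranspose_neg, conjTranspose_mul, conjTranspose_conjTranspose]
    refine ⟨?_, ?_, ?_, ?_⟩
    · calc _ = Aᴴ * A - w * (Dᴴ * D) * wᴴ := by noncomm_ring
        _ = 1 := by rw [← hA, ← hD]; noncomm_ring
    · calc _ = -(Aᴴ * A) * w + w * (Dᴴ * D) := by noncomm_ring
        _ = -w - w * (R * (wᴴ * w)) + w * R := by rw [← hA, ← hD]; noncomm_ring
        _ = 0 := by rw [hR1]; noncomm_ring
    · calc _ = -wᴴ * (Aᴴ * A) + (Dᴴ * D) * wᴴ := by noncomm_ring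
        _ = -wᴴ - ((wᴴ * w) * R) * wᴴ + R * wᴴ := by rw [← hA, ← hD]; noncomm_ring
        _ = 0 := by rw [hR2]; noncomm_ring
    · calc _ = wᴴ * (Aᴴ * A) * w - Dᴴ * D := by noncomm_ring
        _ = wᴴ * w + ((wᴴ * w) * R) * (wᴴ * w) - R := by rw [← hA, ← hD]; noncomm_ring
        _ = wᴴ * w + R * (wᴴ * w) - wᴴ * w - R := by rw [hR2]; noncomm_ring
        _ = -1 := by rw [hR1]; noncomm_ring
  have hη : twistorForm.det = 1 := by
    rw [twistorForm, det_fromBlocks_zero₂₁, det_neg]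
    simp
  have hnorm : ‖g₀.det‖ = 1 := by
    have h1 := congrArg det hform
    rw [det_mul, det_mul, det_conjTranspose, hη, mul_one, Complex.star_def, Complex.conj_mul'] at h1
    have h2 : ‖g₀.det‖ ^ 2 = 1 := by exact_mod_cast h1
    exact (pow_eq_one_iff_of_nonneg (norm_nonneg _) two_ne_zero).1 h2
  -- So far `g₀` only preserves the form; its determinant has modulus one. Multiplying by `diag(u,
  -- u, 1, 1)` with `u² = (det g₀)⁻¹` corrects it without moving the zero of the numerator.
  obtain ⟨u, hu⟩ := IsAlgClosed.exists_pow_nat_eq (g₀.det)⁻¹ (n := 2) two_pos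
  have hun : ‖u‖ = 1 := by
    have h1 := congrArg norm hu
    rw [norm_pow, norm_inv, hnorm, inv_one] at h1
    exact (pow_eq_one_iff_of_nonneg (norm_nonneg _) two_ne_zero).1 h1
  have hd0 : g₀.det ≠ 0 := by
    intro h0
    simp [h0] at hnorm
  set g : Mat22 := fromBlocks (u • (1 : Matrix (Fin 2) (Fin 2) ℂ)) 0 0 1 * g₀ with hg
  have hgd : g.det = 1 := by
    rw [hg, det_mul, det_fromBlocks_zero₂₁, det_smul, det_one]
    simp [hu, hd0]
  refine ⟨⟨⟨g, hgd⟩, twistorForm_mul (twistorForm_scalar hun) hform⟩, ?_⟩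
  change moebius g W = 0
  have hnum : numer g W = 0 := by
    rw [hg, hg₀, fromBlocks_multiply, numer, toBlocks_fromBlocks₁₁, toBlocks_fromBlocks₁₂]
    simp [hw]
  refine Matrix.of.injective ?_
  rw [of_moebius, hnum, Matrix.zero_mul]
  rfl

/-- The element `diag (u, u, ū, ū)` of `SU(2,2)`, which acts on `𝔻` as `Z ↦ u² Z`. -/
def rotationSU (u : ℂ) (hu : ‖u‖ = 1) : SU22 :=
  ⟨⟨fromBlocks (u • (1 : Matrix (Fin 2) (Fin 2) ℂ)) 0 0 (star u • 1), by
    rw [det_fromBlocks_zero₂₁, det_smul, det_smul, det_one, Fintype.card_fin, mul_one, mul_one,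
      ← mul_pow, Complex.star_def, Complex.mul_conj', hu]
    simp⟩, by
    change (fromBlocks _ _ _ _)ᴴ * twistorForm * fromBlocks _ _ _ _ = twistorForm
    rw [conjTranspose_mul_twistorForm_mul, twistorForm]
    have : star u * u = 1 := by rw [Complex.star_def, Complex.conj_mul', hu]; simp
    rw [Complex.star_def] at this
    simp [smul_smul, this, mul_comm u]⟩

lemma autFactor_rotationSU {u : ℂ} (hu : ‖u‖ = 1) (Z : Mat2) :
    autFactor (rotationSU u hu).1.1 Z = star u ^ 2 := by
  change (denom (fromBlocks _ _ _ _) Z).det = _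
  rw [denom, toBlocks_fromBlocks₂₁, toBlocks_fromBlocks₂₂]
  simp

lemma moebius_rotationSU {u : ℂ} (hu : ‖u‖ = 1) (Z : Mat2) :
    moebius (rotationSU u hu).1.1 Z = (u ^ 2) • Z := by
  refine Matrix.of.injective ?_
  change numer (fromBlocks _ _ _ _) Z * (denom (fromBlocks _ _ _ _) Z)⁻¹ = u ^ 2 • Matrix.of Z
  rw [denom, numer, toBlocks_fromBlocks₂₁, toBlocks_fromBlocks₂₂, toBlocks_fromBlocks₁₁,
    toBlocks_fromBlocks₁₂, Matrix.zero_mul, zero_add, add_zero]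
  have h1 : star u * u = 1 := by rw [Complex.star_def, Complex.conj_mul', hu]; simp
  have h2 : (star u • (1 : Matrix (Fin 2) (Fin 2) ℂ))⁻¹ = u • 1 :=
    inv_eq_right_inv (by rw [smul_mul_smul_comm, h1, one_smul, Matrix.one_mul])
  rw [h2]
  simp [smul_smul, sq]

end Domain

/-! ### The discrete series representation -/

section Representation

open Matrix

lemma lintegral_bergmanMeasure (lam : ℕ) (F : Mat2 → ℝ≥0∞) :
    ∫⁻ Z, F Z ∂(bergmanMeasure lam) =
      ∫⁻ Z in domainD, ENNReal.ofReal (cConst lam * weight Z ^ (lam - 4)) * F Z := by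
  have hc : Continuous fun Z : Mat2 => cConst lam * weight Z ^ (lam - 4) :=
    continuous_const.mul (continuous_weight.pow _)
  unfold bergmanMeasure
  rw [lintegral_withDensity_eq_lintegral_mul_non_measurable _ hc.measurable.ennreal_ofReal
    (Eventually.of_forall fun _ => ENNReal.ofReal_lt_top)]
  rfl

lemma ae_mem_domainD (lam : ℕ) : ∀ᵐ Z ∂(bergmanMeasure lam), Z ∈ domainD :=
  (withDensity_absolutelyContinuous _ _).ae_le (ae_restrict_mem isOpen_domainD.measurableSet)

lemma aestronglyMeasurable_of_differentiableOn (lam : ℕ) {f : Mat2 → ℂ}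
    (hf : DifferentiableOn ℂ f domainD) : AEStronglyMeasurable f (bergmanMeasure lam) :=
  (hf.continuousOn.aestronglyMeasurable isOpen_domainD.measurableSet).mono_ac
    (withDensity_absolutelyContinuous _ _)

instance isFiniteMeasure_bergmanMeasure (lam : ℕ) : IsFiniteMeasure (bergmanMeasure lam) := by
  refine ⟨?_⟩
  have h1 := lintegral_bergmanMeasure lam 1
  simp only [Pi.one_apply, lintegral_one, mul_one] at h1
  rw [h1]
  have hc : Continuous fun Z : Mat2 => cConst lam * weight Z ^ (lam - 4) :=
    continuous_const.mul (continuous_weight.pow _)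
  have hi : IntegrableOn (fun Z : Mat2 => cConst lam * weight Z ^ (lam - 4)) domainD :=
    (hc.continuousOn.integrableOn_compact (isCompact_closedBall 0 1)).mono_set
      domainD_subset_closedBall
  refine lt_of_le_of_lt (lintegral_mono fun Z => ?_) hi.2
  exact Real.ofReal_le_enorm _

instance isAddHaarMeasure_volume_mat2 : (volume : Measure Mat2).IsAddHaarMeasure :=
  Measure.pi.isAddHaarMeasure (fun _ : Fin 2 => (volume : Measure (Fin 2 → ℂ)))

lemma form_of_mem (g : SU22) : g.1.1ᴴ * twistorForm * g.1.1 = twistorForm := g.2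

lemma moebius_inv_moebius (g : SU22) {Z : Mat2} (hZ : Z ∈ domainD) :
    moebius (g⁻¹ : SU22).1.1 (moebius g.1.1 Z) = Z := by
  rw [← moebius_mul (form_of_mem g) hZ]
  have h1 : (g⁻¹ : SU22).1.1 * g.1.1 = ((g⁻¹ * g : SU22)).1.1 := rfl
  rw [h1, inv_mul_cancel]
  exact moebius_one Z

lemma moebius_moebius_inv (g : SU22) {Z : Mat2} (hZ : Z ∈ domainD) :
    moebius g.1.1 (moebius (g⁻¹ : SU22).1.1 Z) = Z := by
  simpa using moebius_inv_moebius g⁻¹ hZ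

lemma image_moebius (g : SU22) : moebius g.1.1 '' domainD = domainD := by
  refine Set.Subset.antisymm ?_ fun Z hZ =>
    ⟨_, moebius_mem (form_of_mem g⁻¹) hZ, moebius_moebius_inv g hZ⟩
  rintro _ ⟨Z, hZ, rfl⟩
  exact moebius_mem (form_of_mem g) hZ

lemma injOn_moebius (g : SU22) : Set.InjOn (moebius g.1.1) domainD := fun Z hZ W hW h => by
  rw [← moebius_inv_moebius g hZ, h, moebius_inv_moebius g hW]

/-- Change of variables: the Jacobian contributes `|j|⁻⁸` and the weight `|j|^(-2(λ-4))`, together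
`|j|^(-2λ)`. -/
lemma lintegral_comp_moebius (lam : ℕ) [Fact (3 < lam)] (g : SU22) (F : Mat2 → ℝ≥0∞) :
    ∫⁻ Z, ENNReal.ofReal ((‖autFactor g.1.1 Z‖ ^ (2 * lam))⁻¹) * F (moebius g.1.1 Z)
      ∂(bergmanMeasure lam) = ∫⁻ Z, F Z ∂(bergmanMeasure lam) := by
  have h4 : 4 ≤ lam := Fact.out (p := 3 < lam)
  rw [lintegral_bergmanMeasure, lintegral_bergmanMeasure]
  conv_rhs => rw [← image_moebius g]
  rw [lintegral_image_eq_lintegral_abs_det_fderiv_mul volume isOpen_domainD.measurableSet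
    (f' := fun Z => (fderiv ℂ (moebius g.1.1) Z).restrictScalars ℝ)
    (fun Z hZ => ((differentiableAt_moebius (form_of_mem g) hZ).hasFDerivAt.restrictScalars
      ℝ).hasFDerivWithinAt) (injOn_moebius g)]
  refine setLIntegral_congr_fun isOpen_domainD.measurableSet fun Z hZ => ?_
  rw [abs_det_fderiv_moebius (form_of_mem g) g.1.2 hZ, ← mul_assoc, ← mul_assoc,
    ← ENNReal.ofReal_mul (by have := cConst_pos lam; have := weight_pos hZ; positivity),
    ← ENNReal.ofReal_mul (by positivity)]
  congr 2
  have hj : ‖autFactor g.1.1 Z‖ ≠ 0 := norm_ne_zero_iff.2 (autFactor_ne_zero (form_of_mem g) hZ)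
  rw [← weight_moebius (form_of_mem g) hZ, mul_pow, ← pow_mul]
  obtain ⟨n, rfl⟩ := Nat.exists_eq_add_of_le h4
  -- The exponent `λ - 4` is a truncated subtraction, hence the rewriting of `λ` as `4 + n`.
  have e : 2 * (4 + n) = 2 * (4 + n - 4) + 8 := by omega
  rw [e, pow_add]
  field_simp

lemma eLpNorm_two_eq (lam : ℕ) (f : Mat2 → ℂ) :
    eLpNorm f 2 (bergmanMeasure lam) = (∫⁻ W, ‖f W‖ₑ ^ 2 ∂(bergmanMeasure lam)) ^ (1 / 2 : ℝ) := by
  rw [eLpNorm_eq_lintegral_rpow_enorm_toReal (by norm_num) (by norm_num)]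
  simp only [ENNReal.toReal_ofNat, ENNReal.rpow_ofNat]

/-- The transform `f ↦ det(CZ + D)^(-λ) f((AZ + B)(CZ + D)⁻¹)`. -/
def weightedComp (lam : ℕ) (h : Mat22) (f : Mat2 → ℂ) : Mat2 → ℂ := fun Z =>
  ((autFactor h Z) ^ lam)⁻¹ * f (moebius h Z)

lemma eLpNorm_weightedComp (lam : ℕ) [Fact (3 < lam)] (g : SU22) (f : Mat2 → ℂ) :
    eLpNorm (weightedComp lam g.1.1 f) 2 (bergmanMeasure lam) =
      eLpNorm f 2 (bergmanMeasure lam) := by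
  rw [eLpNorm_two_eq, eLpNorm_two_eq, ← lintegral_comp_moebius lam g fun W => ‖f W‖ₑ ^ 2]
  congr 2
  funext Z
  rw [weightedComp, enorm_mul, mul_pow]
  congr 1
  rw [← ofReal_norm, ← ENNReal.ofReal_pow (norm_nonneg _), norm_inv, norm_pow, inv_pow, ← pow_mul,
    mul_comm]

lemma differentiableOn_weightedComp (lam : ℕ) (g : SU22) {f : Mat2 → ℂ}
    (hf : DifferentiableOn ℂ f domainD) :
    DifferentiableOn ℂ (weightedComp lam g.1.1 f) domainD := by
  refine DifferentiableOn.mul ?_ (hf.comp (differentiableOn_moebius (form_of_mem g))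
    fun Z hZ => moebius_mem (form_of_mem g) hZ)
  exact ((differentiable_autFactor _).pow _).differentiableOn.inv fun Z hZ =>
    pow_ne_zero _ (autFactor_ne_zero (form_of_mem g) hZ)

/-- The element of `L²𝒪(𝔻, dμ_λ)` given by a square integrable holomorphic function. -/
def bergmanMk (lam : ℕ) (f : Mat2 → ℂ) (hf : DifferentiableOn ℂ f domainD)
    (hm : MemLp f 2 (bergmanMeasure lam)) : bergmanSpace lam :=
  ⟨hm.toLp, f, hf, hm.coeFn_toLp⟩

lemma bergmanMk_ae_eq (lam : ℕ) {f : Mat2 → ℂ} (hf : DifferentiableOn ℂ f domainD)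
    (hm : MemLp f 2 (bergmanMeasure lam)) :
    (bergmanMk lam f hf hm : Lp ℂ 2 (bergmanMeasure lam)) =ᵐ[bergmanMeasure lam] f :=
  hm.coeFn_toLp

lemma memLp_holFun {lam : ℕ} (ψ : bergmanSpace lam) : MemLp (holFun ψ) 2 (bergmanMeasure lam) :=
  (memLp_congr_ae (ae_eq_holFun ψ)).1 (Lp.memLp _)

lemma ext_holFun {lam : ℕ} {H : Type*} [NormedAddCommGroup H] [InnerProductSpace ℂ H]
    (I : H ≃ₗᵢ⋆[ℂ] bergmanSpace lam) {x y : H}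
    (h : ∀ Z ∈ domainD, holFun (I x) Z = holFun (I y) Z) : x = y := by
  refine I.injective (Subtype.ext (Lp.ext ?_))
  filter_upwards [ae_eq_holFun (I x), ae_eq_holFun (I y), ae_mem_domainD lam] with Z h1 h2 h3
  rw [h1, h2, h Z h3]

variable {lam : ℕ} [Fact (3 < lam)]

lemma holFun_bergmanMk {f : Mat2 → ℂ} (hf : DifferentiableOn ℂ f domainD)
    (hm : MemLp f 2 (bergmanMeasure lam)) {Z : Mat2} (hZ : Z ∈ domainD) :
    holFun (bergmanMk lam f hf hm) Z = f Z :=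
  eqOn_of_ae_eq lam (differentiableOn_holFun (bergmanMk lam f hf hm)) hf
    ((ae_eq_holFun (bergmanMk lam f hf hm)).symm.trans (bergmanMk_ae_eq lam hf hm)) hZ

lemma memLp_weightedComp (g : SU22) (ψ : bergmanSpace lam) :
    MemLp (weightedComp lam g.1.1 (holFun ψ)) 2 (bergmanMeasure lam) :=
  ⟨aestronglyMeasurable_of_differentiableOn lam
    (differentiableOn_weightedComp lam g (differentiableOn_holFun ψ)), by
    rw [eLpNorm_weightedComp]
    exact (memLp_holFun ψ).2⟩

variable {H : Type*} [NormedAddCommGroup H] [InnerProductSpace ℂ H]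
  (I : H ≃ₗᵢ⋆[ℂ] bergmanSpace lam)

/-- The action of `g ∈ SU(2,2)` on `ℋ`, as a map. -/
def seriesFun (g : SU22) (x : H) : H :=
  I.symm (bergmanMk lam _ (differentiableOn_weightedComp lam g⁻¹ (differentiableOn_holFun (I x)))
    (memLp_weightedComp g⁻¹ (I x)))

lemma holFun_seriesFun (g : SU22) (x : H) {Z : Mat2} (hZ : Z ∈ domainD) :
    holFun (I (seriesFun I g x)) Z = weightedComp lam (g⁻¹ : SU22).1.1 (holFun (I x)) Z := by
  rw [seriesFun, I.apply_symm_apply, holFun_bergmanMk _ _ hZ]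

lemma norm_seriesFun (g : SU22) (x : H) : ‖seriesFun I g x‖ = ‖x‖ := by
  rw [seriesFun, I.symm.norm_map, ← I.norm_map x, Submodule.coe_norm, Submodule.coe_norm,
    bergmanMk, Lp.norm_toLp, eLpNorm_weightedComp, ← eLpNorm_congr_ae (ae_eq_holFun (I x)),
    ← Lp.norm_def]

/-- This is the cocycle identity for `det(CZ + D)`; substituting `g⁻¹` turns the right action on
functions into a left one. -/
lemma seriesFun_mul (g₁ g₂ : SU22) (x : H) :
    seriesFun I (g₁ * g₂) x = seriesFun I g₁ (seriesFun I g₂ x) := by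
  refine ext_holFun I fun Z hZ => ?_
  have h1 := moebius_mem (form_of_mem g₁⁻¹) hZ
  rw [holFun_seriesFun I _ _ hZ, holFun_seriesFun I _ _ hZ, weightedComp, weightedComp,
    holFun_seriesFun I _ _ h1, weightedComp]
  have e : ((g₁ * g₂)⁻¹ : SU22).1.1 = (g₂⁻¹ : SU22).1.1 * (g₁⁻¹ : SU22).1.1 := by
    rw [_root_.mul_inv_rev]; rfl
  rw [e, moebius_mul (form_of_mem g₁⁻¹) hZ, autFactor_mul (form_of_mem g₁⁻¹) hZ, mul_pow, mul_inv]
  ring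

lemma seriesFun_one (x : H) : seriesFun I 1 x = x := by
  refine ext_holFun I fun Z hZ => ?_
  have e : ((1 : SU22)⁻¹ : SU22).1.1 = 1 := by rw [inv_one]; rfl
  rw [holFun_seriesFun I _ _ hZ, weightedComp, e, moebius_one, autFactor_one]
  simp

/-- The action of `g ∈ SU(2,2)` on `ℋ`, as a unitary map. -/
def seriesEquiv (g : SU22) : H ≃ₗᵢ[ℂ] H where
  toFun := seriesFun I g
  invFun := seriesFun I g⁻¹
  left_inv x := by rw [← seriesFun_mul, inv_mul_cancel, seriesFun_one]
  right_inv x := by rw [← seriesFun_mul, mul_inv_cancel, seriesFun_one]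
  map_add' x y := ext_holFun I fun Z hZ => by
    rw [map_add, holFun_add _ _ hZ, holFun_seriesFun I _ _ hZ, holFun_seriesFun I _ _ hZ,
      holFun_seriesFun I _ _ hZ, map_add, weightedComp, weightedComp, weightedComp,
      holFun_add _ _ (moebius_mem (form_of_mem g⁻¹) hZ), mul_add]
  map_smul' c x := ext_holFun I fun Z hZ => by
    rw [map_smulₛₗ, holFun_smul _ _ hZ, holFun_seriesFun I _ _ hZ, holFun_seriesFun I _ _ hZ,
      map_smulₛₗ, weightedComp, weightedComp,
      holFun_smul _ _ (moebius_mem (form_of_mem g⁻¹) hZ)]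
    simp only [RingHom.id_apply]
    ring
  norm_map' x := norm_seriesFun I g x

variable [CompleteSpace H]

/-- The discrete series representation `U_λ` of `SU(2,2)` on `ℋ`. -/
def discreteSeries : SU22 →* unitary (H →L[ℂ] H) :=
  (Unitary.linearIsometryEquiv (𝕜 := ℂ) (H := H)).symm.toMonoidHom.comp
    { toFun := seriesEquiv I
      map_one' := LinearIsometryEquiv.ext fun x => seriesFun_one I x
      map_mul' := fun g₁ g₂ => LinearIsometryEquiv.ext fun x => seriesFun_mul I g₁ g₂ x }

lemma discreteSeries_apply (g : SU22) (x : H) :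
    (discreteSeries I g : H →L[ℂ] H) x = seriesFun I g x := rfl

lemma isDiscreteSeries_discreteSeries : IsDiscreteSeries I (discreteSeries I) := fun g ψ Z hZ => by
  rw [discreteSeries_apply, holFun_seriesFun I g ψ hZ]
  rfl

end Representation

/-! ### Coherent states and the reproducing kernel -/

section CoherentStates

variable {lam : ℕ} [Fact (3 < lam)] {H : Type*} [NormedAddCommGroup H] [InnerProductSpace ℂ H]
  (I : H ≃ₗᵢ⋆[ℂ] bergmanSpace lam)

lemma isTotalFamily_coherentState : IsTotalFamily (coherentState I) := fun x hx => by
  refine ext_holFun I fun Z hZ => ?_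
  rw [← inner_coherentState I x ⟨Z, hZ⟩, ← inner_coherentState I 0 ⟨Z, hZ⟩, hx, inner_zero_left]

/-- The vector of `ℋ` corresponding to the constant function `1`. -/
def constState : H :=
  I.symm (bergmanMk lam (fun _ => 1) (differentiableOn_const 1) (memLp_const 1))

/-- Pairing with this vector reads off eigenvalues on coherent states; it also shows that no
coherent state is zero. -/
lemma inner_constState (Z : domainD) : ⟪constState I, coherentState I Z⟫_ℂ = 1 := by
  rw [inner_coherentState, constState, I.apply_symm_apply, holFun_bergmanMk _ _ Z.2]

/-- The origin, as a point of `𝔻`. -/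
def originD : domainD := ⟨0, zero_mem_domainD⟩

/-- The action of `SU(2,2)` on `𝔻`. -/
def actD (g : SU22) (Z : domainD) : domainD :=
  ⟨moebius g.1.1 Z, moebius_mem (form_of_mem g) Z.2⟩

variable [CompleteSpace H]

lemma adjoint_discreteSeries (g : SU22) :
    ContinuousLinearMap.adjoint (discreteSeries I g : H →L[ℂ] H) = discreteSeries I g⁻¹ := by
  rw [map_inv]
  rfl

lemma discreteSeries_apply_inv (g : SU22) (x : H) :
    (discreteSeries I g : H →L[ℂ] H) ((discreteSeries I g⁻¹ : H →L[ℂ] H) x) = x := by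
  rw [discreteSeries_apply, discreteSeries_apply, ← seriesFun_mul, mul_inv_cancel, seriesFun_one]

/-- The adjoint of `U(g)` is `U(g⁻¹)`, so pairing with `ψ` evaluates `U(g⁻¹) ψ` at `Z`, and the
defining formula of `U(g⁻¹)` involves `g` itself. -/
lemma discreteSeries_coherentState (g : SU22) (Z : domainD) :
    (discreteSeries I g : H →L[ℂ] H) (coherentState I Z) =
      ((autFactor g.1.1 Z) ^ lam)⁻¹ • coherentState I (actD g Z) := by
  refine ext_inner_left ℂ fun ψ => ?_
  have h1 := adjoint_discreteSeries I g⁻¹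
  rw [inv_inv] at h1
  rw [← h1, ContinuousLinearMap.adjoint_inner_right, inner_smul_right, inner_coherentState,
    inner_coherentState, isDiscreteSeries_discreteSeries I g⁻¹ ψ Z Z.2, inv_inv]
  rfl

lemma inner_discreteSeries (g : SU22) (x y : H) :
    ⟪(discreteSeries I g : H →L[ℂ] H) x, (discreteSeries I g : H →L[ℂ] H) y⟫_ℂ = ⟪x, y⟫_ℂ :=
  Unitary.inner_map_map _ x y

lemma inner_coherentState_actD (g : SU22) (W Z : domainD) :
    ⟪coherentState I W, coherentState I Z⟫_ℂ =
      ((star (autFactor g.1.1 W) * autFactor g.1.1 Z) ^ lam)⁻¹ *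
        ⟪coherentState I (actD g W), coherentState I (actD g Z)⟫_ℂ := by
  rw [← inner_discreteSeries I g, discreteSeries_coherentState, discreteSeries_coherentState,
    inner_smul_left, inner_smul_right, mul_pow, mul_inv, map_inv₀, map_pow, Complex.star_def]
  ring

/-- The squared norm of the coherent state at the origin. -/
def vacuumNormSq : ℂ := ⟪coherentState I originD, coherentState I originD⟫_ℂ

omit [CompleteSpace H] in
lemma coherentState_ne_zero (Z : domainD) : coherentState I Z ≠ 0 := fun h => by
  have := inner_constState I Z
  simp [h] at this

omit [CompleteSpace H] in
lemma vacuumNormSq_ne_zero : vacuumNormSq I ≠ 0 :=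
  inner_self_ne_zero.2 (coherentState_ne_zero I _)

/-- A holomorphic function on `𝔻` restricts to a holomorphic function on the closed unit disc of
each complex line. -/
lemma diffContOnCl_slice {f : Mat2 → ℂ} (hf : DifferentiableOn ℂ f domainD) {Z : Mat2}
    (hZ : Z ∈ domainD) : DiffContOnCl ℂ (fun s : ℂ => f (s • Z)) (ball 0 1) := by
  apply DifferentiableOn.diffContOnCl
  rw [closure_ball _ one_ne_zero]
  refine hf.comp (by fun_prop) fun s hs => smul_mem_domainD hZ (by simpa using hs)

/-- `diag(u, u, ū, ū)` fixes the origin and its automorphy factors cancel, so `f(Z) = ⟨0|Z⟩`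
satisfies `f(u² Z) = f(Z)`. On the disc `s ↦ f(s Z)` the boundary values all equal `f(Z)` and their
mean is `f(0)`. -/
lemma inner_originD (Z : domainD) :
    ⟪coherentState I originD, coherentState I Z⟫_ℂ = vacuumNormSq I := by
  set f : Mat2 → ℂ := holFun (I (coherentState I originD)) with hf
  have hrot : ∀ u : ℂ, ‖u‖ = 1 → ∀ W (hW : W ∈ domainD), f (u ^ 2 • W) = f W := by
    intro u hu W hW
    have h1 := inner_coherentState_actD I (rotationSU u hu) originD ⟨W, hW⟩
    have e1 : actD (rotationSU u hu) originD = originD :=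
      Subtype.ext (by simp [actD, originD, moebius_rotationSU])
    have e2 : star (star u ^ 2) * star u ^ 2 = 1 := by
      rw [Complex.star_def, Complex.conj_mul', norm_pow, Complex.norm_conj, hu]
      simp
    rw [e1, autFactor_rotationSU, autFactor_rotationSU, e2, one_pow, inv_one, one_mul,
      inner_coherentState, inner_coherentState] at h1
    rw [hf, h1]
    simp [actD, moebius_rotationSU]
  have hd : DiffContOnCl ℂ (fun s : ℂ => f (s • (Z : Mat2))) (ball 0 |1|) := by
    rw [abs_one]
    exact diffContOnCl_slice (differentiableOn_holFun _) Z.2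
  have hav := hd.circleAverage
  rw [Real.circleAverage_congr_sphere (f₂ := fun _ => f Z) ?_, Real.circleAverage_const] at hav
  · rw [vacuumNormSq, inner_coherentState, inner_coherentState]
    simpa [originD, hf] using hav
  · intro s hs
    have hs' : ‖s‖ = 1 := by simpa using hs
    obtain ⟨u, rfl⟩ := IsAlgClosed.exists_pow_nat_eq s (n := 2) two_pos
    rw [norm_pow] at hs'
    exact hrot u ((pow_eq_one_iff_of_nonneg (norm_nonneg _) two_ne_zero).1 hs') Z Z.2

/-- The reproducing kernel of `L²𝒪(𝔻, dμ_λ)` is `det (E - W* Z)^(-λ)`, up to a constant. -/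
lemma inner_mul_detKernel (W Z : domainD) :
    ⟪coherentState I W, coherentState I Z⟫_ℂ * detKernel W Z ^ lam = vacuumNormSq I := by
  -- With `W` moved to the origin, the determinant is `1` and the inner product is the constant
  -- `⟨0|0⟩`; the automorphy factors of the two sides cancel.
  obtain ⟨g, hg⟩ := exists_moebius_eq_zero W.2
  have e1 : actD g W = originD := Subtype.ext hg
  have hW := autFactor_ne_zero (form_of_mem g) W.2
  have hZ := autFactor_ne_zero (form_of_mem g) Z.2
  have hW' : star (autFactor g.1.1 W) ≠ 0 := star_ne_zero.2 hW
  rw [← detKernel_moebius (form_of_mem g) Z.2 W.2, hg, detKernel_zero_left, mul_one,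
    inner_coherentState_actD I g, e1, inner_originD]
  field_simp

lemma inner_coherentState_ne_zero (W Z : domainD) :
    ⟪coherentState I W, coherentState I Z⟫_ℂ ≠ 0 := fun h => by
  have h1 := inner_mul_detKernel I W Z
  rw [h, zero_mul] at h1
  exact vacuumNormSq_ne_zero I h1.symm

/-- Totality used twice: an operator is determined by its kernel on coherent states, so operator
identities can be checked on functions of `W` and `Z`. -/
lemma ext_matrixElements {S T : H →L[ℂ] H} (h : ∀ W Z, ⟪coherentState I W, S (coherentState I Z)⟫_ℂ =
    ⟪coherentState I W, T (coherentState I Z)⟫_ℂ) : S = T := by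
  refine (isTotalFamily_coherentState I).ext fun Z => ?_
  rw [← sub_eq_zero]
  refine isTotalFamily_coherentState I _ fun W => ?_
  rw [← inner_conj_symm, inner_sub_right, h, sub_self, map_zero]

end CoherentStates

/-! ### Annihilation operators and the vacuum projection -/

section Annihilation

variable {lam : ℕ} [Fact (3 < lam)] {H : Type*} [NormedAddCommGroup H] [InnerProductSpace ℂ H]
  (I : H ≃ₗᵢ⋆[ℂ] bergmanSpace lam)

/-- `T |Z⟩ = f(Z) |Z⟩` for all `Z ∈ 𝔻`. -/
def IsAnnihilation (f : Mat2 → ℂ) (T : H →L[ℂ] H) : Prop :=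
  ∀ Z : domainD, T (coherentState I Z) = f Z • coherentState I Z

variable {I}

lemma IsAnnihilation.add {f g : Mat2 → ℂ} {S T : H →L[ℂ] H} (hS : IsAnnihilation I f S)
    (hT : IsAnnihilation I g T) : IsAnnihilation I (fun Z => f Z + g Z) (S + T) := fun Z => by
  simp [hS Z, hT Z, add_smul]

lemma IsAnnihilation.sub {f g : Mat2 → ℂ} {S T : H →L[ℂ] H} (hS : IsAnnihilation I f S)
    (hT : IsAnnihilation I g T) : IsAnnihilation I (fun Z => f Z - g Z) (S - T) := fun Z => by
  simp [hS Z, hT Z, sub_smul]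

lemma IsAnnihilation.neg {f : Mat2 → ℂ} {S : H →L[ℂ] H} (hS : IsAnnihilation I f S) :
    IsAnnihilation I (fun Z => -f Z) (-S) := fun Z => by
  simp [hS Z]

lemma IsAnnihilation.mul {f g : Mat2 → ℂ} {S T : H →L[ℂ] H} (hS : IsAnnihilation I f S)
    (hT : IsAnnihilation I g T) : IsAnnihilation I (fun Z => f Z * g Z) (S * T) := fun Z => by
  simp [hS Z, hT Z, smul_smul, mul_comm]

variable (I) in
lemma isAnnihilation_const (c : ℂ) : IsAnnihilation I (fun _ => c) (c • (1 : H →L[ℂ] H)) :=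
  fun Z => by simp

variable [CompleteSpace H]

lemma IsAnnihilation.unique {f g : Mat2 → ℂ} {S T : H →L[ℂ] H} (hS : IsAnnihilation I f S)
    (hT : IsAnnihilation I g T) (h : ∀ Z ∈ domainD, f Z = g Z) : S = T :=
  (isTotalFamily_coherentState I).ext fun Z => by rw [hS Z, hT Z, h Z Z.2]

lemma coordinate_mem_boundedHolomorphic (k l : Fin 2) :
    (fun Z : Mat2 => Z k l) ∈ boundedHolomorphic :=
  ⟨by fun_prop, 1, fun _ hZ => norm_apply_le_one hZ k l⟩

variable (I)

/-- The coordinate annihilation operator `a_{kl}`. -/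
def coordOp (k l : Fin 2) : H →L[ℂ] H :=
  (existsUnique_annihilation I (coordinate_mem_boundedHolomorphic k l)).choose

lemma isAnnihilation_coordOp (k l : Fin 2) :
    IsAnnihilation I (fun Z => Z k l) (coordOp I k l) :=
  (existsUnique_annihilation I (coordinate_mem_boundedHolomorphic k l)).choose_spec.1

lemma coordOp_mem_annihilationOperators (k l : Fin 2) :
    coordOp I k l ∈ annihilationOperators I coordinateFunctions :=
  ⟨_, ⟨k, l, rfl⟩, isAnnihilation_coordOp I k l⟩

lemma eq_coordOp_of_mem {T : H →L[ℂ] H} (hT : T ∈ annihilationOperators I coordinateFunctions) :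
    ∃ k l, T = coordOp I k l := by
  obtain ⟨f, ⟨k, l, rfl⟩, h⟩ := hT
  exact ⟨k, l, IsAnnihilation.unique (f := fun Z => Z k l) h (isAnnihilation_coordOp I k l) fun _ _ => rfl⟩

/-- Reduces statements about the whole algebra to its four generators; it serves both for `ℳ⁺⁺_pol ⊆
ℳ⁺⁺` and for conformal invariance. -/
lemma phaseSpacePol_le {S : StarSubalgebra ℂ (H →L[ℂ] H)} (hS : IsClosed (S : Set (H →L[ℂ] H)))
    (h : ∀ k l, coordOp I k l ∈ S) : phaseSpacePol I ≤ S := by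
  refine StarSubalgebra.topologicalClosure_minimal (StarAlgebra.adjoin_le ?_) hS
  have h1 : polarizationPol I ≤ S.toSubalgebra :=
    Subalgebra.topologicalClosure_minimal (Algebra.adjoin_le fun T hT => by
      obtain ⟨k, l, rfl⟩ := eq_coordOp_of_mem I hT
      exact h k l) hS
  exact h1

lemma coordOp_mem_polarizationPol (k l : Fin 2) : coordOp I k l ∈ polarizationPol I :=
  Subalgebra.le_topologicalClosure _ (Algebra.subset_adjoin (coordOp_mem_annihilationOperators I k l))

lemma isClosed_phaseSpacePol : IsClosed (phaseSpacePol I : Set (H →L[ℂ] H)) :=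
  StarSubalgebra.isClosed_topologicalClosure _

lemma isClosed_phaseSpace : IsClosed (phaseSpace I : Set (H →L[ℂ] H)) :=
  StarSubalgebra.isClosed_topologicalClosure _

lemma coordOp_mem_phaseSpacePol (k l : Fin 2) : coordOp I k l ∈ phaseSpacePol I :=
  StarSubalgebra.le_topologicalClosure _
    (StarAlgebra.subset_adjoin ℂ _ (coordOp_mem_polarizationPol I k l))

lemma phaseSpacePol_le_phaseSpace : phaseSpacePol I ≤ phaseSpace I :=
  phaseSpacePol_le I (isClosed_phaseSpace I) fun k l =>
    StarSubalgebra.le_topologicalClosure _ (StarAlgebra.subset_adjoin ℂ _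
      ⟨_, coordinate_mem_boundedHolomorphic k l, isAnnihilation_coordOp I k l⟩)

/-- The operator `det (a_{kl})`. -/
def detOp : H →L[ℂ] H :=
  coordOp I 0 0 * coordOp I 1 1 - coordOp I 0 1 * coordOp I 1 0

lemma isAnnihilation_detOp :
    IsAnnihilation I (fun Z => Z 0 0 * Z 1 1 - Z 0 1 * Z 1 0) (detOp I) :=
  ((isAnnihilation_coordOp I 0 0).mul (isAnnihilation_coordOp I 1 1)).sub
    ((isAnnihilation_coordOp I 0 1).mul (isAnnihilation_coordOp I 1 0))

/-- The map on operators that multiplies the kernel `⟨W| X |Z⟩` by `det (E - W* Z)`. -/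
def kernelMul (X : H →L[ℂ] H) : H →L[ℂ] H :=
  X - (star (coordOp I 0 0) * X * coordOp I 0 0 + star (coordOp I 0 1) * X * coordOp I 0 1 +
    star (coordOp I 1 0) * X * coordOp I 1 0 + star (coordOp I 1 1) * X * coordOp I 1 1) +
    star (detOp I) * X * detOp I

variable {I} in
lemma IsAnnihilation.inner_star_mul_mul {f : Mat2 → ℂ} {T : H →L[ℂ] H} (hT : IsAnnihilation I f T)
    (X : H →L[ℂ] H) (W Z : domainD) :
    ⟪coherentState I W, (star T * X * T) (coherentState I Z)⟫_ℂ =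
      star (f W) * f Z * ⟪coherentState I W, X (coherentState I Z)⟫_ℂ := by
  rw [mul_apply_eq_comp, mul_apply_eq_comp,
    ContinuousLinearMap.star_eq_adjoint, ContinuousLinearMap.adjoint_inner_right, hT, hT, map_smul,
    inner_smul_left, inner_smul_right, Complex.star_def, mul_assoc]

lemma inner_kernelMul (X : H →L[ℂ] H) (W Z : domainD) :
    ⟪coherentState I W, kernelMul I X (coherentState I Z)⟫_ℂ =
      detKernel W Z * ⟪coherentState I W, X (coherentState I Z)⟫_ℂ := by
  simp only [kernelMul, add_apply, sub_apply, inner_add_right,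
    inner_sub_right, (isAnnihilation_coordOp I _ _).inner_star_mul_mul,
    (isAnnihilation_detOp I).inner_star_mul_mul]
  rw [detKernel_eq]
  ring

lemma kernelMul_mem {X : H →L[ℂ] H} (hX : X ∈ phaseSpacePol I) :
    kernelMul I X ∈ phaseSpacePol I := by
  have h := coordOp_mem_phaseSpacePol I
  have hd : detOp I ∈ phaseSpacePol I := sub_mem (mul_mem (h _ _) (h _ _)) (mul_mem (h _ _) (h _ _))
  have hm : ∀ T ∈ phaseSpacePol I, star T * X * T ∈ phaseSpacePol I := fun T hT =>
    mul_mem (mul_mem (star_mem hT) hX) hT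
  exact add_mem (sub_mem hX (add_mem (add_mem (add_mem (hm _ (h _ _)) (hm _ (h _ _)))
    (hm _ (h _ _))) (hm _ (h _ _)))) (hm _ hd)

/-- After `λ` applications of `kernelMul` to the identity the kernel `N det(E - W*Z)^(-λ)` has
become the constant `N = ⟨0|0⟩`, while `|0⟩⟨0|` has kernel `⟨W|0⟩⟨0|Z⟩ = N²`. Here `λ` must be an
integer. -/
lemma vacuum_rankOne_mem : InnerProductSpace.rankOne ℂ (coherentState I originD)
    (coherentState I originD) ∈ phaseSpacePol I := by
  have h1 : ∀ (n : ℕ) (W Z : domainD),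
      ⟪coherentState I W, (kernelMul I)^[n] 1 (coherentState I Z)⟫_ℂ =
        detKernel W Z ^ n * ⟪coherentState I W, coherentState I Z⟫_ℂ := fun n W Z => by
    induction n with
    | zero => simp
    | succ n ih => rw [Function.iterate_succ_apply', inner_kernelMul, ih, pow_succ]; ring
  have h2 : ∀ n, (kernelMul I)^[n] 1 ∈ phaseSpacePol I := fun n => by
    induction n with
    | zero => exact one_mem _
    | succ n ih => rw [Function.iterate_succ_apply']; exact kernelMul_mem I ih
  have h3 : InnerProductSpace.rankOne ℂ (coherentState I originD) (coherentState I originD) =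
      vacuumNormSq I • (kernelMul I)^[lam] 1 := by
    refine ext_matrixElements I fun W Z => ?_
    rw [InnerProductSpace.rankOne_apply, inner_smul_right, smul_apply,
      inner_smul_right, h1, inner_originD, mul_comm (_ ^ _), inner_mul_detKernel,
      ← inner_conj_symm, inner_originD, vacuumNormSq, inner_conj_symm]
  rw [h3]
  exact SMulMemClass.smul_mem _ (h2 lam)

end Annihilation

/-! ### Conformal invariance of `ℳ⁺⁺_pol` and its rank one operators -/

section ConformalInvariance

variable {lam : ℕ} [Fact (3 < lam)] {H : Type*} [NormedAddCommGroup H] [InnerProductSpace ℂ H]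
  [CompleteSpace H] (I : H ≃ₗᵢ⋆[ℂ] bergmanSpace lam)

/-- `U(g)*` maps `|Z⟩` to a multiple of `|g⁻¹Z⟩`, an eigenvector of `T`, and `U(g)` brings it back;
the scalars cancel. -/
lemma IsAnnihilation.conj_discreteSeries {f : Mat2 → ℂ} {T : H →L[ℂ] H}
    (hT : IsAnnihilation I f T) (g : SU22) :
    IsAnnihilation I (fun Z => f (moebius (g⁻¹ : SU22).1.1 Z))
      ((discreteSeries I g : H →L[ℂ] H) * T *
        ContinuousLinearMap.adjoint (discreteSeries I g : H →L[ℂ] H)) := fun Z => by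
  have h1 := discreteSeries_apply_inv I g (coherentState I Z)
  rw [discreteSeries_coherentState, map_smul] at h1
  rw [adjoint_discreteSeries, mul_apply_eq_comp, mul_apply_eq_comp, discreteSeries_coherentState,
    map_smul, hT, map_smul, map_smul, smul_comm, h1]
  rfl

/-- Functions `f` with `a(f) ∈ ℳ⁺⁺_pol`. -/
def IsPolSymbol (f : Mat2 → ℂ) : Prop := ∃ T ∈ phaseSpacePol I, IsAnnihilation I f T

variable {I}

lemma IsPolSymbol.add {f g : Mat2 → ℂ} (hf : IsPolSymbol I f) (hg : IsPolSymbol I g) :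
    IsPolSymbol I fun Z => f Z + g Z := by
  obtain ⟨S, hS, hS'⟩ := hf
  obtain ⟨T, hT, hT'⟩ := hg
  exact ⟨S + T, add_mem hS hT, hS'.add hT'⟩

lemma IsPolSymbol.sub {f g : Mat2 → ℂ} (hf : IsPolSymbol I f) (hg : IsPolSymbol I g) :
    IsPolSymbol I fun Z => f Z - g Z := by
  obtain ⟨S, hS, hS'⟩ := hf
  obtain ⟨T, hT, hT'⟩ := hg
  exact ⟨S - T, sub_mem hS hT, hS'.sub hT'⟩

lemma IsPolSymbol.neg {f : Mat2 → ℂ} (hf : IsPolSymbol I f) : IsPolSymbol I fun Z => -f Z := by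
  obtain ⟨S, hS, hS'⟩ := hf
  exact ⟨-S, neg_mem hS, hS'.neg⟩

lemma IsPolSymbol.mul {f g : Mat2 → ℂ} (hf : IsPolSymbol I f) (hg : IsPolSymbol I g) :
    IsPolSymbol I fun Z => f Z * g Z := by
  obtain ⟨S, hS, hS'⟩ := hf
  obtain ⟨T, hT, hT'⟩ := hg
  exact ⟨S * T, mul_mem hS hT, hS'.mul hT'⟩

variable (I)

lemma isPolSymbol_const (c : ℂ) : IsPolSymbol I fun _ => c :=
  ⟨_, SMulMemClass.smul_mem c (one_mem _), isAnnihilation_const I c⟩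

lemma isPolSymbol_coord (k l : Fin 2) : IsPolSymbol I fun Z => Z k l :=
  ⟨_, coordOp_mem_phaseSpacePol I k l, isAnnihilation_coordOp I k l⟩

lemma isPolSymbol_numer (h : Mat22) (i j : Fin 2) : IsPolSymbol I fun Z => numer h Z i j := by
  simp only [numer, Matrix.add_apply, Matrix.mul_apply, Fin.sum_univ_two, Matrix.of_apply]
  exact (((isPolSymbol_const I _).mul (isPolSymbol_coord I _ _)).add
    ((isPolSymbol_const I _).mul (isPolSymbol_coord I _ _))).add (isPolSymbol_const I _)

lemma isPolSymbol_denom (h : Mat22) (i j : Fin 2) : IsPolSymbol I fun Z => denom h Z i j := by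
  simp only [denom, Matrix.add_apply, Matrix.mul_apply, Fin.sum_univ_two, Matrix.of_apply]
  exact (((isPolSymbol_const I _).mul (isPolSymbol_coord I _ _)).add
    ((isPolSymbol_const I _).mul (isPolSymbol_coord I _ _))).add (isPolSymbol_const I _)

lemma isPolSymbol_autFactor (h : Mat22) : IsPolSymbol I (autFactor h) := by
  have e : autFactor h = fun Z => denom h Z 0 0 * denom h Z 1 1 - denom h Z 0 1 * denom h Z 1 0 :=
    funext fun Z => by rw [autFactor_eq, Matrix.det_fin_two]
  rw [e]
  exact ((isPolSymbol_denom I h _ _).mul (isPolSymbol_denom I h _ _)).sub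
    ((isPolSymbol_denom I h _ _).mul (isPolSymbol_denom I h _ _))

lemma isPolSymbol_adjugate (h : Mat22) (k j : Fin 2) :
    IsPolSymbol I fun Z => (denom h Z).adjugate k j := by
  simp only [Matrix.adjugate_fin_two]
  fin_cases k <;> fin_cases j <;>
    simp only [Fin.zero_eta, Fin.mk_one, Matrix.of_apply, Matrix.cons_val_zero, Matrix.cons_val_one,
      Matrix.cons_val', Matrix.cons_val_fin_one]
  · exact isPolSymbol_denom I h _ _
  · exact (isPolSymbol_denom I h _ _).neg
  · exact (isPolSymbol_denom I h _ _).neg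
  · exact isPolSymbol_denom I h _ _

lemma inv_autFactor_mem_boundedHolomorphic (g : SU22) :
    (fun Z => (autFactor g.1.1 Z)⁻¹) ∈ boundedHolomorphic := by
  refine ⟨(differentiable_autFactor _).differentiableOn.inv fun Z hZ =>
    autFactor_ne_zero (form_of_mem g) hZ, ?_⟩
  set h := g.1.1
  -- Entrywise bounds for `(CZ + D)⁻¹ = D* - B* h(Z)`, since the entries of `h(Z)` have modulus at
  -- most one. The reciprocal of the factor is the determinant of this matrix.
  let K : Fin 2 → Fin 2 → ℝ := fun i j =>
    ‖h.toBlocks₂₂.conjTranspose i j‖ +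
      (‖h.toBlocks₁₂.conjTranspose i 0‖ + ‖h.toBlocks₁₂.conjTranspose i 1‖)
  have hK : ∀ Z ∈ domainD, ∀ i j, ‖(denom h Z)⁻¹ i j‖ ≤ K i j := fun Z hZ i j => by
    have hm := norm_apply_le_one (moebius_mem (form_of_mem g) hZ)
    rw [inv_denom (form_of_mem g) hZ, Matrix.sub_apply, Matrix.mul_apply, Fin.sum_univ_two]
    refine (norm_sub_le _ _).trans (add_le_add le_rfl ((norm_add_le _ _).trans
      (add_le_add ?_ ?_)))
    · rw [norm_mul]
      exact mul_le_of_le_one_right (norm_nonneg _) (hm 0 j)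
    · rw [norm_mul]
      exact mul_le_of_le_one_right (norm_nonneg _) (hm 1 j)
  refine ⟨K 0 0 * K 1 1 + K 0 1 * K 1 0, fun Z hZ => ?_⟩
  have e : (autFactor h Z)⁻¹ = ((denom h Z)⁻¹).det := by
    rw [Matrix.det_nonsing_inv, Ring.inverse_eq_inv', autFactor_eq]
  simp only [e, Matrix.det_fin_two]
  refine (norm_sub_le _ _).trans ?_
  rw [norm_mul, norm_mul]
  have := hK Z hZ
  exact add_le_add (mul_le_mul (this _ _) (this _ _) (norm_nonneg _) ((norm_nonneg _).trans (this 0 0)))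
    (mul_le_mul (this _ _) (this _ _) (norm_nonneg _) ((norm_nonneg _).trans (this 0 1)))

lemma isPolSymbol_inv_autFactor (g : SU22) : IsPolSymbol I fun Z => (autFactor g.1.1 Z)⁻¹ := by
  obtain ⟨J, hJ, hJ'⟩ := isPolSymbol_autFactor I g.1.1
  obtain ⟨L, hL, -⟩ := existsUnique_annihilation I (inv_autFactor_mem_boundedHolomorphic g)
  have hL' : IsAnnihilation I (fun Z => (autFactor g.1.1 Z)⁻¹) L := hL
  have h1 : L * J = 1 := (hL'.mul hJ').unique (T := 1) (g := fun _ => 1) (fun Z => by simp)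
    fun Z hZ => inv_mul_cancel₀ (autFactor_ne_zero (form_of_mem g) hZ)
  have h2 : J * L = 1 := (hJ'.mul hL').unique (T := 1) (g := fun _ => 1) (fun Z => by simp)
    fun Z hZ => mul_inv_cancel₀ (autFactor_ne_zero (form_of_mem g) hZ)
  have : IsClosed (phaseSpacePol I : Set (H →L[ℂ] H)) := isClosed_phaseSpacePol I
  -- Spectral permanence: an element of a C*-subalgebra that is invertible in `B(ℋ)` has its inverse
  -- in the subalgebra. So `a(1/j)` is in `ℳ⁺⁺_pol` without any polynomial approximation of `1/j`.
  have hu : IsUnit (⟨J, hJ⟩ : phaseSpacePol I) :=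
    (StarSubalgebra.coe_isUnit (phaseSpacePol I)).1 ⟨⟨J, L, h2, h1⟩, rfl⟩
  obtain ⟨b, hb⟩ := hu.exists_right_inv
  have hb' : J * (b : H →L[ℂ] H) = 1 := congrArg Subtype.val hb
  have e : L = b := by
    calc L = L * (J * b) := by rw [hb', mul_one]
      _ = b := by rw [← mul_assoc, h1, one_mul]
  exact ⟨L, e ▸ b.2, hL'⟩

lemma isPolSymbol_moebius (g : SU22) (k l : Fin 2) :
    IsPolSymbol I fun Z => moebius g.1.1 Z k l := by
  simp only [moebius_apply]
  exact (((isPolSymbol_numer I _ _ _).mul (isPolSymbol_adjugate I _ _ _)).add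
    ((isPolSymbol_numer I _ _ _).mul (isPolSymbol_adjugate I _ _ _))).mul
      (isPolSymbol_inv_autFactor I g)

/-- `ℳ⁺⁺_pol` is conformally invariant. -/
lemma conj_discreteSeries_mem (g : SU22) {X : H →L[ℂ] H} (hX : X ∈ phaseSpacePol I) :
    (discreteSeries I g : H →L[ℂ] H) * X *
      ContinuousLinearMap.adjoint (discreteSeries I g : H →L[ℂ] H) ∈ phaseSpacePol I := by
  let φ : (H →L[ℂ] H) ≃⋆ₐ[ℂ] (H →L[ℂ] H) := Unitary.conjStarAlgAut ℂ _ (discreteSeries I g)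
  have hφ : ∀ X, φ X = (discreteSeries I g : H →L[ℂ] H) * X *
      ContinuousLinearMap.adjoint (discreteSeries I g : H →L[ℂ] H) := fun X => by
    rw [Unitary.conjStarAlgAut_apply]
    rfl
  have hcont : Continuous φ := by
    have : (φ : (H →L[ℂ] H) → (H →L[ℂ] H)) = fun X => (discreteSeries I g : H →L[ℂ] H) * X *
      ContinuousLinearMap.adjoint (discreteSeries I g : H →L[ℂ] H) := funext hφ
    rw [this]
    fun_prop
  -- The preimage of the algebra under conjugation is a closed star subalgebra, so only the four
  -- generators have to be tested; they go to the operators of the Möbius entries.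
  have h1 : phaseSpacePol I ≤ (phaseSpacePol I).comap (StarAlgHomClass.toStarAlgHom φ) := by
    refine phaseSpacePol_le I ((isClosed_phaseSpacePol I).preimage hcont) fun k l => ?_
    obtain ⟨T, hT, hT'⟩ := isPolSymbol_moebius I g⁻¹ k l
    have e : φ (coordOp I k l) = T := by
      rw [hφ]
      exact ((isAnnihilation_coordOp I k l).conj_discreteSeries I g).unique hT' fun _ _ => rfl
    change φ (coordOp I k l) ∈ phaseSpacePol I
    rwa [e]
  have h2 : φ X ∈ phaseSpacePol I := h1 hX
  rwa [hφ] at h2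

/-- Conformal invariance carries the vacuum projection to a nonzero multiple of `|Z⟩⟨Z|`. The
product of `|W⟩⟨W|` and `|Z⟩⟨Z|` is `⟨W|Z⟩ |W⟩⟨Z|`, and `⟨W|Z⟩` never vanishes. -/
lemma rankOne_coherentState_mem (W Z : domainD) : InnerProductSpace.rankOne ℂ (coherentState I W)
    (coherentState I Z) ∈ phaseSpacePol I := by
  have hdiag : ∀ Z : domainD, InnerProductSpace.rankOne ℂ (coherentState I Z)
      (coherentState I Z) ∈ phaseSpacePol I := fun Z => by
    obtain ⟨g, hg⟩ := exists_moebius_eq_zero Z.2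
    have h1 := conj_discreteSeries_mem I g⁻¹ (vacuum_rankOne_mem I)
    have e1 : actD g Z = originD := Subtype.ext hg
    have e0 : (discreteSeries I g⁻¹ : H →L[ℂ] H) (coherentState I originD) =
        ((autFactor g.1.1 Z) ^ lam) • coherentState I Z := by
      have h2 := discreteSeries_apply_inv I g⁻¹ (coherentState I Z)
      rw [inv_inv, discreteSeries_coherentState, e1, map_smul] at h2
      rw [← h2, smul_smul, mul_inv_cancel₀, one_smul]
      exact pow_ne_zero _ (autFactor_ne_zero (form_of_mem g) Z.2)
    set c : ℂ := (autFactor g.1.1 Z) ^ lam with hc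
    have hc0 : c ≠ 0 := pow_ne_zero _ (autFactor_ne_zero (form_of_mem g) Z.2)
    have e2 : (discreteSeries I g⁻¹ : H →L[ℂ] H) *
        InnerProductSpace.rankOne ℂ (coherentState I originD) (coherentState I originD) *
        ContinuousLinearMap.adjoint (discreteSeries I g⁻¹ : H →L[ℂ] H) =
        (star c * c) • InnerProductSpace.rankOne ℂ (coherentState I Z) (coherentState I Z) := by
      ext x
      rw [mul_apply_eq_comp, mul_apply_eq_comp, InnerProductSpace.rankOne_apply,
        ContinuousLinearMap.adjoint_inner_right, map_smul, e0, smul_apply,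
        InnerProductSpace.rankOne_apply, inner_smul_left, smul_smul, smul_smul, Complex.star_def]
      congr 1
      ring
    rw [e2] at h1
    have h3 := SMulMemClass.smul_mem (star c * c)⁻¹ h1
    rwa [smul_smul, inv_mul_cancel₀ (mul_ne_zero (star_ne_zero.2 hc0) hc0), one_smul] at h3
  have h1 := mul_mem (hdiag W) (hdiag Z)
  have e : InnerProductSpace.rankOne ℂ (coherentState I W) (coherentState I W) *
      InnerProductSpace.rankOne ℂ (coherentState I Z) (coherentState I Z) =
      ⟪coherentState I W, coherentState I Z⟫_ℂ •
        InnerProductSpace.rankOne ℂ (coherentState I W) (coherentState I Z) := by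
    ext x
    simp [smul_smul, mul_comm]
  rw [e] at h1
  have h3 := SMulMemClass.smul_mem (⟪coherentState I W, coherentState I Z⟫_ℂ)⁻¹ h1
  rwa [smul_smul, inv_mul_cancel₀ (inner_coherentState_ne_zero I W Z), one_smul] at h3

end ConformalInvariance

/-! ### Symbols, and the intersection of a polarization with its adjoint -/

section Polarization

variable {lam : ℕ} [Fact (3 < lam)] {H : Type*} [NormedAddCommGroup H] [InnerProductSpace ℂ H]
  [CompleteSpace H] (I : H ≃ₗᵢ⋆[ℂ] bergmanSpace lam)

/-- The symbol of an operator with eigenvectors `|Z⟩`; it is always holomorphic. -/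
def symbolOf (T : H →L[ℂ] H) : Mat2 → ℂ :=
  holFun (I (ContinuousLinearMap.adjoint T (constState I)))

lemma symbolOf_apply (T : H →L[ℂ] H) (Z : domainD) :
    symbolOf I T Z = ⟪constState I, T (coherentState I Z)⟫_ℂ := by
  rw [symbolOf, ← inner_coherentState, ContinuousLinearMap.adjoint_inner_left]

variable {I} in
lemma IsAnnihilation.symbolOf_eq {f : Mat2 → ℂ} {T : H →L[ℂ] H} (hT : IsAnnihilation I f T)
    (Z : domainD) : symbolOf I T Z = f Z := by
  rw [symbolOf_apply, hT, inner_smul_right, inner_constState, mul_one]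

/-- With the eigenvalue written as a matrix element of `T`, having all `|Z⟩` as eigenvectors becomes
a closed condition on `T`, so it survives the norm closure. -/
lemma exists_isAnnihilation_of_mem_polarizationPol {T : H →L[ℂ] H} (hT : T ∈ polarizationPol I) :
    ∃ f, IsAnnihilation I f T := by
  have hclosed : IsClosed {T : H →L[ℂ] H | ∀ Z : domainD, T (coherentState I Z) =
      ⟪constState I, T (coherentState I Z)⟫_ℂ • coherentState I Z} := by
    simp only [Set.ofPred_forall]
    refine isClosed_iInter fun Z => isClosed_eq (by fun_prop) ?_
    exact (Continuous.inner continuous_const (by fun_prop)).smul continuous_const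
  have h1 : (Algebra.adjoin ℂ (annihilationOperators I coordinateFunctions) : Set (H →L[ℂ] H)) ⊆
      {T : H →L[ℂ] H | ∀ Z : domainD, T (coherentState I Z) =
        ⟪constState I, T (coherentState I Z)⟫_ℂ • coherentState I Z} := by
    intro S hS
    obtain ⟨f, hf⟩ : ∃ f, IsAnnihilation I f S := by
      refine Algebra.adjoin_induction (p := fun S _ => ∃ f, IsAnnihilation I f S) ?_ ?_ ?_ ?_ hS
      · rintro S ⟨f, -, hf⟩
        exact ⟨f, hf⟩
      · intro c
        rw [Algebra.algebraMap_eq_smul_one]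
        exact ⟨_, isAnnihilation_const I c⟩
      · rintro S T - - ⟨f, hf⟩ ⟨g, hg⟩
        exact ⟨_, hf.add hg⟩
      · rintro S T - - ⟨f, hf⟩ ⟨g, hg⟩
        exact ⟨_, hf.mul hg⟩
    intro Z
    rw [← symbolOf_apply, hf.symbolOf_eq, hf]
  have h2 : ∀ Z : domainD, T (coherentState I Z) =
      ⟪constState I, T (coherentState I Z)⟫_ℂ • coherentState I Z :=
    closure_minimal h1 hclosed hT
  exact ⟨symbolOf I T, fun Z => by rw [symbolOf_apply, ← h2]⟩

/-- Computing `⟨W|T|Z⟩` from either side gives `conj(f(W)) ⟨W|Z⟩ = g(Z) ⟨W|Z⟩`. As the kernel has no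
zeros, a function of `W` equals a function of `Z`, and both are constant. -/
lemma mem_scalarOperators_of_isAnnihilation {f g : Mat2 → ℂ} {S T : H →L[ℂ] H}
    (hS : IsAnnihilation I f S) (hT : IsAnnihilation I g T)
    (h : ContinuousLinearMap.adjoint S = T) : T ∈ scalarOperators H := by
  have h1 : ∀ W Z : domainD, star (f W) = g Z := fun W Z => by
    have h2 : ⟪coherentState I W, T (coherentState I Z)⟫_ℂ =
        star (f W) * ⟪coherentState I W, coherentState I Z⟫_ℂ := by
      rw [← h, ContinuousLinearMap.adjoint_inner_right, hS, inner_smul_left, Complex.star_def]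
    rw [hT, inner_smul_right] at h2
    exact (mul_right_cancel₀ (inner_coherentState_ne_zero I W Z) h2).symm
  exact ⟨star (f originD), (isAnnihilation_const I _).unique hT fun Z hZ => h1 originD ⟨Z, hZ⟩⟩

lemma polarizationPol_inter_adjointSet :
    (polarizationPol I : Set (H →L[ℂ] H)) ∩ adjointSet (polarizationPol I : Set (H →L[ℂ] H)) =
      scalarOperators H := by
  refine Set.Subset.antisymm ?_ ?_
  · rintro T ⟨hT, S, hS, hST⟩
    obtain ⟨f, hf⟩ := exists_isAnnihilation_of_mem_polarizationPol I hS
    obtain ⟨g, hg⟩ := exists_isAnnihilation_of_mem_polarizationPol I hT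
    exact mem_scalarOperators_of_isAnnihilation I hf hg hST
  · rintro _ ⟨c, rfl⟩
    have h1 : ∀ c : ℂ, c • (1 : H →L[ℂ] H) ∈ polarizationPol I := fun c =>
      Subalgebra.smul_mem _ (one_mem _) c
    refine ⟨h1 c, star c • 1, h1 _, ?_⟩
    rw [map_smulₛₗ, ← ContinuousLinearMap.star_eq_adjoint, star_one]
    simp

lemma polarization_inter_adjointSet :
    polarization I ∩ adjointSet (polarization I) = scalarOperators H := by
  refine Set.Subset.antisymm ?_ ?_
  · rintro T ⟨⟨g, -, hg⟩, S, ⟨f, -, hf⟩, hST⟩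
    exact mem_scalarOperators_of_isAnnihilation I hf hg hST
  · rintro _ ⟨c, rfl⟩
    have h1 : ∀ c : ℂ, c • (1 : H →L[ℂ] H) ∈ polarization I := fun c =>
      ⟨fun _ => c, ⟨differentiableOn_const c, ‖c‖, fun _ _ => le_rfl⟩, isAnnihilation_const I c⟩
    refine ⟨h1 c, star c • 1, h1 _, ?_⟩
    rw [map_smulₛₗ, ← ContinuousLinearMap.star_eq_adjoint, star_one]
    simp

end Polarization

/-! ### Boundary behaviour of coherent states; compactness and non-compactness -/

section Boundary

variable {lam : ℕ} [Fact (3 < lam)] {H : Type*} [NormedAddCommGroup H] [InnerProductSpace ℂ H]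
  [CompleteSpace H] (I : H ≃ₗᵢ⋆[ℂ] bergmanSpace lam)

/-- The point `diag (t, s)` of `𝔻`. -/
def diagD (t s : ball (0 : ℂ) 1) : domainD :=
  ⟨diagPoint t s, diagPoint_mem (mem_ball_zero_iff.1 t.2) (mem_ball_zero_iff.1 s.2)⟩

omit [CompleteSpace H] in
lemma norm_vacuumNormSq : ‖vacuumNormSq I‖ = ‖coherentState I originD‖ ^ 2 := by
  rw [vacuumNormSq, inner_self_eq_norm_sq_to_K, norm_pow, RCLike.norm_ofReal, abs_norm]

lemma norm_sq_mul_weight (Z : domainD) :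
    ‖coherentState I Z‖ ^ 2 * weight Z ^ lam = ‖coherentState I originD‖ ^ 2 := by
  have h1 := congrArg norm (inner_mul_detKernel I Z Z)
  rwa [norm_mul, detKernel_self Z.2, inner_self_eq_norm_sq_to_K, norm_pow, norm_pow,
    RCLike.norm_ofReal, abs_norm, Complex.norm_real, Real.norm_of_nonneg (weight_pos Z.2).le,
    norm_vacuumNormSq] at h1

lemma weight_diagPoint (t s : ℂ) :
    weight (diagPoint t s) = (1 - ‖t‖ ^ 2) * (1 - ‖s‖ ^ 2) := by
  rw [weight_eq, detKernel_diagPoint, Complex.star_def, Complex.conj_mul', Complex.conj_mul']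
  norm_cast

/-- The normalized coherent state. -/
def unitState (Z : domainD) : H := ((‖coherentState I Z‖⁻¹ : ℝ) : ℂ) • coherentState I Z

omit [CompleteSpace H] in
lemma norm_unitState (Z : domainD) : ‖unitState I Z‖ = 1 := by
  rw [unitState, norm_smul, Complex.norm_real, norm_inv, norm_norm,
    inv_mul_cancel₀ (norm_ne_zero_iff.2 (coherentState_ne_zero I Z))]

/-- The normalized coherent states at `diag (t, 0)` tend weakly to zero as `|t| → 1`. -/
lemma tendsto_inner_unitState {t : ℕ → ball (0 : ℂ) 1}
    (ht : Tendsto (fun n => ‖(t n : ℂ)‖) atTop (𝓝 1)) (W : domainD) :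
    Tendsto (fun n => ⟪coherentState I W, unitState I (diagD (t n) ⟨0, by simp⟩)⟫_ℂ)
      atTop (𝓝 0) := by
  have hlam : lam ≠ 0 := by have : 3 < lam := Fact.out; omega
  set N : ℝ := ‖coherentState I originD‖ ^ 2 with hN
  have hN0 : 0 < N := by
    have := norm_pos_iff.2 (coherentState_ne_zero I originD)
    positivity
  -- At `Z = diag(t, 0)` the determinant is `1 - conj(w₁₁) t`, of modulus at least `d`. So `⟨W|Z⟩`
  -- stays bounded, while `‖|Z⟩‖² = N (1 - |t|²)^(-λ)` blows up.
  set d : ℝ := 1 - ‖(W : Mat2) 0 0‖ with hd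
  have hd0 : 0 < d := by have := norm_apply_lt_one W.2 0 0; linarith
  have hb : ∀ n, ‖⟪coherentState I W, unitState I (diagD (t n) ⟨0, by simp⟩)⟫_ℂ‖ ^ 2 ≤
      N / d ^ lam / d ^ lam * (1 - ‖(t n : ℂ)‖ ^ 2) ^ lam := fun n => by
    set Z : domainD := diagD (t n) ⟨0, by simp⟩ with hZ
    have htn : ‖(t n : ℂ)‖ < 1 := mem_ball_zero_iff.1 (t n).2
    have h1 := congrArg norm (inner_mul_detKernel I W Z)
    rw [norm_mul, norm_pow, norm_vacuumNormSq] at h1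
    have h2 := norm_sq_mul_weight I Z
    have h3 : weight (Z : Mat2) = 1 - ‖(t n : ℂ)‖ ^ 2 := by
      rw [hZ, diagD, weight_diagPoint]; simp
    have h4 : d ≤ ‖detKernel (W : Mat2) Z‖ := by
      have e : detKernel (W : Mat2) Z = 1 - star ((W : Mat2) 0 0) * (t n : ℂ) := by
        rw [detKernel_eq]
        simp [hZ, diagD, diagPoint]
      rw [e]
      have := norm_sub_norm_le (1 : ℂ) (star ((W : Mat2) 0 0) * (t n : ℂ))
      rw [norm_one, norm_mul, norm_star] at this
      nlinarith [norm_nonneg ((W : Mat2) 0 0), norm_nonneg (t n : ℂ)]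
    have hz0 : 0 < ‖coherentState I Z‖ := norm_pos_iff.2 (coherentState_ne_zero I Z)
    have h5 : ‖⟪coherentState I W, coherentState I Z⟫_ℂ‖ ≤ N / d ^ lam := by
      rw [le_div_iff₀ (by positivity), hN, ← h1]
      gcongr
    have h6 : ‖⟪coherentState I W, unitState I Z⟫_ℂ‖ ^ 2 =
        ‖⟪coherentState I W, coherentState I Z⟫_ℂ‖ ^ 2 / ‖coherentState I Z‖ ^ 2 := by
      rw [unitState, inner_smul_right, norm_mul, Complex.norm_real, norm_inv, norm_norm]
      field_simp
    rw [h6, div_le_iff₀ (by positivity), mul_assoc, ← h3, mul_comm (weight _ ^ lam), h2, ← hN]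
    calc _ ≤ (N / d ^ lam) ^ 2 := by gcongr
      _ = _ := by ring
  have hlim : Tendsto (fun n => N / d ^ lam / d ^ lam * (1 - ‖(t n : ℂ)‖ ^ 2) ^ lam) atTop
      (𝓝 0) := by
    have := (((ht.pow 2).const_sub 1).pow lam).const_mul (N / d ^ lam / d ^ lam)
    simpa [hlam] using this
  have h7 := squeeze_zero (fun _ => sq_nonneg _) hb hlim
  rw [tendsto_zero_iff_norm_tendsto_zero]
  have h8 := h7.sqrt
  simpa using h8

lemma tendsto_inner_unitState_of_compact {T : H →L[ℂ] H} (hT : T ∈ compactOperators H)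
    {t : ℕ → ball (0 : ℂ) 1} (ht : Tendsto (fun n => ‖(t n : ℂ)‖) atTop (𝓝 1)) :
    Tendsto (fun n => ⟪unitState I (diagD (t n) ⟨0, by simp⟩),
      T (unitState I (diagD (t n) ⟨0, by simp⟩))⟫_ℂ) atTop (𝓝 0) :=
  tendsto_inner_of_isCompactOperator (isTotalFamily_coherentState I) hT
    (fun _ => (norm_unitState I _).le) fun W => tendsto_inner_unitState I ht W

lemma tendsto_one_sub_inv : Tendsto (fun n : ℕ => 1 - ((n : ℝ) + 2)⁻¹) atTop (𝓝 1) := by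
  have h1 : Tendsto (fun n : ℕ => (n : ℝ) + 2) atTop atTop :=
    tendsto_atTop_add_const_right _ _ tendsto_natCast_atTop_atTop
  simpa using (tendsto_inv_atTop_zero.comp h1).const_sub 1

/-- The maximum principle on the disc `s ↦ diag(s, 0)` finds points with `|s| → 1` at which `|f|` is
at least `|f(0)|`. There `f` is the expectation of `T` in a normalized coherent state, which tends
to zero. -/
lemma symbol_origin_eq_zero_of_compact {f : Mat2 → ℂ} {T : H →L[ℂ] H}
    (hf : IsAnnihilation I f T) (hT : T ∈ compactOperators H) : f originD = 0 := by
  -- `f` is not assumed holomorphic; it agrees on `𝔻` with the symbol of `T`, which is.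
  have hd : DifferentiableOn ℂ (fun s : ℂ => symbolOf I T (diagPoint s 0)) (ball 0 1) := by
    refine (differentiableOn_holFun _).comp (t := domainD) ?_
      (fun s hs => diagPoint_mem (by simpa using hs) (by simp))
    refine Differentiable.differentiableOn ?_
    refine differentiable_pi.2 fun i => differentiable_pi.2 fun j => ?_
    fin_cases i <;> fin_cases j <;> simp [diagPoint]
  have hex : ∀ n : ℕ, ∃ s : ball (0 : ℂ) 1, ‖(s : ℂ)‖ = 1 - ((n : ℝ) + 2)⁻¹ ∧
      ‖f originD‖ ≤ ‖f (diagD s ⟨0, by simp⟩)‖ := fun n => by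
    -- The shift by `2` keeps the radius positive at `n = 0`.
    set r : ℝ := 1 - ((n : ℝ) + 2)⁻¹ with hr
    have h2 : ((n : ℝ) + 2)⁻¹ ≤ 2⁻¹ := by gcongr; linarith [n.cast_nonneg (α := ℝ)]
    have hr0 : 0 < r := by
      have : (2 : ℝ)⁻¹ < 1 := by norm_num
      linarith
    have hr1 : r < 1 := by
      have : 0 < ((n : ℝ) + 2)⁻¹ := by positivity
      linarith
    have hsub : closedBall (0 : ℂ) r ⊆ ball 0 1 := closedBall_subset_ball hr1
    obtain ⟨s, hs, hmax⟩ := Complex.exists_mem_frontier_isMaxOn_norm (E := ℂ)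
      (U := ball (0 : ℂ) r) (f := fun s : ℂ => symbolOf I T (diagPoint s 0)) isBounded_ball
      ⟨0, mem_ball_self hr0⟩ (DifferentiableOn.diffContOnCl (hd.mono (by
        rw [closure_ball _ hr0.ne']; exact hsub)))
    rw [frontier_ball _ hr0.ne', mem_sphere_zero_iff_norm] at hs
    have hs1 : s ∈ ball (0 : ℂ) 1 := by simpa [hs] using hr1
    refine ⟨⟨s, hs1⟩, hs, ?_⟩
    have h3 : ‖symbolOf I T (diagPoint 0 0)‖ ≤ ‖symbolOf I T (diagPoint s 0)‖ :=
      hmax (subset_closure (mem_ball_self hr0))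
    have e0 : diagPoint 0 0 = ((originD : domainD) : Mat2) := by
      ext i j
      fin_cases i <;> fin_cases j <;> simp [diagPoint, originD]
    rw [e0] at h3
    rw [← hf.symbolOf_eq, ← hf.symbolOf_eq]
    exact h3
  choose s hs1 hs2 using hex
  have h1 := tendsto_inner_unitState_of_compact I hT (t := s) (by
    simp only [hs1]
    exact tendsto_one_sub_inv)
  have h2 : ∀ Z : domainD, ⟪unitState I Z, T (unitState I Z)⟫_ℂ = f Z := fun Z => by
    have e : T (unitState I Z) = f Z • unitState I Z := by
      rw [unitState, map_smul, hf, smul_comm]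
    rw [e, inner_smul_right, inner_self_eq_norm_sq_to_K, norm_unitState]
    simp
  simp only [h2] at h1
  have h3 := ge_of_tendsto' h1.norm hs2
  rw [norm_zero] at h3
  exact norm_le_zero_iff.1 h3

/-- Conjugating by a `U(g)` that moves `Z` to the origin keeps `T` compact and turns `f(Z)` into the
value of the new symbol at the origin. -/
lemma eq_zero_of_isAnnihilation_of_compact {f : Mat2 → ℂ} {T : H →L[ℂ] H}
    (hf : IsAnnihilation I f T) (hT : T ∈ compactOperators H) : T = 0 := by
  refine hf.unique (g := fun _ => 0) (fun Z => by simp) fun Z hZ => ?_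
  obtain ⟨g, hg⟩ := exists_moebius_eq_zero hZ
  have h1 := hf.conj_discreteSeries I g
  have h2 : (discreteSeries I g : H →L[ℂ] H) * T *
      ContinuousLinearMap.adjoint (discreteSeries I g : H →L[ℂ] H) ∈ compactOperators H :=
    (IsCompactOperator.clm_comp (show IsCompactOperator T from hT)
      (discreteSeries I g : H →L[ℂ] H)).comp_clm
        (ContinuousLinearMap.adjoint (discreteSeries I g : H →L[ℂ] H))
  have h3 := symbol_origin_eq_zero_of_compact I h1 h2
  have e : moebius (g⁻¹ : SU22).1.1 (originD : Mat2) = Z := by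
    have := moebius_inv_moebius g hZ
    rwa [hg] at this
  rwa [e] at h3

lemma polarizationPol_inter_compactOperators :
    (polarizationPol I : Set (H →L[ℂ] H)) ∩ compactOperators H = {0} := by
  refine Set.Subset.antisymm ?_ ?_
  · rintro T ⟨hT, hc⟩
    obtain ⟨f, hf⟩ := exists_isAnnihilation_of_mem_polarizationPol I hT
    exact eq_zero_of_isAnnihilation_of_compact I hf hc
  · rintro _ rfl
    exact ⟨zero_mem _, isCompactOperator_zero⟩

lemma polarization_inter_compactOperators :
    polarization I ∩ compactOperators H = {0} := by
  refine Set.Subset.antisymm ?_ ?_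
  · rintro T ⟨⟨f, -, hf⟩, hc⟩
    exact eq_zero_of_isAnnihilation_of_compact I hf hc
  · rintro _ rfl
    exact ⟨⟨0, ⟨differentiableOn_const 0, 0, fun _ _ => by simp⟩, fun Z => by simp⟩,
      isCompactOperator_zero⟩

/-- The commutator `[a₂₂, a₂₂*]`. -/
def coordCommutator : H →L[ℂ] H :=
  coordOp I 1 1 * star (coordOp I 1 1) - star (coordOp I 1 1) * coordOp I 1 1

/-- Test `a₂₂*|Z⟩` against `V = diag(t, 1/2)`, where `⟨V|a₂₂*|Z⟩ = ½ ⟨V|Z⟩`. With `q = 1 - |t|²`,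
both `⟨V|Z⟩` and `‖Z‖²` are `N q^(-λ)`, and `‖V‖²` is `N (3q/4)^(-λ)`. In Cauchy–Schwarz the powers
of `q` cancel, so the bound is uniform in `t`. -/
lemma norm_sq_star_coordOp_ge (t : ball (0 : ℂ) 1) :
    4⁻¹ * (3 / 4) ^ lam ≤ ‖star (coordOp I 1 1) (unitState I (diagD t ⟨0, by simp⟩))‖ ^ 2 := by
  set a := coordOp I 1 1
  set Z : domainD := diagD t ⟨0, by simp⟩ with hZ
  set V : domainD := diagD t ⟨2⁻¹, by simp; norm_num⟩ with hV
  set q : ℝ := 1 - ‖(t : ℂ)‖ ^ 2 with hq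
  have ht : ‖(t : ℂ)‖ < 1 := mem_ball_zero_iff.1 t.2
  have hq0 : 0 < q := by nlinarith [norm_nonneg (t : ℂ)]
  set N : ℝ := ‖coherentState I originD‖ ^ 2 with hN
  have hz0 : 0 < ‖coherentState I Z‖ := norm_pos_iff.2 (coherentState_ne_zero I Z)
  have hv0 : 0 < ‖coherentState I V‖ := norm_pos_iff.2 (coherentState_ne_zero I V)
  have hN0 : 0 < N := by
    have := norm_pos_iff.2 (coherentState_ne_zero I originD)
    positivity
  have e1 : ‖coherentState I Z‖ ^ 2 * q ^ lam = N := by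
    have h := norm_sq_mul_weight I Z
    have h3 : weight (Z : Mat2) = q := by rw [hZ, diagD, weight_diagPoint]; simp [hq]
    rwa [h3] at h
  have e2 : ‖coherentState I V‖ ^ 2 * (q * (3 / 4)) ^ lam = N := by
    have h := norm_sq_mul_weight I V
    have h3 : weight (V : Mat2) = q * (3 / 4) := by
      rw [hV, diagD, weight_diagPoint, norm_inv, Complex.norm_ofNat]
      norm_num [hq]
    rwa [h3] at h
  have e3 : ‖⟪coherentState I V, coherentState I Z⟫_ℂ‖ * q ^ lam = N := by
    have h := congrArg norm (inner_mul_detKernel I V Z)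
    have h3 : detKernel (V : Mat2) Z = (q : ℂ) := by
      rw [hV, hZ, diagD, diagD, detKernel_diagPoint, Complex.star_def, Complex.conj_mul']
      simp [hq]
    rwa [h3, norm_mul, norm_pow, Complex.norm_real, Real.norm_of_nonneg hq0.le,
      norm_vacuumNormSq] at h
  have h1 : 2⁻¹ * ‖⟪coherentState I V, coherentState I Z⟫_ℂ‖ ≤
      ‖coherentState I V‖ * ‖star a (coherentState I Z)‖ := by
    have h2 := norm_inner_le_norm (𝕜 := ℂ) (coherentState I V) (star a (coherentState I Z))
    rw [ContinuousLinearMap.star_eq_adjoint, ContinuousLinearMap.adjoint_inner_right,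
      isAnnihilation_coordOp I 1 1 V, inner_smul_left, norm_mul, RCLike.norm_conj] at h2
    have h3 : ‖(V : Mat2) 1 1‖ = 2⁻¹ := by simp [hV, diagD, diagPoint]
    rwa [h3] at h2
  have h4 : ‖star a (unitState I Z)‖ ^ 2 =
      ‖star a (coherentState I Z)‖ ^ 2 / ‖coherentState I Z‖ ^ 2 := by
    rw [unitState, map_smul, norm_smul, Complex.norm_real, norm_inv, norm_norm]
    field_simp
  have h5 := pow_le_pow_left₀ (by positivity) h1 2
  rw [mul_pow, mul_pow] at h5
  rw [h4, le_div_iff₀ (by positivity)]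
  have hql : 0 < q ^ lam := by positivity
  have hpl : (0 : ℝ) < (3 / 4) ^ lam := by positivity
  rw [mul_pow] at e2
  have e1' : ‖coherentState I Z‖ ^ 2 = N / q ^ lam := by rw [← e1]; field_simp
  have e2' : ‖coherentState I V‖ ^ 2 = N / (q ^ lam * (3 / 4) ^ lam) := by rw [← e2]; field_simp
  have e3' : ‖⟪coherentState I V, coherentState I Z⟫_ℂ‖ = N / q ^ lam := by rw [← e3]; field_simp
  rw [e2', e3'] at h5
  rw [e1']
  have h6 : (4⁻¹ * (3 / 4) ^ lam * (N / q ^ lam)) =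
      (2⁻¹ ^ 2 * (N / q ^ lam) ^ 2) / (N / (q ^ lam * (3 / 4) ^ lam)) := by
    field_simp
    norm_num
  rw [h6, div_le_iff₀ (by positivity)]
  linarith

/-- `a₂₂` kills the states at `diag(t, 0)`, so the expectation of the commutator there is `‖a₂₂*
u‖²`. This is bounded below, although `u` tends weakly to zero. -/
lemma coordCommutator_notMem_compactOperators : coordCommutator I ∉ compactOperators H := by
  intro hT
  let t : ℕ → ball (0 : ℂ) 1 := fun n => ⟨((1 - ((n : ℝ) + 2)⁻¹ : ℝ) : ℂ), by
    have h2 : ((n : ℝ) + 2)⁻¹ ≤ 2⁻¹ := by gcongr; linarith [n.cast_nonneg (α := ℝ)]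
    have h3 : 0 < ((n : ℝ) + 2)⁻¹ := by positivity
    have h4 : (2 : ℝ)⁻¹ < 1 := by norm_num
    rw [mem_ball_zero_iff, Complex.norm_real, Real.norm_eq_abs, abs_lt]
    constructor <;> linarith⟩
  have ht : Tendsto (fun n => ‖(t n : ℂ)‖) atTop (𝓝 1) := by
    have : Tendsto (fun n => (t n : ℂ)) atTop (𝓝 ((1 : ℝ) : ℂ)) :=
      (Complex.continuous_ofReal.tendsto 1).comp tendsto_one_sub_inv
    simpa using this.norm
  have h1 := (tendsto_inner_unitState_of_compact I hT ht).norm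
  have h2 : ∀ n, 4⁻¹ * (3 / 4) ^ lam ≤ ‖⟪unitState I (diagD (t n) ⟨0, by simp⟩),
      coordCommutator I (unitState I (diagD (t n) ⟨0, by simp⟩))⟫_ℂ‖ := fun n => by
    set Z := diagD (t n) ⟨0, by simp⟩ with hZ
    have h3 := norm_sq_star_coordOp_ge I (t n)
    have h4 : coordOp I 1 1 (unitState I Z) = 0 := by
      rw [unitState, map_smul, isAnnihilation_coordOp I 1 1 Z]
      simp [hZ, diagD, diagPoint]
    have h5 : ⟪unitState I Z, coordCommutator I (unitState I Z)⟫_ℂ =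
        ((‖star (coordOp I 1 1) (unitState I Z)‖ ^ 2 : ℝ) : ℂ) := by
      rw [coordCommutator, sub_apply, mul_apply_eq_comp, mul_apply_eq_comp, h4, map_zero, sub_zero,
        ← ContinuousLinearMap.adjoint_inner_left, ← ContinuousLinearMap.star_eq_adjoint,
        inner_self_eq_norm_sq_to_K]
      simp
    rw [h5, Complex.norm_real, Real.norm_of_nonneg (sq_nonneg _)]
    exact h3
  have h3 := ge_of_tendsto' h1 h2
  rw [norm_zero] at h3
  have : (0 : ℝ) < 4⁻¹ * (3 / 4) ^ lam := by positivity
  linarith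

/-- The two states are eigenvectors of `a₁₁` with eigenvalues `0` and `1/2`. They provide the
dimension bound needed to rule out the zero ideal. -/
lemma linearIndependent_coherentState : LinearIndependent ℂ ![coherentState I originD,
    coherentState I (diagD ⟨2⁻¹, by simp; norm_num⟩ ⟨0, by simp⟩)] := by
  rw [LinearIndependent.pair_iff]
  intro a b hab
  have h1 := congrArg (fun x => ⟪constState I, x⟫_ℂ) hab
  have h2 := congrArg (coordOp I 0 0) hab
  simp only [inner_add_right, inner_smul_right, inner_constState, inner_zero_right] at h1
  rw [map_add, map_smul, map_smul, isAnnihilation_coordOp I 0 0, isAnnihilation_coordOp I 0 0] at h2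
  have h3 : b = 0 := by
    simpa [originD, diagD, diagPoint, coherentState_ne_zero] using h2
  subst h3
  simpa using h1

end Boundary

/-! ### Assembly, for any closed star subalgebra containing `ℳ⁺⁺_pol` -/

section Main

variable {lam : ℕ} [Fact (3 < lam)] {H : Type*} [NormedAddCommGroup H] [InnerProductSpace ℂ H]
  [CompleteSpace H] (I : H ≃ₗᵢ⋆[ℂ] bergmanSpace lam) {M : StarSubalgebra ℂ (H →L[ℂ] H)}

lemma actsIrreducibly_of_phaseSpacePol_le (h : phaseSpacePol I ≤ M) :
    ActsIrreducibly (M : Set (H →L[ℂ] H)) :=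
  haveI : Nontrivial H := ⟨_, _, coherentState_ne_zero I originD⟩
  actsIrreducibly_of_rankOne_mem (isTotalFamily_coherentState I)
    fun W Z => h (rankOne_coherentState_mem I W Z)

lemma stronglyDense_of_phaseSpacePol_le (hM : IsClosed (M : Set (H →L[ℂ] H)))
    (h : phaseSpacePol I ≤ M) : StronglyDense (M : Set (H →L[ℂ] H)) :=
  stronglyDense_of_rankOne_mem (S := Subalgebra.toSubmodule M.toSubalgebra)
    (rankOne_mem_of_isTotalFamily (isTotalFamily_coherentState I) hM
      fun W Z => h (rankOne_coherentState_mem I W Z))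

lemma compactOperators_subset_of_phaseSpacePol_le (hM : IsClosed (M : Set (H →L[ℂ] H)))
    (h : phaseSpacePol I ≤ M) : compactOperators H ⊆ (M : Set (H →L[ℂ] H)) :=
  compactOperators_subset (S := Subalgebra.toSubmodule M.toSubalgebra)
    (isTotalFamily_coherentState I) hM fun W Z => h (rankOne_coherentState_mem I W Z)

lemma compactOperators_subset_idealOperators_of_phaseSpacePol_le
    (hM : IsClosed (M : Set (H →L[ℂ] H))) (h : phaseSpacePol I ≤ M) (J : TwoSidedIdeal M)
    (hJ : IsClosed (J : Set M)) (hirr : ActsIrreducibly (idealOperators J)) :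
    compactOperators H ⊆ idealOperators J :=
  compactOperators_subset_idealOperators (isTotalFamily_coherentState I) hM
    (fun W Z => h (rankOne_coherentState_mem I W Z)) (linearIndependent_coherentState I) J hJ hirr

/-- The single commutator `[a₂₂, a₂₂*]` does both jobs: being nonzero, it forces the closed ideal to
contain all compact operators, and being non-compact, it makes the inclusion strict. -/
lemma compactOperators_ssubset_commutatorIdeal (hM : IsClosed (M : Set (H →L[ℂ] H)))
    (h : phaseSpacePol I ≤ M) : compactOperators H ⊂ commutatorIdeal M := by
  have ha : coordOp I 1 1 ∈ M := h (coordOp_mem_phaseSpacePol I 1 1)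
  let a : M := ⟨coordOp I 1 1, ha⟩
  let b : M := ⟨star (coordOp I 1 1), star_mem ha⟩
  have hab : a * b - b * a ∈ TwoSidedIdeal.span {x : M | ∃ a b : M, x = a * b - b * a} :=
    TwoSidedIdeal.subset_span ⟨a, b, rfl⟩
  have hval : ((a * b - b * a : M) : H →L[ℂ] H) = coordCommutator I := rfl
  have hnc := coordCommutator_notMem_compactOperators I
  have hne : a * b - b * a ≠ 0 := fun h0 => hnc (by
    rw [← hval, h0]
    exact isCompactOperator_zero)
  refine (Set.ssubset_iff_of_subset ?_).2 ⟨_, ⟨_, subset_closure hab, hval⟩, hnc⟩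
  exact compactOperators_subset_closure_ideal (isTotalFamily_coherentState I) hM
    (fun W Z => h (rankOne_coherentState_mem I W Z)) _ hab hne

end Main

end ConformalToeplitz
end

theorem proposition41 (lam : ℕ) [Fact (3 < lam)]
    {H : Type*} [NormedAddCommGroup H] [InnerProductSpace ℂ H] [CompleteSpace H]
    (I : H ≃ₗᵢ⋆[ℂ] bergmanSpace lam) :
    (ActsIrreducibly (phaseSpacePol I : Set (H →L[ℂ] H)) ∧
      (polarizationPol I : Set (H →L[ℂ] H)) ∩ adjointSet (polarizationPol I : Set (H →L[ℂ] H)) =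
        scalarOperators H) ∧
    (WeaklyDense (phaseSpacePol I : Set (H →L[ℂ] H)) ∧
      StronglyDense (phaseSpacePol I : Set (H →L[ℂ] H))) ∧
    (compactOperators H ⊆ (phaseSpacePol I : Set (H →L[ℂ] H)) ∧
      ∀ J : TwoSidedIdeal (phaseSpacePol I), IsClosed (J : Set (phaseSpacePol I)) →
        ActsIrreducibly (idealOperators J) → compactOperators H ⊆ idealOperators J) ∧
    (∃ U : SU22 →* unitary (H →L[ℂ] H), IsDiscreteSeries I U ∧
      ∀ g : SU22, ∀ X ∈ phaseSpacePol I,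
        (U g : H →L[ℂ] H) * X * ContinuousLinearMap.adjoint (U g : H →L[ℂ] H) ∈
          phaseSpacePol I) ∧
    (polarizationPol I : Set (H →L[ℂ] H)) ∩ compactOperators H = {0} ∧
    compactOperators H ⊂ commutatorIdeal (phaseSpacePol I) ∧
    ((ActsIrreducibly (phaseSpace I : Set (H →L[ℂ] H)) ∧
      polarization I ∩ adjointSet (polarization I) = scalarOperators H) ∧
    (WeaklyDense (phaseSpace I : Set (H →L[ℂ] H)) ∧
      StronglyDense (phaseSpace I : Set (H →L[ℂ] H))) ∧
    (compactOperators H ⊆ (phaseSpace I : Set (H →L[ℂ] H)) ∧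
      ∀ J : TwoSidedIdeal (phaseSpace I), IsClosed (J : Set (phaseSpace I)) →
        ActsIrreducibly (idealOperators J) → compactOperators H ⊆ idealOperators J) ∧
    polarization I ∩ compactOperators H = {0} ∧
    compactOperators H ⊂ commutatorIdeal (phaseSpace I)) := by
  have hc := isClosed_phaseSpacePol I
  have hc' := isClosed_phaseSpace I
  have hle := phaseSpacePol_le_phaseSpace I
  refine ⟨⟨actsIrreducibly_of_phaseSpacePol_le I le_rfl, polarizationPol_inter_adjointSet I⟩,
    ⟨weaklyDense_of_stronglyDense (stronglyDense_of_phaseSpacePol_le I hc le_rfl),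
      stronglyDense_of_phaseSpacePol_le I hc le_rfl⟩,
    ⟨compactOperators_subset_of_phaseSpacePol_le I hc le_rfl,
      compactOperators_subset_idealOperators_of_phaseSpacePol_le I hc le_rfl⟩,
    ⟨discreteSeries I, isDiscreteSeries_discreteSeries I,
      fun g X hX => conj_discreteSeries_mem I g hX⟩,
    polarizationPol_inter_compactOperators I,
    compactOperators_ssubset_commutatorIdeal I hc le_rfl,
    ⟨actsIrreducibly_of_phaseSpacePol_le I hle, polarization_inter_adjointSet I⟩,
    ⟨weaklyDense_of_stronglyDense (stronglyDense_of_phaseSpacePol_le I hc' hle),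
      stronglyDense_of_phaseSpacePol_le I hc' hle⟩,
    ⟨compactOperators_subset_of_phaseSpacePol_le I hc' hle,
      compactOperators_subset_idealOperators_of_phaseSpacePol_le I hc' hle⟩,
    polarization_inter_compactOperators I,
    compactOperators_ssubset_commutatorIdeal I hc' hle⟩
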